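/- Let $\sigma$ be arc length measure on the unit circle $S^1\subset\mathbb R^2$, let functions be complex valued, let $R_t$ denote rotation of $S^1$ by $t$ radians, and let $X$ be the vector field on $S^1$ generating $R_t$. For $s>0$ write $s=k+\alpha$ with $k\in\{0,1,2,\dots\}$ and $\alpha\in(0,1]$ (so $k=\lfloor s\rfloor$ if $s\notin\mathbb Z$), and let $\mathcal H^s=\mathcal H^s(S^1)$ be the set of all $f\in L^2(S^1)=L^2(\sigma)$ whose weak derivatives $X^mf$, $0\le m\le k$, lie in $L^2(S^1)$ and for which $$\|f\|_{\mathcal H^s}=\|f\|_{L^2(S^1)}+2\sum_{m=0}^{k}\ \sup_{0<|t|\le1}\frac{\|(X^mf)\circ R_t-X^mf\|_{L^2(S^1)}}{|t|^{\alpha}}<\infty .$$ A function $F\in L^2(S^1)$ is called the restriction to $S^1$ of a complex measure $\mu$ on $\mathbb R^2$ if the averages $\mu(B(x,r))/|B(x,r)|$ over discs converge to $F(x)$ in $L^2(S^1,d\sigma(x))$ as $r\to0^+$. **Proposition.** For every $\varepsilon>0$ there exist $\delta\in(0,1)$ and $C_\varepsilon<\infty$ such that, for all $f_1,\dots,f_4\in\mathcal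 H^\varepsilon(S^1)$ and all $h\in L^2(S^1)$, the convolution of measures $f_1\sigma*f_2\sigma*f_3\sigma*f_4\sigma*h\sigma$ has a restriction $F\in L^2(S^1)$ to $S^1$, and $F\in\mathcal H^\delta(S^1)$ with $$\|F\|_{\mathcal H^\delta}\le C_\varepsilon\,\prod_{j=1}^4\|f_j\|_{\mathcal H^\varepsilon}\,\|h\|_{L^2(S^1)} .$$ -/

import Mathlib

open MeasureTheory Filter Topology
open scoped ENNReal NNReal

noncomputable section

namespace CircleConv

instance : MeasurableSpace Circle := borel Circle

instance : BorelSpace Circle := ⟨rfl⟩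

/-- Arc length measure `σ` on the unit circle `S¹ ⊂ ℝ² = ℂ`, of total mass `2π`. -/
def σ : Measure Circle :=
  (volume.restrict (Set.Ioc (-Real.pi) Real.pi)).map Circle.exp

/-- The flow `exp(tX) x` of the unit rotation field on `S¹`: rotation of `x` by `t` radians. -/
def rot (t : ℝ) (x : Circle) : Circle := Circle.exp t * x

/-- The derivative `Xφ` of a function along the rotation field. -/
def rotDeriv (φ : Circle → ℂ) (x : Circle) : ℂ := deriv (fun t : ℝ => φ (rot t x)) 0

/-- `φ` is a smooth function on the circle (read in the angular coordinate). -/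
def IsSmooth (φ : Circle → ℂ) : Prop := ContDiff ℝ ((⊤ : ℕ∞) : WithTop ℕ∞) (fun θ : ℝ => φ (Circle.exp θ))

/-- `g ∈ L²(S¹)` is the `m`-th weak (distributional) derivative `X^m f` of `f`. -/
def IsWeakDeriv (m : ℕ) (f g : Circle → ℂ) : Prop :=
  MemLp g 2 σ ∧ ∀ φ : Circle → ℂ, IsSmooth φ →
    ∫ x, f x * (rotDeriv^[m] φ) x ∂σ = (-1) ^ m * ∫ x, g x * φ x ∂σ

/-- `∑_{j=1}^{2} sup_{0<|t|≤1} ‖g ∘ exp(tX_j) - g‖_{L²} / |t|^α`. Rotations of the plane form a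
one-parameter group, so both fields `X_1`, `X_2` are the rotation field `X`. -/
def holderSeminorm (α : ℝ) (g : Circle → ℂ) : ℝ≥0∞ :=
  ∑ _j : Fin 2, ⨆ t : ℝ, ⨆ _ : 0 < |t| ∧ |t| ≤ 1,
    eLpNorm (fun x => g (rot t x) - g x) 2 σ / ENNReal.ofReal (|t| ^ α)

/-- The integer part `k` in `s = k + α`, `α ∈ (0, 1]`, for `s > 0`; it is `⌊s⌋` unless `s` is an
integer. -/
def ordInt (s : ℝ) : ℕ := ⌈s⌉₊ - 1

/-- The norm of `𝓗^s(S¹)`, `s > 0`: with `s = k + α`,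
`‖f‖_{L²} + ∑_{m ≤ k} ∑_j sup_{0<|t|≤1} ‖X^m f ∘ exp(tX_j) - X^m f‖_{L²} / |t|^α`.
All `g` admissible in the infimum agree almost everywhere, so the infimum only evaluates the
seminorm at `X^m f`; it is `∞` if `f` has no `m`-th weak derivative in `L²`. -/
def HNorm (s : ℝ) (f : Circle → ℂ) : ℝ≥0∞ :=
  eLpNorm f 2 σ + ∑ m ∈ Finset.range (ordInt s + 1),
    ⨅ g : Circle → ℂ, ⨅ _ : IsWeakDeriv m f g, holderSeminorm (s - ordInt s) g

/-- Membership in `𝓗^s(S¹)`, `s > 0`. -/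
def MemH (s : ℝ) (f : Circle → ℂ) : Prop := MemLp f 2 σ ∧ HNorm s f < ⊤

/-- The convolution `f₁σ ∗ ⋯ ∗ fₙσ`, a complex measure on `ℝ² = ℂ`: the image of the product
of the measures `fᵢσ` under addition. -/
def convMeasure {n : ℕ} (f : Fin n → Circle → ℂ) : ComplexMeasure ℂ :=
  ((Measure.pi fun _ : Fin n => σ).withDensityᵥ fun y => ∏ i, f i (y i)).map
    fun y => ∑ i, (y i : ℂ)

/-- `F ∈ L²(S¹)` is the restriction (trace) to `S¹` of (the density of) the complex measure `μ`
on the plane: the averages of `μ` over discs of radius `r` centred at points of `S¹` converge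
to `F` in `L²(S¹)` as `r → 0`. -/
def IsRestriction (μ : ComplexMeasure ℂ) (F : Circle → ℂ) : Prop :=
  MemLp F 2 σ ∧
    Tendsto (fun r : ℝ => eLpNorm (fun x : Circle =>
      μ (Metric.ball (x : ℂ) r) / ((volume.real (Metric.ball (x : ℂ) r) : ℝ) : ℂ) - F x) 2 σ)
      (𝓝[>] 0) (𝓝 0)

end CircleConv

end

noncomputable section

namespace CircleConv

open Set

/-! ### Arc length measure -/

/-! The averages of the fivefold convolution over discs of radius `r` form a family `G r` of
functions on the circle. The proof shows that it is Cauchy in `L²` with a power rate in `r`, and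
that `G r` varies little under small rotations. Only `f 0` and `f 1` need regularity; the other
three factors enter through their `L²` norms.

Size. Testing against `g` in `L²` gives an integral over six points of the circle, grouped in three
pairs, with a kernel `χ` evaluated at a signed sum of the points. The map from a pair `(x, y)` to `x
+ y` or `x - y` sends `gap x y` times arc length squared to at most twice Lebesgue measure, so
integrating a pair weighted by `gap` replaces `χ` by `2 ∫ χ`. Hölder's inequality with three
exponents `3`, in which each pair carries the weight `gap` in one factor and its energy density
`P^(3/2) gap^(-1/2)` in the other two, yields `trilinear_le`. The energy of a tensor product is
controlled by `L²` norms through a Hardy-Littlewood-Sobolev inequality, `energy_mul_le`. Hence every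
kernel `χ` gives an `L²` bound proportional to its integral (`l2_posOp_tensor_le`).

Cancellation. A difference of two normalised disc indicators is the divergence of a radial field
whose Newtonian tails cancel, and whose `L¹` norm is therefore of the order of the radii. To
integrate by parts along the torus of pairs, `f 0` and `f 1` are replaced by arc averages with
bounded derivatives, and the pairs at which `(x, y) ↦ x + y` degenerates are cut off by `sep κ`. The
replacement costs the `L²` modulus of continuity, the cutoff costs a power of `κ` because its
complement has small energy, and the main term gains the radius. Powers of one scale `η` balance
these costs in `l2_convOp_discSub_le`.

Regularity. The power rate gives the limit `F`. A rotation by `t` moves a disc of radius `r` only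
within an annulus of relative mass `4 |t| / r`; comparing `F` with `G r` for `r = |t|^(1/2)` gives
its Hölder exponent in `exists_discConv_limit`. -/

theorem measurePreserving_exp (a : ℝ) :
    MeasurePreserving Circle.exp (volume.restrict (Ioc a (a + 2 * Real.pi))) σ := by
  have : Fact (0 < 2 * Real.pi) := ⟨Real.two_pi_pos⟩
  have hm : Measurable (AddCircle.homeomorphCircle' : AddCircle (2 * Real.pi) → Circle) :=
    AddCircle.homeomorphCircle'.continuous.measurable
  have key : ∀ c : ℝ, (volume.restrict (Ioc c (c + 2 * Real.pi))).map Circle.exp =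
      (volume : Measure (AddCircle (2 * Real.pi))).map AddCircle.homeomorphCircle' := by
    intro c
    rw [← (AddCircle.measurePreserving_mk (2 * Real.pi) c).map_eq,
      Measure.map_map hm (AddCircle.measurePreserving_mk (2 * Real.pi) c).measurable]
    rfl
  refine ⟨Circle.exp.continuous.measurable, ?_⟩
  rw [key a, ← key (-Real.pi), σ]
  congr 3
  ring

theorem measurePreserving_exp_Ioc :
    MeasurePreserving Circle.exp (volume.restrict (Ioc (-Real.pi) Real.pi)) σ :=
  ⟨Circle.exp.continuous.measurable, rfl⟩

instance : IsFiniteMeasure σ := by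
  unfold σ; infer_instance

theorem measurePreserving_mul_left (w : Circle) : MeasurePreserving (fun x => w * x) σ σ := by
  obtain ⟨t, rfl⟩ := Circle.exp_surjective w
  refine ⟨(continuous_const_mul _).measurable, ?_⟩
  have h1 := measurePreserving_exp (-Real.pi)
  have h2 := measurePreserving_exp (t + -Real.pi)
  have h3 : MeasurePreserving (fun θ : ℝ => t + θ)
      (volume.restrict (Ioc (-Real.pi) (-Real.pi + 2 * Real.pi)))
      (volume.restrict (Ioc (t + -Real.pi) (t + -Real.pi + 2 * Real.pi))) := by
    have := (measurePreserving_add_left (volume : Measure ℝ) t).restrict_preimage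
      (measurableSet_Ioc (a := t + -Real.pi) (b := t + -Real.pi + 2 * Real.pi))
    convert this using 3
    ext θ
    simp only [mem_Ioc, mem_preimage]
    constructor <;> rintro ⟨h, h'⟩ <;> constructor <;> linarith
  rw [← h1.map_eq, Measure.map_map (continuous_const_mul _).measurable h1.measurable, h1.map_eq,
    ← (h2.comp h3).map_eq]
  congr 1
  ext θ
  simp [Circle.exp_add]

theorem measurePreserving_neg : MeasurePreserving (fun x : Circle => -x) σ σ := by
  simpa using measurePreserving_mul_left (-1)

theorem measurePreserving_rot (t : ℝ) : MeasurePreserving (rot t) σ σ :=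
  measurePreserving_mul_left _

theorem lintegral_mul_left_eq (w : Circle) {f : Circle → ℝ≥0∞} (hf : Measurable f) :
    ∫⁻ x, f (w * x) ∂σ = ∫⁻ x, f x ∂σ :=
  (measurePreserving_mul_left w).lintegral_comp hf

theorem lintegral_exp {f : Circle → ℝ≥0∞} (hf : Measurable f) :
    ∫⁻ x, f x ∂σ = ∫⁻ θ in Ioc (-Real.pi) Real.pi, f (Circle.exp θ) :=
  (measurePreserving_exp_Ioc.lintegral_comp hf).symm

theorem measure_univ_eq : σ univ = ENNReal.ofReal (2 * Real.pi) := by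
  rw [← measurePreserving_exp_Ioc.measure_preimage MeasurableSet.univ.nullMeasurableSet]
  simp [two_mul]

/-! ### The transversality weight -/

/-- The absolute value of the sine of the angle between `x` and `y`. -/
def gap (x y : Circle) : ℝ≥0∞ := ‖((x / y : Circle) : ℂ).im‖ₑ

theorem gap_eq (x y : Circle) : gap x y = ‖((x : ℂ) * (starRingEnd ℂ) y).im‖ₑ := by
  rw [gap, div_eq_mul_inv, Circle.coe_mul, Circle.coe_inv_eq_conj]

@[fun_prop]
theorem measurable_gap : Measurable (fun p : Circle × Circle => gap p.1 p.2) := by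
  simp_rw [gap_eq]
  have : Continuous fun p : Circle × Circle => ((p.1 : ℂ) * (starRingEnd ℂ) p.2).im := by
    fun_prop
  exact this.measurable.enorm

theorem gap_comm (x y : Circle) : gap x y = gap y x := by
  have : (x / y : Circle) = (y / x)⁻¹ := by simp
  rw [gap, gap, this, Circle.coe_inv_eq_conj, Complex.conj_im, enorm_neg]

theorem gap_neg_right (x y : Circle) : gap x (-y) = gap x y := by
  simp [gap, div_neg]

theorem gap_mul_left (w x y : Circle) : gap (w * x) (w * y) = gap x y := by
  simp [gap, mul_div_mul_left_eq_div]

theorem im_exp (θ : ℝ) : ((Circle.exp θ : Circle) : ℂ).im = Real.sin θ := by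
  rw [Circle.coe_exp, Complex.exp_ofReal_mul_I_im]

theorem gap_exp (α β : ℝ) : gap (Circle.exp α) (Circle.exp β) = ‖Real.sin (α - β)‖ₑ := by
  rw [gap, ← Circle.exp_sub, im_exp]

theorem gap_le_one (x y : Circle) : gap x y ≤ 1 := by
  have h1 := Complex.abs_im_le_norm ((x / y : Circle) : ℂ)
  rw [Circle.norm_coe] at h1
  rw [gap, Real.enorm_eq_ofReal_abs]
  exact ENNReal.ofReal_le_one.2 h1

theorem lintegral_eq_two_mul_of_even {f : ℝ → ℝ≥0∞} (hf : ∀ x, f (-x) = f x) :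
    ∫⁻ x, f x = 2 * ∫⁻ x in Ioi 0, f x := by
  rw [← lintegral_add_compl f (measurableSet_Ioi (a := (0 : ℝ))), compl_Ioi, two_mul,
    setLIntegral_congr Iio_ae_eq_Iic.symm]
  congr 1
  have h := (Measure.measurePreserving_neg (volume : Measure ℝ)).setLIntegral_comp_preimage_emb
    (MeasurableEquiv.neg ℝ).measurableEmbedding f (Iio 0)
  rw [← h]
  simp [hf]

theorem lintegral_comp_mul_left_Ioi (f : ℝ → ℝ≥0∞) {a : ℝ} (ha : 0 < a) :
    ENNReal.ofReal a * ∫⁻ x in Ioi 0, f (a * x) = ∫⁻ x in Ioi 0, f x := by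
  have h := lintegral_image_eq_lintegral_abs_deriv_mul (s := Ioi (0 : ℝ)) (f := fun x => a * x)
    (f' := fun _ => a) measurableSet_Ioi
    (fun x _ => by simpa using ((hasDerivAt_id x).const_mul a).hasDerivWithinAt)
    (fun x _ y _ hxy => by simpa [ha.ne'] using hxy) f
  have himg : (fun x => a * x) '' Ioi (0 : ℝ) = Ioi 0 := by
    simp [Set.image_mul_left_Ioi ha]
  rw [himg, abs_of_pos ha, lintegral_const_mul' _ _ ENNReal.ofReal_ne_top] at h
  exact h.symm

/-- Every angle in a period is within `π / 2` of `0`, `π` or `-π`, and there the sine is at least `2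
/ π` times the distance. Three such points, two signs and the dilation by `π / 2` give the factor
`3π ≤ 10`. -/
theorem lintegral_comp_gap_le {F : ℝ≥0∞ → ℝ≥0∞} (hF : Antitone F) (x : Circle) :
    ∫⁻ y, F (gap x y) ∂σ ≤ 10 * ∫⁻ v in Ioi (0 : ℝ), F (ENNReal.ofReal v) := by
  have hpi := Real.pi_pos
  have hFm : Measurable F := hF.measurable
  have hg : Measurable fun y => F (gap x y) :=
    hFm.comp (measurable_gap.comp (measurable_const.prodMk measurable_id))
  rw [← lintegral_mul_left_eq x hg, lintegral_exp (by
    exact hg.comp (measurePreserving_mul_left x).measurable)]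
  set G : ℝ → ℝ≥0∞ := fun v => F (ENNReal.ofReal (2 / Real.pi * |v|)) with hG
  have hGm : Measurable G := by
    apply hFm.comp
    fun_prop
  have h1 : ∀ θ ∈ Ioc (-Real.pi) Real.pi, F (gap x (x * Circle.exp θ)) ≤
      G θ + G (θ + Real.pi) + G (θ + -Real.pi) := by
    intro θ hθ
    have e : gap x (x * Circle.exp θ) = ENNReal.ofReal |Real.sin θ| := by
      have := gap_mul_left x 1 (Circle.exp θ)
      rw [mul_one] at this
      rw [this, ← Circle.exp_zero, gap_exp, Real.enorm_eq_ofReal_abs]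
      simp
    have hz : ∀ v, |v| ≤ Real.pi / 2 → |Real.sin v| = |Real.sin θ| →
        F (gap x (x * Circle.exp θ)) ≤ G v := by
      intro v hv hs
      rw [e, ← hs]
      exact hF (ENNReal.ofReal_le_ofReal (Real.mul_abs_le_abs_sin hv))
    rcases le_or_gt |θ| (Real.pi / 2) with h | h
    · exact (hz θ h rfl).trans (by rw [add_assoc]; exact le_self_add)
    · rcases lt_abs.1 h with h | h
      · refine (hz (θ + -Real.pi) (abs_le.2 ⟨by linarith, by linarith [hθ.2]⟩) ?_).trans
          le_add_self
        rw [← sub_eq_add_neg, Real.sin_sub_pi, abs_neg]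
      · refine (hz (θ + Real.pi) (abs_le.2 ⟨by linarith [hθ.1], by linarith⟩) ?_).trans
          ((le_add_self : _ ≤ G θ + _).trans le_self_add)
        rw [Real.sin_add_pi, abs_neg]
  calc ∫⁻ θ in Ioc (-Real.pi) Real.pi, F (gap x (x * Circle.exp θ))
      ≤ ∫⁻ θ in Ioc (-Real.pi) Real.pi, (G θ + G (θ + Real.pi) + G (θ + -Real.pi)) :=
        setLIntegral_mono (by fun_prop) h1
    _ ≤ ∫⁻ θ, (G θ + G (θ + Real.pi) + G (θ + -Real.pi)) := setLIntegral_le_lintegral _ _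
    _ = 3 * ∫⁻ θ, G θ := by
        rw [lintegral_add_right _ (by fun_prop), lintegral_add_right _ (by fun_prop),
          lintegral_add_right_eq_self G, lintegral_add_right_eq_self G]
        ring
    _ = 3 * (2 * ∫⁻ v in Ioi (0 : ℝ), F (ENNReal.ofReal (2 / Real.pi * v))) := by
        rw [lintegral_eq_two_mul_of_even (fun v => by simp [hG])]
        congr 2
        refine setLIntegral_congr_fun measurableSet_Ioi fun v hv => ?_
        simp only [hG, abs_of_pos (mem_Ioi.1 hv)]
    _ = ENNReal.ofReal (3 * Real.pi) * ∫⁻ v in Ioi (0 : ℝ), F (ENNReal.ofReal v) := by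
        have h2 : (0 : ℝ) < 2 / Real.pi := by positivity
        rw [← lintegral_comp_mul_left_Ioi (fun v => F (ENNReal.ofReal v)) h2, ← mul_assoc,
          ← mul_assoc, ← ENNReal.ofReal_mul (by positivity)]
        congr 1
        rw [show (3 : ℝ) * Real.pi * (2 / Real.pi) = 3 * 2 by field_simp]
        simp [ENNReal.ofReal_mul]
    _ ≤ 10 * ∫⁻ v in Ioi (0 : ℝ), F (ENNReal.ofReal v) := by
        gcongr
        rw [ENNReal.ofReal_le_iff_le_toReal (by simp)]
        have := Real.pi_lt_d2
        norm_num
        linarith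

theorem lintegral_eq_polar {φ : ℂ → ℝ≥0∞} (hφ : Measurable φ) (b : ℂ) :
    ∫⁻ z, φ z = ∫⁻ ρ in Ioi (0 : ℝ), ENNReal.ofReal ρ * ∫⁻ y : Circle, φ (ρ * y + b) ∂σ := by
  have h (p : ℝ × ℝ) : ENNReal.ofReal p.1 • φ (Complex.polarCoord.symm p + b) =
      ENNReal.ofReal p.1 * φ (p.1 * (Circle.exp p.2 : Circle) + b) := by
    rw [Complex.polarCoord_symm_apply, Circle.coe_exp, Complex.exp_mul_I, smul_eq_mul]
    push_cast
    rfl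
  rw [← lintegral_add_right_eq_self φ b, ← Complex.lintegral_comp_polarCoord_symm]
  simp_rw [h]
  rw [show polarCoord.target = Ioi (0 : ℝ) ×ˢ Ioo (-Real.pi) Real.pi from rfl,
    Measure.volume_eq_prod, ← Measure.prod_restrict]
  have hm : Measurable fun p : ℝ × ℝ =>
      ENNReal.ofReal p.1 * φ (p.1 * (Circle.exp p.2 : Circle) + b) := by
    have : Measurable Circle.exp := Circle.exp.continuous.measurable
    fun_prop
  rw [lintegral_prod _ hm.aemeasurable]
  refine lintegral_congr fun ρ => ?_
  have hm' : Measurable fun y : ℝ => φ (ρ * (Circle.exp y : Circle) + b) := by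
    have : Measurable Circle.exp := Circle.exp.continuous.measurable
    fun_prop
  dsimp only
  rw [lintegral_const_mul _ hm', lintegral_exp (by fun_prop), setLIntegral_congr Ioo_ae_eq_Ioc]

/-- The image of `|sin(α - β)| dα dβ` under `(α, β) ↦ exp(iα) + exp(iβ)` is at most twice Lebesgue
measure. -/
theorem lintegral_gap_mul_comp_add {φ : ℂ → ℝ≥0∞} (hφ : Measurable φ) (b : ℂ) :
    ∫⁻ y, ∫⁻ x, gap x y * φ (x + y + b) ∂σ ∂σ ≤ 2 * ∫⁻ z, φ z := by
  have hpi := Real.pi_pos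
  set Q : ℝ → ℝ≥0∞ := fun ρ => ∫⁻ y : Circle, φ (ρ * y + b) ∂σ with hQ
  have hQm : Measurable Q := by
    apply Measurable.lintegral_prod_right
    fun_prop
  -- Rotation invariance absorbs the unimodular factor in `exp(iψ) + 1 = 2 cos(ψ/2) exp(iψ/2)`.
  have hQrot : ∀ (ρ : ℝ) (w : Circle), ∫⁻ y : Circle, φ (ρ * (w * y) + b) ∂σ = Q ρ := by
    intro ρ w
    exact lintegral_mul_left_eq w (f := fun y : Circle => φ (ρ * y + b)) (by fun_prop)
  have hQeven : ∀ ρ, Q (-ρ) = Q ρ := by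
    intro ρ
    rw [← hQrot ρ (-1)]
    simp [hQ]
  have h1 : ∀ y : Circle, ∫⁻ x, gap x y * φ (x + y + b) ∂σ =
      ∫⁻ w : Circle, gap w 1 * φ ((w + 1) * y + b) ∂σ := by
    intro y
    rw [← lintegral_mul_left_eq y (by fun_prop)]
    refine lintegral_congr fun w => ?_
    have := gap_mul_left y w 1
    rw [mul_one] at this
    rw [this]
    congr 2
    push_cast
    ring
  have h2 : ∀ ψ : ℝ, ∫⁻ y : Circle, φ (((Circle.exp ψ : Circle) + 1) * y + b) ∂σ =
      Q (2 * Real.cos (ψ / 2)) := by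
    intro ψ
    rw [← hQrot _ (Circle.exp (ψ / 2))]
    refine lintegral_congr fun y => ?_
    congr 2
    have : ((Circle.exp ψ : Circle) : ℂ) + 1 = 2 * Complex.cos (ψ / 2) * Complex.exp (ψ / 2 * Complex.I) := by
      rw [Circle.coe_exp, Complex.cos, mul_div_cancel₀ _ two_ne_zero, add_mul, ← Complex.exp_add, ← Complex.exp_add,
        ← add_mul, ← add_mul, add_halves, neg_add_cancel, zero_mul, Complex.exp_zero]
    rw [this, Circle.coe_exp]
    push_cast
    ring
  have h3 : ∫⁻ y, ∫⁻ x, gap x y * φ (x + y + b) ∂σ ∂σ =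
      ∫⁻ ψ in Ioc (0 : ℝ) (0 + 2 * Real.pi), ‖Real.sin ψ‖ₑ * Q (2 * Real.cos (ψ / 2)) := by
    simp_rw [h1]
    rw [lintegral_lintegral_swap (by fun_prop)]
    rw [← (measurePreserving_exp 0).lintegral_comp (by
      apply Measurable.lintegral_prod_right
      fun_prop)]
    refine lintegral_congr fun ψ => ?_
    rw [lintegral_const_mul _ (by fun_prop), h2, ← Circle.exp_zero, gap_exp, sub_zero]
  -- With `ρ = 2 cos(ψ/2)`, injective on the period, `|sin ψ|` equals `|ρ|` times `|dρ/dψ|`: the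
  -- weight is exactly the polar Jacobian.
  have h4 : ∫⁻ ψ in Ioc (0 : ℝ) (0 + 2 * Real.pi), ‖Real.sin ψ‖ₑ * Q (2 * Real.cos (ψ / 2)) =
      ∫⁻ ρ in (fun ψ => 2 * Real.cos (ψ / 2)) '' Ioc (0 : ℝ) (0 + 2 * Real.pi),
        ENNReal.ofReal |ρ| * Q ρ := by
    rw [lintegral_image_eq_lintegral_abs_deriv_mul (f' := fun ψ => - Real.sin (ψ / 2))
      measurableSet_Ioc]
    · refine setLIntegral_congr_fun measurableSet_Ioc fun ψ hψ => ?_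
      rw [← mul_assoc, ← ENNReal.ofReal_mul (abs_nonneg _), ← abs_mul, Real.enorm_eq_ofReal_abs]
      congr 2
      rw [← abs_neg]
      congr 1
      have := Real.sin_two_mul (ψ / 2)
      rw [mul_div_cancel₀ _ two_ne_zero] at this
      rw [this]
      ring
    · intro ψ _
      have := ((Real.hasDerivAt_cos (ψ / 2)).comp ψ ((hasDerivAt_id ψ).div_const 2)).const_mul 2
      exact (this.congr_deriv (by ring)).hasDerivWithinAt
    · intro ψ hψ ψ' hψ' h
      have := Real.injOn_cos (x₁ := ψ / 2) (x₂ := ψ' / 2)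
        ⟨by linarith [hψ.1], by linarith [hψ.2]⟩ ⟨by linarith [hψ'.1], by linarith [hψ'.2]⟩
        (by simpa using h)
      linarith
  rw [h3, h4, lintegral_eq_polar hφ b]
  -- The variable `ρ` takes both signs, so the plane is covered twice; this is the factor `2`.
  calc _ ≤ ∫⁻ ρ, ENNReal.ofReal |ρ| * Q ρ := setLIntegral_le_lintegral _ _
    _ = 2 * ∫⁻ ρ in Ioi (0 : ℝ), ENNReal.ofReal |ρ| * Q ρ :=
        lintegral_eq_two_mul_of_even (fun ρ => by rw [abs_neg, hQeven])
    _ = _ := by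
        congr 1
        refine setLIntegral_congr_fun measurableSet_Ioi fun v hv => ?_
        simp only [abs_of_pos (mem_Ioi.1 hv), hQ]

/-! ### The bilinear fractional integral inequality -/

theorem lintegral_Ioc_rpow {a ρ : ℝ} (ha : a < 1) (hρ : 0 ≤ ρ) :
    ∫⁻ v in Ioc 0 ρ, ENNReal.ofReal v ^ (-a) = ENNReal.ofReal (ρ ^ (1 - a) / (1 - a)) := by
  have h1 : ∫⁻ v in Ioc 0 ρ, ENNReal.ofReal v ^ (-a) =
      ∫⁻ v in Ioc 0 ρ, ENNReal.ofReal (v ^ (-a)) :=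
    setLIntegral_congr_fun measurableSet_Ioc fun v hv => ENNReal.ofReal_rpow_of_pos hv.1
  have hi : IntervalIntegrable (fun v : ℝ => v ^ (-a)) volume 0 ρ :=
    intervalIntegral.intervalIntegrable_rpow' (by linarith)
  rw [h1, ← ofReal_integral_eq_lintegral_ofReal ((intervalIntegrable_iff_integrableOn_Ioc_of_le hρ).1 hi)
    ((ae_restrict_iff' measurableSet_Ioc).2 (Eventually.of_forall fun v hv =>
      Real.rpow_nonneg hv.1.le _)),
    ← intervalIntegral.integral_of_le hρ, integral_rpow (Or.inl (by linarith)),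
    Real.zero_rpow (by linarith)]
  congr 1
  rw [show -a + 1 = 1 - a by ring, sub_zero]

theorem rpow_le_rpow_of_nonpos {u v : ℝ≥0∞} {z : ℝ} (hz : z ≤ 0) (h : u ≤ v) : v ^ z ≤ u ^ z := by
  obtain ⟨w, rfl⟩ : ∃ w, z = -w := ⟨-z, (neg_neg z).symm⟩
  rw [ENNReal.rpow_neg, ENNReal.rpow_neg]
  exact ENNReal.inv_le_inv.2 (ENNReal.rpow_le_rpow h (neg_nonpos.1 hz))

theorem lintegral_gap_rpow_le {a ρ : ℝ} (ha0 : 0 ≤ a) (ha : a < 1) (hρ : 0 ≤ ρ) (x : Circle) :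
    ∫⁻ y, (if gap x y ≤ ENNReal.ofReal ρ then gap x y ^ (-a) else 0) ∂σ ≤
      10 * ENNReal.ofReal (ρ ^ (1 - a) / (1 - a)) := by
  have hF : Antitone fun v : ℝ≥0∞ => if v ≤ ENNReal.ofReal ρ then v ^ (-a) else 0 := by
    intro u v huv
    dsimp only
    split_ifs with h1 h2
    · exact rpow_le_rpow_of_nonpos (by linarith) huv
    · exact absurd (huv.trans h1) h2
    · exact zero_le
    · exact le_rfl
  refine (lintegral_comp_gap_le hF x).trans ?_
  gcongr
  rw [← lintegral_Ioc_rpow ha hρ, ← lintegral_indicator measurableSet_Ioc,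
    ← lintegral_indicator measurableSet_Ioi]
  refine lintegral_mono fun v => ?_
  by_cases hv : 0 < v
  · rw [indicator_of_mem (mem_Ioi.2 hv)]
    split_ifs with h
    · rw [indicator_of_mem]
      exact ⟨hv, (ENNReal.ofReal_le_ofReal_iff hρ).1 h⟩
    · exact zero_le
  · rw [indicator_of_notMem (by simpa using hv)]
    exact zero_le

theorem lintegral_gap_rpow_lt {a : ℝ} (ha0 : 0 ≤ a) (ha : a < 1) (x : Circle) :
    ∫⁻ y, gap x y ^ (-a) ∂σ ≤ 10 * ENNReal.ofReal (1 / (1 - a)) := by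
  have h := lintegral_gap_rpow_le ha0 ha zero_le_one x
  simpa [gap_le_one] using h

theorem lintegral_max_gap_le {ρ : ℝ} (hρ : 0 < ρ) (x : Circle) :
    ∫⁻ y, (max (gap x y) (ENNReal.ofReal ρ)) ^ (-2 : ℝ) ∂σ ≤ 10 * ENNReal.ofReal (2 / ρ) := by
  have hF : Antitone fun v : ℝ≥0∞ => (max v (ENNReal.ofReal ρ)) ^ (-2 : ℝ) := fun u v huv =>
    rpow_le_rpow_of_nonpos (by norm_num) (max_le_max huv le_rfl)
  refine (lintegral_comp_gap_le hF x).trans ?_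
  gcongr
  rw [← Ioc_union_Ioi_eq_Ioi hρ.le]
  refine (lintegral_union_le _ _ _).trans ?_
  have h1 : ∫⁻ v in Ioc 0 ρ, (max (ENNReal.ofReal v) (ENNReal.ofReal ρ)) ^ (-2 : ℝ) =
      ENNReal.ofReal (1 / ρ) := by
    have : ∀ v ∈ Ioc 0 ρ, (max (ENNReal.ofReal v) (ENNReal.ofReal ρ)) ^ (-2 : ℝ) =
        ENNReal.ofReal (ρ ^ (-2 : ℝ)) := by
      intro v hv
      rw [max_eq_right (ENNReal.ofReal_le_ofReal hv.2), ENNReal.ofReal_rpow_of_pos hρ]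
    rw [setLIntegral_congr_fun measurableSet_Ioc this, lintegral_const, Measure.restrict_apply_univ,
      Real.volume_Ioc, ← ENNReal.ofReal_mul (by positivity)]
    congr 1
    rw [Real.rpow_neg hρ.le]
    norm_num
    field_simp
  have h2 : ∫⁻ v in Ioi ρ, (max (ENNReal.ofReal v) (ENNReal.ofReal ρ)) ^ (-2 : ℝ) =
      ENNReal.ofReal (1 / ρ) := by
    have : ∀ v ∈ Ioi ρ, (max (ENNReal.ofReal v) (ENNReal.ofReal ρ)) ^ (-2 : ℝ) =
        ENNReal.ofReal (v ^ (-2 : ℝ)) := by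
      intro v hv
      rw [max_eq_left (ENNReal.ofReal_le_ofReal (mem_Ioi.1 hv).le),
        ENNReal.ofReal_rpow_of_pos (hρ.trans hv)]
    rw [setLIntegral_congr_fun measurableSet_Ioi this,
      ← ofReal_integral_eq_lintegral_ofReal (integrableOn_Ioi_rpow_of_lt (by norm_num) hρ)
        ((ae_restrict_iff' measurableSet_Ioi).2 (Eventually.of_forall fun v hv =>
          Real.rpow_nonneg (hρ.trans hv).le _)),
      integral_Ioi_rpow_of_lt (by norm_num) hρ]
    congr 1
    norm_num [Real.rpow_neg_one]
  rw [h1, h2, ← ENNReal.ofReal_add (by positivity) (by positivity)]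
  apply le_of_eq
  congr 1
  ring

/-- The `L²` norm of a nonnegative function on the circle. -/
def l2 (f : Circle → ℝ≥0∞) : ℝ≥0∞ := (∫⁻ x, f x ^ (2 : ℝ) ∂σ) ^ (1 / 2 : ℝ)

theorem eLpNorm_eq_l2 (f : Circle → ℂ) : eLpNorm f 2 σ = l2 fun x => ‖f x‖ₑ := by
  rw [eLpNorm_eq_lintegral_rpow_enorm_toReal (by simp) (by simp), l2]
  simp

/-- The integral over `y` is cut at `gap = ρ`. Near the diagonal and the antidiagonal, `g ≤ t`
leaves an integrable power of `gap`; away from them, Hölder with exponents `4/3` and `4` pairs `g²`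
with `gap^(-2)`. -/
theorem lintegral_sublevel_le {g : Circle → ℝ≥0∞} (hg : Measurable g)
    (hg1 : ∫⁻ y, g y ^ (2 : ℝ) ∂σ ≤ 1) (x : Circle) {t : ℝ} (ht : 0 < t) :
    ∫⁻ y, (if g y ≤ ENNReal.ofReal t then g y ^ (3 / 2 : ℝ) * gap x y ^ (-(1 / 2) : ℝ) else 0) ∂σ ≤
      40 * ENNReal.ofReal t ^ (1 / 2 : ℝ) := by
  -- This threshold balances the two pieces: `t^(3/2) ρ^(1/2)` and `ρ^(-1/4)` both equal `t^(1/2)`.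
  set ρ : ℝ := t ^ (-2 : ℝ) with hρdef
  have hρ : 0 < ρ := by positivity
  have hgap : Measurable fun y => gap x y :=
    measurable_gap.comp (measurable_const.prodMk measurable_id)
  have hpt : ∀ y, (if g y ≤ ENNReal.ofReal t then g y ^ (3 / 2 : ℝ) * gap x y ^ (-(1 / 2) : ℝ) else 0) ≤
      ENNReal.ofReal t ^ (3 / 2 : ℝ) *
        (if gap x y ≤ ENNReal.ofReal ρ then gap x y ^ (-(1 / 2) : ℝ) else 0) +
      (g y ^ (2 : ℝ)) ^ (3 / 4 : ℝ) * ((max (gap x y) (ENNReal.ofReal ρ)) ^ (-2 : ℝ)) ^ (1 / 4 : ℝ) := by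
    intro y
    split_ifs with h1 h2
    · refine le_trans ?_ le_self_add
      gcongr
    · rw [mul_zero, zero_add, max_eq_left (not_le.1 h2).le, ← ENNReal.rpow_mul, ← ENNReal.rpow_mul]
      norm_num
    · exact zero_le
    · exact zero_le
  have hH : ∫⁻ y, (g y ^ (2 : ℝ)) ^ (3 / 4 : ℝ) *
      ((max (gap x y) (ENNReal.ofReal ρ)) ^ (-2 : ℝ)) ^ (1 / 4 : ℝ) ∂σ ≤
      20 * ENNReal.ofReal t ^ (1 / 2 : ℝ) := by
    refine (ENNReal.lintegral_mul_norm_pow_le (by fun_prop) (by fun_prop)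
      (by norm_num) (by norm_num) (by norm_num)).trans ?_
    have e1 : (∫⁻ y, g y ^ (2 : ℝ) ∂σ) ^ (3 / 4 : ℝ) ≤ 1 := ENNReal.rpow_le_one hg1 (by norm_num)
    have e2 : (∫⁻ y, (max (gap x y) (ENNReal.ofReal ρ)) ^ (-2 : ℝ) ∂σ) ^ (1 / 4 : ℝ) ≤
        20 * ENNReal.ofReal t ^ (1 / 2 : ℝ) := by
      calc _ ≤ (10 * ENNReal.ofReal (2 / ρ)) ^ (1 / 4 : ℝ) := by
            gcongr; exact lintegral_max_gap_le hρ x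
        _ = (20 : ℝ≥0∞) ^ (1 / 4 : ℝ) * ENNReal.ofReal t ^ (1 / 2 : ℝ) := by
            have : 10 * ENNReal.ofReal (2 / ρ) = 20 * ENNReal.ofReal t ^ (2 : ℝ) := by
              rw [ENNReal.ofReal_rpow_of_pos ht, hρdef, Real.rpow_neg ht.le, div_inv_eq_mul,
                ENNReal.ofReal_mul (by norm_num), ← mul_assoc]
              norm_num
            rw [this, ENNReal.mul_rpow_of_nonneg _ _ (by norm_num), ← ENNReal.rpow_mul]
            norm_num
        _ ≤ 20 * ENNReal.ofReal t ^ (1 / 2 : ℝ) := by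
            gcongr
            conv_rhs => rw [← ENNReal.rpow_one 20]
            exact ENNReal.rpow_le_rpow_of_exponent_le (by norm_num) (by norm_num)
    calc _ ≤ 1 * (20 * ENNReal.ofReal t ^ (1 / 2 : ℝ)) := mul_le_mul' e1 e2
      _ = _ := one_mul _
  have hI : ENNReal.ofReal t ^ (3 / 2 : ℝ) *
      ∫⁻ y, (if gap x y ≤ ENNReal.ofReal ρ then gap x y ^ (-(1 / 2) : ℝ) else 0) ∂σ ≤
      20 * ENNReal.ofReal t ^ (1 / 2 : ℝ) := by
    calc _ ≤ ENNReal.ofReal t ^ (3 / 2 : ℝ) *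
          (10 * ENNReal.ofReal (ρ ^ (1 - 1 / 2 : ℝ) / (1 - 1 / 2))) := by
          gcongr
          exact lintegral_gap_rpow_le (by norm_num) (by norm_num) hρ.le x
      _ = 20 * ENNReal.ofReal t ^ (1 / 2 : ℝ) := by
          have : ρ ^ (1 - 1 / 2 : ℝ) / (1 - 1 / 2) = 2 * t ^ (-1 : ℝ) := by
            rw [hρdef, ← Real.rpow_mul ht.le]
            norm_num
            ring
          rw [this, ENNReal.ofReal_mul (by norm_num), ← ENNReal.ofReal_rpow_of_pos ht]
          have h3 : ENNReal.ofReal t ^ (1 / 2 : ℝ) =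
              ENNReal.ofReal t ^ (3 / 2 : ℝ) * ENNReal.ofReal t ^ (-1 : ℝ) := by
            rw [← ENNReal.rpow_add _ _ (by simpa using ht) ENNReal.ofReal_ne_top]
            norm_num
          rw [h3]
          norm_num
          ring
  calc _ ≤ ∫⁻ y, (ENNReal.ofReal t ^ (3 / 2 : ℝ) *
        (if gap x y ≤ ENNReal.ofReal ρ then gap x y ^ (-(1 / 2) : ℝ) else 0) +
      (g y ^ (2 : ℝ)) ^ (3 / 4 : ℝ) *
        ((max (gap x y) (ENNReal.ofReal ρ)) ^ (-2 : ℝ)) ^ (1 / 4 : ℝ)) ∂σ := lintegral_mono hpt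
    _ = _ := lintegral_add_right _ (by fun_prop)
    _ ≤ 20 * ENNReal.ofReal t ^ (1 / 2 : ℝ) + 20 * ENNReal.ofReal t ^ (1 / 2 : ℝ) := by
        refine add_le_add ?_ hH
        rw [lintegral_const_mul]
        · exact hI
        · exact Measurable.ite (measurableSet_le hgap measurable_const) (by fun_prop) measurable_const
    _ = 40 * ENNReal.ofReal t ^ (1 / 2 : ℝ) := by ring

/-- Taking `t = f x` in `lintegral_sublevel_le` leaves `f^(3/2) f^(1/2) = f²`, which is integrable.
-/
theorem lintegral_lintegral_sublevel_le {f g : Circle → ℝ≥0∞} (hf : Measurable f) (hg : Measurable g)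
    (hf1 : ∫⁻ y, f y ^ (2 : ℝ) ∂σ ≤ 1) (hg1 : ∫⁻ y, g y ^ (2 : ℝ) ∂σ ≤ 1) :
    ∫⁻ x, ∫⁻ y, (if g y ≤ f x then (f x * g y) ^ (3 / 2 : ℝ) * gap x y ^ (-(1 / 2) : ℝ) else 0) ∂σ ∂σ
      ≤ 40 := by
  have hfin : ∀ᵐ x ∂σ, f x ≠ ∞ := by
    have h := ae_lt_top (hf.pow_const (2 : ℝ)) (ne_top_of_le_ne_top ENNReal.one_ne_top hf1)
    filter_upwards [h] with x hx hx'
    simp [hx'] at hx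
  calc _ ≤ ∫⁻ x, 40 * f x ^ (2 : ℝ) ∂σ := by
        refine lintegral_mono_ae ?_
        filter_upwards [hfin] with x hx
        rcases eq_or_ne (f x) 0 with h0 | h0
        · simp [h0]
        · have ht : 0 < (f x).toReal := ENNReal.toReal_pos h0 hx
          have h := lintegral_sublevel_le hg hg1 x ht
          rw [ENNReal.ofReal_toReal hx] at h
          have e : ∀ y, (if g y ≤ f x then (f x * g y) ^ (3 / 2 : ℝ) * gap x y ^ (-(1 / 2) : ℝ) else 0)
              = f x ^ (3 / 2 : ℝ) *
                (if g y ≤ f x then g y ^ (3 / 2 : ℝ) * gap x y ^ (-(1 / 2) : ℝ) else 0) := by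
            intro y
            rw [mul_ite, mul_zero, ENNReal.mul_rpow_of_nonneg _ _ (by norm_num), mul_assoc]
          simp_rw [e]
          rw [lintegral_const_mul' _ _ (ENNReal.rpow_ne_top_of_nonneg (by norm_num) hx)]
          calc _ ≤ f x ^ (3 / 2 : ℝ) * (40 * f x ^ (1 / 2 : ℝ)) := by gcongr
            _ = 40 * (f x ^ (3 / 2 : ℝ) * f x ^ (1 / 2 : ℝ)) := by ring
            _ = _ := by
              rw [← ENNReal.rpow_add _ _ h0 hx]
              norm_num
    _ = 40 * ∫⁻ x, f x ^ (2 : ℝ) ∂σ := lintegral_const_mul _ (hf.pow_const _)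
    _ ≤ 40 * 1 := by gcongr
    _ = 40 := mul_one _

/-- The weighted `L^{3/2}` energy of a function of two points of the circle. -/
def energy (P : Circle × Circle → ℝ≥0∞) : ℝ≥0∞ :=
  ∫⁻ p, P p ^ (3 / 2 : ℝ) * gap p.1 p.2 ^ (-(1 / 2) : ℝ) ∂(σ.prod σ)

/-- Either `g y ≤ f x` or `f x ≤ g y`, and `gap` is symmetric, so the one-sided bound is used twice.
-/
theorem energy_mul_le_of_le_one {f g : Circle → ℝ≥0∞} (hf : Measurable f) (hg : Measurable g)
    (hf1 : ∫⁻ y, f y ^ (2 : ℝ) ∂σ ≤ 1) (hg1 : ∫⁻ y, g y ^ (2 : ℝ) ∂σ ≤ 1) :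
    energy (fun p => f p.1 * g p.2) ≤ 80 := by
  rw [energy, lintegral_prod _ (by fun_prop)]
  have hm : Measurable fun p : Circle × Circle =>
      (if g p.2 ≤ f p.1 then (f p.1 * g p.2) ^ (3 / 2 : ℝ) * gap p.1 p.2 ^ (-(1 / 2) : ℝ) else 0) :=
    Measurable.ite (measurableSet_le (by fun_prop) (by fun_prop)) (by fun_prop) measurable_const
  have hm' : Measurable fun p : Circle × Circle =>
      (if f p.1 ≤ g p.2 then (f p.1 * g p.2) ^ (3 / 2 : ℝ) * gap p.1 p.2 ^ (-(1 / 2) : ℝ) else 0) :=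
    Measurable.ite (measurableSet_le (by fun_prop) (by fun_prop)) (by fun_prop) measurable_const
  have h1 := lintegral_lintegral_sublevel_le hf hg hf1 hg1
  have h2 := lintegral_lintegral_sublevel_le hg hf hg1 hf1
  have h3 : ∫⁻ x, ∫⁻ y,
      (if f x ≤ g y then (f x * g y) ^ (3 / 2 : ℝ) * gap x y ^ (-(1 / 2) : ℝ) else 0) ∂σ ∂σ ≤ 40 := by
    rw [lintegral_lintegral_swap hm'.aemeasurable]
    simpa only [gap_comm, mul_comm] using h2
  calc _ ≤ ∫⁻ x, ∫⁻ y,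
        ((if g y ≤ f x then (f x * g y) ^ (3 / 2 : ℝ) * gap x y ^ (-(1 / 2) : ℝ) else 0) +
        (if f x ≤ g y then (f x * g y) ^ (3 / 2 : ℝ) * gap x y ^ (-(1 / 2) : ℝ) else 0)) ∂σ ∂σ := by
        refine lintegral_mono fun x => lintegral_mono fun y => ?_
        dsimp only
        rcases le_total (g y) (f x) with h | h
        · rw [if_pos h]; exact le_self_add
        · rw [if_pos h]; exact le_add_self
    _ = _ := by
        rw [← lintegral_add_left hm.lintegral_prod_right']
        refine lintegral_congr fun x => ?_
        exact lintegral_add_left (hm.comp measurable_prodMk_left) _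
    _ ≤ 40 + 40 := add_le_add h1 h3
    _ = 80 := by norm_num

/-- This is a Hardy-Littlewood-Sobolev inequality, with `f^(3/2)` and `g^(3/2)` in `L^(4/3)` and the
kernel `gap^(-1/2)`. It follows from the normalised case by homogeneity; norms `0` and `∞` are
treated separately. -/
theorem energy_mul_le {f g : Circle → ℝ≥0∞} (hf : Measurable f) (hg : Measurable g) :
    energy (fun p => f p.1 * g p.2) ≤ 80 * (l2 f * l2 g) ^ (3 / 2 : ℝ) := by
  have hzero : ∀ {u : Circle → ℝ≥0∞}, Measurable u → l2 u = 0 → ∀ᵐ x ∂σ, u x = 0 := by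
    intro u hu h
    rw [l2, ENNReal.rpow_eq_zero_iff_of_pos (by norm_num), lintegral_eq_zero_iff (by fun_prop)] at h
    filter_upwards [h] with x hx
    simpa using hx
  have hnorm : ∀ {u : Circle → ℝ≥0∞}, Measurable u → l2 u ≠ 0 → l2 u ≠ ∞ →
      ∫⁻ y, ((l2 u)⁻¹ * u y) ^ (2 : ℝ) ∂σ ≤ 1 := by
    intro u hu h0 h1
    simp_rw [ENNReal.mul_rpow_of_nonneg _ _ (zero_le_two : (0:ℝ) ≤ 2)]
    rw [lintegral_const_mul _ (by fun_prop)]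
    have : ∫⁻ y, u y ^ (2 : ℝ) ∂σ = l2 u ^ (2 : ℝ) := by
      rw [l2, ← ENNReal.rpow_mul]; norm_num
    rw [this, ENNReal.inv_rpow, ENNReal.inv_mul_cancel]
    · simp [h0]
    · simp [h1]
  rcases eq_or_ne (l2 f) 0 with hf0 | hf0
  · rw [energy, (lintegral_eq_zero_iff (by fun_prop)).2]
    · exact zero_le
    · filter_upwards [Measure.quasiMeasurePreserving_fst.ae (hzero hf hf0)] with p hp
      simp [hp]
  rcases eq_or_ne (l2 g) 0 with hg0 | hg0
  · rw [energy, (lintegral_eq_zero_iff (by fun_prop)).2]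
    · exact zero_le
    · filter_upwards [Measure.quasiMeasurePreserving_snd.ae (hzero hg hg0)] with p hp
      simp [hp]
  rcases eq_or_ne (l2 f) ∞ with hf1 | hf1
  · simp [hf1, hg0]
  rcases eq_or_ne (l2 g) ∞ with hg1 | hg1
  · simp [hg1, hf0]
  have h := energy_mul_le_of_le_one (f := fun x => (l2 f)⁻¹ * f x) (g := fun x => (l2 g)⁻¹ * g x)
    (by fun_prop) (by fun_prop) (hnorm hf hf0 hf1) (hnorm hg hg0 hg1)
  have e : energy (fun p => f p.1 * g p.2) = (l2 f * l2 g) ^ (3 / 2 : ℝ) *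
      energy (fun p => (l2 f)⁻¹ * f p.1 * ((l2 g)⁻¹ * g p.2)) := by
    rw [energy, energy, ← lintegral_const_mul _ (by fun_prop)]
    refine lintegral_congr fun p => ?_
    rw [← mul_assoc, ← ENNReal.mul_rpow_of_nonneg _ _ (by norm_num : (0:ℝ) ≤ 3 / 2)]
    congr 2
    calc f p.1 * g p.2 = (l2 f * (l2 f)⁻¹) * (l2 g * (l2 g)⁻¹) * (f p.1 * g p.2) := by
          rw [ENNReal.mul_inv_cancel hf0 hf1, ENNReal.mul_inv_cancel hg0 hg1]; simp
      _ = _ := by ring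
  rw [e, mul_comm]
  gcongr

theorem energy_mul_rpow_le {f g : Circle → ℝ≥0∞} (hf : Measurable f) (hg : Measurable g) :
    energy (fun p => f p.1 * g p.2) ^ (2 / 3 : ℝ) ≤ 80 * (l2 f * l2 g) := by
  calc _ ≤ (80 * (l2 f * l2 g) ^ (3 / 2 : ℝ)) ^ (2 / 3 : ℝ) := by
        gcongr; exact energy_mul_le hf hg
    _ = 80 ^ (2 / 3 : ℝ) * (l2 f * l2 g) := by
        rw [ENNReal.mul_rpow_of_nonneg _ _ (by norm_num), ← ENNReal.rpow_mul]
        norm_num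
    _ ≤ 80 * (l2 f * l2 g) := by
        gcongr
        conv_rhs => rw [← ENNReal.rpow_one 80]
        exact ENNReal.rpow_le_rpow_of_exponent_le (by norm_num) (by norm_num)

/-! ### The trilinear inequality -/

/-- The map `Z` pushes `gap` times arc length squared to at most twice Lebesgue measure. -/
def IsTransversal (Z : Circle × Circle → ℂ) : Prop :=
  Measurable Z ∧ ∀ φ : ℂ → ℝ≥0∞, Measurable φ → ∀ b : ℂ,
    ∫⁻ p, gap p.1 p.2 * φ (Z p + b) ∂(σ.prod σ) ≤ 2 * ∫⁻ z, φ z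

theorem isTransversal_add : IsTransversal fun p => (p.1 : ℂ) + p.2 := by
  refine ⟨by fun_prop, fun φ hφ b => ?_⟩
  rw [lintegral_prod_symm _ (by fun_prop)]
  exact lintegral_gap_mul_comp_add hφ b

/-- Passing to the antipode of the second point turns the sum into the difference and preserves
`gap`. -/
theorem isTransversal_sub : IsTransversal fun p => (p.1 : ℂ) - p.2 := by
  refine ⟨by fun_prop, fun φ hφ b => ?_⟩
  rw [lintegral_prod_symm _ (by fun_prop)]
  have h := lintegral_gap_mul_comp_add hφ b
  rw [← measurePreserving_neg.lintegral_comp (by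
    apply Measurable.lintegral_prod_left' (f := fun p : Circle × Circle =>
      gap p.1 p.2 * φ (p.1 + p.2 + b))
    fun_prop)] at h
  simpa [gap_neg_right, sub_eq_add_neg] using h

/-- The power `gap^(-1/2)` is integrable, and it is infinite where `gap` vanishes. -/
theorem gap_ne_zero_ae : ∀ᵐ p ∂(σ.prod σ), gap p.1 p.2 ≠ 0 := by
  have h1 : ∫⁻ p, gap p.1 p.2 ^ (-(1 / 2) : ℝ) ∂(σ.prod σ) ≠ ∞ := by
    rw [lintegral_prod _ (by fun_prop)]
    refine ne_top_of_le_ne_top ?_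
      (lintegral_mono fun x => lintegral_gap_rpow_lt (a := 1 / 2) (by norm_num) (by norm_num) x)
    rw [lintegral_const]
    exact ENNReal.mul_ne_top (ENNReal.mul_ne_top (by norm_num) ENNReal.ofReal_ne_top)
      (measure_ne_top _ _)
  filter_upwards [ae_lt_top (by fun_prop) h1] with p hp h0
  rw [h0, ENNReal.zero_rpow_of_neg (by norm_num)] at hp
  exact lt_irrefl _ hp

/-- The pair carrying the weight `gap` is integrated first. Transversality removes `χ` uniformly in
the translation by the other two pairs, and these then decouple. -/
theorem lintegral_gap_inner_le {Z₁ Z₂ Z₃ : Circle × Circle → ℂ}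
    (h₃ : IsTransversal Z₃) {χ : ℂ → ℝ≥0∞} (hχ : Measurable χ)
    {A B : Circle × Circle → ℝ≥0∞} (hA : Measurable A) (hB : Measurable B) :
    ∫⁻ p, ∫⁻ q, ∫⁻ r, A p * B q * gap r.1 r.2 * χ (Z₁ p + Z₂ q + Z₃ r)
      ∂(σ.prod σ) ∂(σ.prod σ) ∂(σ.prod σ) ≤
      (2 * ∫⁻ z, χ z) * ((∫⁻ p, A p ∂(σ.prod σ)) * ∫⁻ q, B q ∂(σ.prod σ)) := by
  have hm₃ := h₃.1
  calc _ ≤ ∫⁻ p, ∫⁻ q, A p * B q * (2 * ∫⁻ z, χ z) ∂(σ.prod σ) ∂(σ.prod σ) := by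
        refine lintegral_mono fun p => lintegral_mono fun q => ?_
        simp_rw [mul_assoc (A p * B q)]
        rw [lintegral_const_mul _ (by fun_prop)]
        gcongr
        have := h₃.2 χ hχ (Z₁ p + Z₂ q)
        simpa only [add_comm (Z₃ _)] using this
    _ = _ := by
        simp_rw [mul_assoc]
        have : ∀ p, ∫⁻ q, A p * (B q * (2 * ∫⁻ z, χ z)) ∂(σ.prod σ) =
            A p * ((∫⁻ q, B q ∂(σ.prod σ)) * (2 * ∫⁻ z, χ z)) := fun p => by
          rw [lintegral_const_mul _ (by fun_prop), lintegral_mul_const _ hB]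
        simp_rw [this]
        rw [lintegral_mul_const _ hA]
        ring

/-- Let `e P = P^(3/2) gap^(-1/2)`. In each of `a₀`, `a₁`, `a₂` two pairs carry `e` and the third
carries `gap`. Since `e² gap` is the cube of the original factor, the integrand is the product of
the cube roots of the three, and Hölder reduces the bound to three applications of
`lintegral_gap_inner_le`. -/
theorem trilinear_le {Z₁ Z₂ Z₃ : Circle × Circle → ℂ} (h₁ : IsTransversal Z₁)
    (h₂ : IsTransversal Z₂) (h₃ : IsTransversal Z₃) {χ : ℂ → ℝ≥0∞} (hχ : Measurable χ)
    {P Q S : Circle × Circle → ℝ≥0∞} (hP : Measurable P) (hQ : Measurable Q) (hS : Measurable S) :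
    ∫⁻ p, ∫⁻ q, ∫⁻ r, P p * Q q * S r * χ (Z₁ p + Z₂ q + Z₃ r)
      ∂(σ.prod σ) ∂(σ.prod σ) ∂(σ.prod σ) ≤
      (2 * ∫⁻ z, χ z) * (energy P ^ (2 / 3 : ℝ) * energy Q ^ (2 / 3 : ℝ) * energy S ^ (2 / 3 : ℝ)) := by
  have hm₁ := h₁.1
  have hm₂ := h₂.1
  have hm₃ := h₃.1
  set ν := σ.prod σ with hν
  set w : Circle × Circle → ℝ≥0∞ := fun p => gap p.1 p.2 with hw
  have hwm : Measurable w := measurable_gap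
  set e : (Circle × Circle → ℝ≥0∞) → Circle × Circle → ℝ≥0∞ :=
    fun P p => P p ^ (3 / 2 : ℝ) * w p ^ (-(1 / 2) : ℝ) with he
  have hem : ∀ {P}, Measurable P → Measurable (e P) := fun hP => by simp only [he]; fun_prop
  have heP := hem hP
  have heQ := hem hQ
  have heS := hem hS
  have henergy : ∀ P, energy P = ∫⁻ p, e P p ∂ν := fun P => rfl
  let a₀ : (Circle × Circle) × (Circle × Circle) × (Circle × Circle) → ℝ≥0∞ :=
    fun t => e P t.1 * e Q t.2.1 * w t.2.2 * χ (Z₁ t.1 + Z₂ t.2.1 + Z₃ t.2.2)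
  let a₁ : (Circle × Circle) × (Circle × Circle) × (Circle × Circle) → ℝ≥0∞ :=
    fun t => e P t.1 * e S t.2.2 * w t.2.1 * χ (Z₁ t.1 + Z₂ t.2.1 + Z₃ t.2.2)
  let a₂ : (Circle × Circle) × (Circle × Circle) × (Circle × Circle) → ℝ≥0∞ :=
    fun t => e Q t.2.1 * e S t.2.2 * w t.1 * χ (Z₁ t.1 + Z₂ t.2.1 + Z₃ t.2.2)
  have ha₀ : Measurable a₀ := by simp only [a₀]; fun_prop
  have ha₁ : Measurable a₁ := by simp only [a₁]; fun_prop
  have ha₂ : Measurable a₂ := by simp only [a₂]; fun_prop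
  have hprod : ∀ {f : (Circle × Circle) × (Circle × Circle) × (Circle × Circle) → ℝ≥0∞}, Measurable f →
      ∫⁻ t, f t ∂(ν.prod (ν.prod ν)) = ∫⁻ p, ∫⁻ q, ∫⁻ r, f (p, q, r) ∂ν ∂ν ∂ν := by
    intro f hf
    rw [lintegral_prod _ hf.aemeasurable]
    refine lintegral_congr fun p => ?_
    exact lintegral_prod _ (hf.comp measurable_prodMk_left).aemeasurable
  set c := 2 * ∫⁻ z, χ z with hc
  have i0 : ∫⁻ t, a₀ t ∂(ν.prod (ν.prod ν)) ≤ c * (energy P * energy Q) := by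
    rw [hprod ha₀]
    exact lintegral_gap_inner_le h₃ hχ heP heQ
  have i1 : ∫⁻ t, a₁ t ∂(ν.prod (ν.prod ν)) ≤ c * (energy P * energy S) := by
    rw [hprod ha₁]
    refine le_trans (le_of_eq ?_) (lintegral_gap_inner_le (Z₁ := Z₁) (Z₂ := Z₃) h₂ hχ heP heS)
    refine lintegral_congr fun p => ?_
    rw [lintegral_lintegral_swap (by fun_prop)]
    refine lintegral_congr fun q => lintegral_congr fun r => ?_
    simp only [a₁, hw, he, add_right_comm (Z₁ p)]
  have i2 : ∫⁻ t, a₂ t ∂(ν.prod (ν.prod ν)) ≤ c * (energy Q * energy S) := by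
    rw [hprod ha₂]
    refine le_trans (le_of_eq ?_) (lintegral_gap_inner_le (Z₁ := Z₂) (Z₂ := Z₃) h₁ hχ heQ heS)
    rw [lintegral_lintegral_swap (by fun_prop)]
    refine lintegral_congr fun q => ?_
    rw [lintegral_lintegral_swap (by fun_prop)]
    refine lintegral_congr fun r => lintegral_congr fun p => ?_
    simp only [a₂, hw, he]
    rw [show Z₁ p + Z₂ q + Z₃ r = Z₂ q + Z₃ r + Z₁ p by ring]
  -- The powers of `gap` cancel only where `gap` is nonzero, hence almost everywhere.
  have hpt : ∀ᵐ t ∂(ν.prod (ν.prod ν)),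
      P t.1 * Q t.2.1 * S t.2.2 * χ (Z₁ t.1 + Z₂ t.2.1 + Z₃ t.2.2) =
        ∏ i : Fin 3, ![a₀, a₁, a₂] i t ^ (1 / 3 : ℝ) := by
    have q1 : ∀ᵐ t ∂(ν.prod (ν.prod ν)), w t.1 ≠ 0 :=
      Measure.quasiMeasurePreserving_fst.ae gap_ne_zero_ae
    have q2 : ∀ᵐ t ∂(ν.prod (ν.prod ν)), w t.2.1 ≠ 0 :=
      Measure.quasiMeasurePreserving_snd.ae (Measure.quasiMeasurePreserving_fst.ae gap_ne_zero_ae)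
    have q3 : ∀ᵐ t ∂(ν.prod (ν.prod ν)), w t.2.2 ≠ 0 :=
      Measure.quasiMeasurePreserving_snd.ae (Measure.quasiMeasurePreserving_snd.ae gap_ne_zero_ae)
    filter_upwards [q1, q2, q3] with t t1 t2 t3
    have hcube : ∀ (P : Circle × Circle → ℝ≥0∞) p, w p ≠ 0 → e P p * e P p * w p = P p ^ (3 : ℝ) := by
      intro P p hp
      have htop : w p ≠ ∞ := ne_top_of_le_ne_top ENNReal.one_ne_top (gap_le_one _ _)
      calc e P p * e P p * w p = (P p ^ (3 / 2 : ℝ) * P p ^ (3 / 2 : ℝ)) *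
            (w p ^ (-(1 / 2) : ℝ) * w p ^ (-(1 / 2) : ℝ) * w p ^ (1 : ℝ)) := by
            simp only [he, ENNReal.rpow_one]; ring
        _ = P p ^ (3 : ℝ) := by
            rw [← ENNReal.rpow_add_of_nonneg _ _ (by norm_num) (by norm_num),
              ← ENNReal.rpow_add _ _ hp htop, ← ENNReal.rpow_add _ _ hp htop]
            norm_num
    rw [Fin.prod_univ_three, ← ENNReal.mul_rpow_of_nonneg _ _ (by norm_num),
      ← ENNReal.mul_rpow_of_nonneg _ _ (by norm_num)]
    have : a₀ t * a₁ t * a₂ t =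
        (P t.1 * Q t.2.1 * S t.2.2 * χ (Z₁ t.1 + Z₂ t.2.1 + Z₃ t.2.2)) ^ (3 : ℝ) := by
      rw [ENNReal.mul_rpow_of_nonneg _ _ (by norm_num), ENNReal.mul_rpow_of_nonneg _ _ (by norm_num),
        ENNReal.mul_rpow_of_nonneg _ _ (by norm_num), ← hcube P _ t1, ← hcube Q _ t2,
        ← hcube S _ t3]
      have h3 : ∀ y : ℝ≥0∞, y ^ (3 : ℝ) = y * y * y := by
        intro y
        rw [show (3 : ℝ) = ((3 : ℕ) : ℝ) by norm_num, ENNReal.rpow_natCast]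
        ring
      rw [h3]
      simp only [a₀, a₁, a₂]
      ring
    simp only [Matrix.cons_val]
    rw [this, ← ENNReal.rpow_mul]
    norm_num
  have hmain := hprod (f := fun t => P t.1 * Q t.2.1 * S t.2.2 * χ (Z₁ t.1 + Z₂ t.2.1 + Z₃ t.2.2))
    (by fun_prop)
  dsimp only at hmain
  rw [← hmain, lintegral_congr_ae hpt]
  refine (ENNReal.lintegral_prod_norm_pow_le (p := fun _ => 1 / 3) Finset.univ
    (fun i _ => by fin_cases i; exacts [ha₀.aemeasurable, ha₁.aemeasurable, ha₂.aemeasurable]) (by norm_num) (fun i _ => by norm_num)).trans ?_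
  rw [Fin.prod_univ_three]
  calc _ ≤ (c * (energy P * energy Q)) ^ (1 / 3 : ℝ) * (c * (energy P * energy S)) ^ (1 / 3 : ℝ) *
        (c * (energy Q * energy S)) ^ (1 / 3 : ℝ) := by
        gcongr
        exacts [i0, i1, i2]
    _ = (c ^ (1 / 3 : ℝ) * c ^ (1 / 3 : ℝ) * c ^ (1 / 3 : ℝ)) *
        ((energy P ^ (1 / 3 : ℝ) * energy P ^ (1 / 3 : ℝ)) *
        (energy Q ^ (1 / 3 : ℝ) * energy Q ^ (1 / 3 : ℝ)) *
        (energy S ^ (1 / 3 : ℝ) * energy S ^ (1 / 3 : ℝ))) := by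
        simp only [ENNReal.mul_rpow_of_nonneg _ _ (show (0 : ℝ) ≤ 1 / 3 by norm_num)]
        ring
    _ = _ := by
        simp only [← ENNReal.rpow_add_of_nonneg _ _ (show (0 : ℝ) ≤ 1 / 3 by norm_num)
          (show (0 : ℝ) ≤ 1 / 3 by norm_num)]
        rw [← ENNReal.rpow_add_of_nonneg _ _ (by norm_num) (by norm_num)]
        norm_num

/-! ### The positive multilinear operator -/

theorem l2_mono {f g : Circle → ℝ≥0∞} (h : ∀ x, f x ≤ g x) : l2 f ≤ l2 g := by
  unfold l2
  gcongr with x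
  exact h x

theorem l2_rpow_two (f : Circle → ℝ≥0∞) : l2 f ^ (2 : ℝ) = ∫⁻ x, f x ^ (2 : ℝ) ∂σ := by
  rw [l2, ← ENNReal.rpow_mul]
  norm_num

/-- Duality: the test function is the truncation of `N` at height `k`, whose norm is finite and can
be divided out. Monotone convergence then removes the truncation. -/
theorem l2_le_of_forall_lintegral_mul_le {N : Circle → ℝ≥0∞} (hN : Measurable N) {A : ℝ≥0∞}
    (h : ∀ g : Circle → ℝ≥0∞, Measurable g → ∫⁻ x, N x * g x ∂σ ≤ A * l2 g) : l2 N ≤ A := by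
  have htrunc : ∀ k : ℕ, l2 (fun x => min (N x) k) ≤ A := by
    intro k
    set g : Circle → ℝ≥0∞ := fun x => min (N x) k with hg
    have hgm : Measurable g := hN.min measurable_const
    have hfin : l2 g ≠ ∞ := by
      refine ENNReal.rpow_ne_top_of_nonneg (by norm_num) (ne_top_of_le_ne_top ?_
        (lintegral_mono (g := fun _ => (k : ℝ≥0∞) ^ (2 : ℝ)) fun x => ?_))
      · rw [lintegral_const]
        exact ENNReal.mul_ne_top (ENNReal.rpow_ne_top_of_nonneg (by norm_num)
          (ENNReal.natCast_ne_top k)) (measure_ne_top _ _)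
      · exact ENNReal.rpow_le_rpow (min_le_right _ _) (by norm_num)
    rcases eq_or_ne (l2 g) 0 with h0 | h0
    · rw [h0]; exact zero_le
    have h1 : l2 g * l2 g ≤ A * l2 g := by
      calc l2 g * l2 g = l2 g ^ (2 : ℝ) := by
            rw [show (2 : ℝ) = ((2 : ℕ) : ℝ) by norm_num, ENNReal.rpow_natCast, sq]
        _ = ∫⁻ x, g x ^ (2 : ℝ) ∂σ := l2_rpow_two g
        _ ≤ ∫⁻ x, N x * g x ∂σ := by
            refine lintegral_mono fun x => ?_
            rw [show (2 : ℝ) = ((2 : ℕ) : ℝ) by norm_num, ENNReal.rpow_natCast, sq]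
            exact mul_le_mul' (min_le_left _ _) le_rfl
        _ ≤ A * l2 g := h g hgm
    exact (ENNReal.mul_le_mul_iff_left h0 hfin).1 h1
  have hsup : ∀ x, N x ^ (2 : ℝ) = ⨆ k : ℕ, (min (N x) k) ^ (2 : ℝ) := by
    intro x
    have hmono : Monotone fun k : ℕ => min (N x) (k : ℝ≥0∞) := fun i j hij =>
      min_le_min le_rfl (by exact_mod_cast hij)
    have ht : Tendsto (fun k : ℕ => min (N x) (k : ℝ≥0∞)) atTop (𝓝 (N x)) := by
      have := (tendsto_const_nhds (x := N x) (f := (atTop : Filter ℕ))).min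
        ENNReal.tendsto_nat_nhds_top
      simpa using this
    have ht2 := (ENNReal.continuous_rpow_const (y := (2 : ℝ))).continuousAt.tendsto.comp ht
    refine tendsto_nhds_unique ht2 (tendsto_atTop_iSup fun i j hij => ?_)
    exact ENNReal.rpow_le_rpow (hmono hij) (by norm_num)
  have : ∫⁻ x, N x ^ (2 : ℝ) ∂σ ≤ A ^ (2 : ℝ) := by
    simp_rw [hsup]
    rw [lintegral_iSup (fun k => (hN.min measurable_const).pow_const _) (fun i j hij x =>
      ENNReal.rpow_le_rpow (min_le_min le_rfl (by exact_mod_cast hij)) (by norm_num))]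
    refine iSup_le fun k => ?_
    rw [← l2_rpow_two]
    exact ENNReal.rpow_le_rpow (htrunc k) (by norm_num)
  calc l2 N ≤ (A ^ (2 : ℝ)) ^ (1 / 2 : ℝ) := by unfold l2; gcongr
    _ = A := by rw [← ENNReal.rpow_mul]; norm_num

/-- The space of quintuples of points of the circle, grouped as two pairs and a single point. -/
abbrev Quint := (Circle × Circle) × (Circle × Circle) × Circle

/-- The product of five copies of arc length measure. -/
def quintMeasure : Measure Quint := (σ.prod σ).prod ((σ.prod σ).prod σ)

instance : IsFiniteMeasure quintMeasure := by unfold quintMeasure; infer_instance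

/-- The displacement of the sum of a quintuple of points from `x`. -/
def phase (t : Quint) (x : Circle) : ℂ :=
  (t.1.1 : ℂ) + t.1.2 + ((t.2.1.1 : ℂ) + t.2.1.2) + ((t.2.2 : ℂ) - x)

@[fun_prop]
theorem measurable_phase : Measurable (fun s : Quint × Circle => phase s.1 s.2) := by
  unfold phase; fun_prop

/-- The positive multilinear convolution operator. -/
def posOp (P Q : Circle × Circle → ℝ≥0∞) (u : Circle → ℝ≥0∞) (χ : ℂ → ℝ≥0∞) (x : Circle) : ℝ≥0∞ :=
  ∫⁻ t, P t.1 * Q t.2.1 * u t.2.2 * χ (phase t x) ∂quintMeasure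

@[fun_prop]
theorem measurable_posOp {P Q : Circle × Circle → ℝ≥0∞} {u : Circle → ℝ≥0∞} {χ : ℂ → ℝ≥0∞}
    (hP : Measurable P) (hQ : Measurable Q) (hu : Measurable u) (hχ : Measurable χ) :
    Measurable (posOp P Q u χ) := by
  unfold posOp
  apply Measurable.lintegral_prod_right
  have : Measurable fun s : Circle × Quint => phase s.2 s.1 :=
    measurable_phase.comp measurable_swap
  fun_prop

theorem lintegral_posOp_mul {P Q : Circle × Circle → ℝ≥0∞} {u g : Circle → ℝ≥0∞} {χ : ℂ → ℝ≥0∞}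
    (hP : Measurable P) (hQ : Measurable Q) (hu : Measurable u) (hχ : Measurable χ)
    (hg : Measurable g) :
    ∫⁻ x, posOp P Q u χ x * g x ∂σ = ∫⁻ p, ∫⁻ q, ∫⁻ r, P p * Q q * (u r.1 * g r.2) *
      χ ((p.1 + p.2) + (q.1 + q.2) + (r.1 - r.2)) ∂(σ.prod σ) ∂(σ.prod σ) ∂(σ.prod σ) := by
  have hm : Measurable fun s : Quint × Circle =>
      P s.1.1 * Q s.1.2.1 * u s.1.2.2 * χ (phase s.1 s.2) * g s.2 := by
    fun_prop
  have e1 : ∀ x, posOp P Q u χ x * g x =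
      ∫⁻ t, P t.1 * Q t.2.1 * u t.2.2 * χ (phase t x) * g x ∂quintMeasure := by
    intro x
    rw [posOp, ← lintegral_mul_const]
    have : Measurable fun t : Quint => phase t x :=
      measurable_phase.comp (measurable_id.prodMk measurable_const)
    fun_prop
  simp_rw [e1]
  rw [lintegral_lintegral_swap (f := fun x t => P t.1 * Q t.2.1 * u t.2.2 * χ (phase t x) * g x)
    (hm.comp measurable_swap).aemeasurable, quintMeasure,
    lintegral_prod _ (hm.lintegral_prod_right').aemeasurable]
  refine lintegral_congr fun p => ?_
  refine (lintegral_prod _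
    (hm.lintegral_prod_right'.comp measurable_prodMk_left).aemeasurable).trans ?_
  refine lintegral_congr fun q => ?_
  rw [lintegral_prod _ (by fun_prop)]
  refine lintegral_congr fun d => lintegral_congr fun x => ?_
  simp only [phase]
  ring

/-- In the dual form the point `x` is the sixth point and enters with a minus sign, so the third
pair consists of `u` and the test function and is mapped by the difference. The constant is `2 *
80`. -/
theorem l2_posOp_le_energy {P Q : Circle × Circle → ℝ≥0∞} {u : Circle → ℝ≥0∞} {χ : ℂ → ℝ≥0∞}
    (hP : Measurable P) (hQ : Measurable Q) (hu : Measurable u) (hχ : Measurable χ) :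
    l2 (posOp P Q u χ) ≤
      160 * (∫⁻ z, χ z) * energy P ^ (2 / 3 : ℝ) * energy Q ^ (2 / 3 : ℝ) * l2 u := by
  refine l2_le_of_forall_lintegral_mul_le (measurable_posOp hP hQ hu hχ) fun g hg => ?_
  rw [lintegral_posOp_mul hP hQ hu hχ hg]
  refine (trilinear_le isTransversal_add isTransversal_add isTransversal_sub hχ hP hQ
    (S := fun r => u r.1 * g r.2) (by fun_prop)).trans ?_
  calc _ ≤ 2 * (∫⁻ z, χ z) * (energy P ^ (2 / 3 : ℝ) * energy Q ^ (2 / 3 : ℝ) *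
        (80 * (l2 u * l2 g))) := by
        gcongr
        exact energy_mul_rpow_le hu hg
    _ = _ := by ring

/-- The tensor product of two functions on the circle. -/
def tensor {R : Type*} [Mul R] (f g : Circle → R) : Circle × Circle → R := fun p => f p.1 * g p.2

@[fun_prop]
theorem measurable_tensor {R : Type*} [Mul R] [MeasurableSpace R] [MeasurableMul₂ R] {f g : Circle → R}
    (hf : Measurable f) (hg : Measurable g) : Measurable (tensor f g) := by
  unfold tensor; fun_prop

/-- The first pair keeps a general density, so that the cut-off density near parallel pairs and the
constant `1` can be inserted there. -/
theorem l2_posOp_le {P : Circle × Circle → ℝ≥0∞} {v w u : Circle → ℝ≥0∞} {χ : ℂ → ℝ≥0∞}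
    (hP : Measurable P) (hv : Measurable v) (hw : Measurable w) (hu : Measurable u)
    (hχ : Measurable χ) :
    l2 (posOp P (tensor v w) u χ) ≤
      12800 * (∫⁻ z, χ z) * energy P ^ (2 / 3 : ℝ) * (l2 v * l2 w * l2 u) := by
  refine (l2_posOp_le_energy hP (by fun_prop) hu hχ).trans ?_
  calc _ ≤ 160 * (∫⁻ z, χ z) * energy P ^ (2 / 3 : ℝ) * (80 * (l2 v * l2 w)) * l2 u := by
        gcongr
        exact energy_mul_rpow_le hv hw
    _ = _ := by ring

theorem l2_posOp_tensor_le {f g v w u : Circle → ℝ≥0∞} {χ : ℂ → ℝ≥0∞}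
    (hf : Measurable f) (hg : Measurable g) (hv : Measurable v) (hw : Measurable w)
    (hu : Measurable u) (hχ : Measurable χ) :
    l2 (posOp (tensor f g) (tensor v w) u χ) ≤
      1024000 * (∫⁻ z, χ z) * (l2 f * l2 g) * (l2 v * l2 w * l2 u) := by
  refine (l2_posOp_le (by fun_prop) hv hw hu hχ).trans ?_
  calc _ ≤ 12800 * (∫⁻ z, χ z) * (80 * (l2 f * l2 g)) * (l2 v * l2 w * l2 u) := by
        gcongr
        exact energy_mul_rpow_le hf hg
    _ = _ := by ring

/-! ### The multilinear operator -/

/-- The density at `x ∈ S¹` of the convolution of `P`, `Q`, `u` regularised by `φ`. -/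
def convOp (P Q : Circle × Circle → ℂ) (u : Circle → ℂ) (φ : ℂ → ℂ) (x : Circle) : ℂ :=
  ∫ t, P t.1 * Q t.2.1 * u t.2.2 * φ (phase t x) ∂quintMeasure

theorem enorm_convOp_le (P Q : Circle × Circle → ℂ) (u : Circle → ℂ) (φ : ℂ → ℂ) (x : Circle) :
    ‖convOp P Q u φ x‖ₑ ≤
      posOp (fun p => ‖P p‖ₑ) (fun q => ‖Q q‖ₑ) (fun d => ‖u d‖ₑ) (fun z => ‖φ z‖ₑ) x := by
  refine (enorm_integral_le_lintegral_enorm _).trans (le_of_eq ?_)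
  simp [posOp, enorm_mul]

/-! ### Averages along the rotation flow -/

theorem l2_add_le {f g : Circle → ℝ≥0∞} (hf : Measurable f) (hg : Measurable g) :
    l2 (fun x => f x + g x) ≤ l2 f + l2 g :=
  ENNReal.lintegral_Lp_add_le hf.aemeasurable hg.aemeasurable (by norm_num)

theorem l2_const_mul (c : ℝ≥0∞) {f : Circle → ℝ≥0∞} (hf : Measurable f) :
    l2 (fun x => c * f x) = c * l2 f := by
  simp_rw [l2, ENNReal.mul_rpow_of_nonneg _ _ (zero_le_two : (0 : ℝ) ≤ 2)]
  rw [lintegral_const_mul _ (by fun_prop), ENNReal.mul_rpow_of_nonneg _ _ (by norm_num),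
    ← ENNReal.rpow_mul]
  norm_num

theorem l2_comp_rot (t : ℝ) {f : Circle → ℝ≥0∞} (hf : Measurable f) :
    l2 (fun x => f (rot t x)) = l2 f := by
  rw [l2, l2, ← (measurePreserving_rot t).lintegral_comp (f := fun x => f x ^ (2 : ℝ)) (by fun_prop)]

theorem lintegral_le_l2 {f : Circle → ℝ≥0∞} (hf : Measurable f) : ∫⁻ x, f x ∂σ ≤ 3 * l2 f := by
  have h := ENNReal.lintegral_mul_norm_pow_le (μ := σ) (f := fun x => f x ^ (2 : ℝ)) (g := fun _ => 1)
    (p := 1 / 2) (q := 1 / 2) (by fun_prop) (by fun_prop) (by norm_num) (by norm_num) (by norm_num)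
  simp only [← ENNReal.rpow_mul, ENNReal.one_rpow, mul_one, lintegral_one, measure_univ_eq] at h
  norm_num at h
  refine h.trans ?_
  rw [l2, mul_comm]
  norm_num
  gcongr
  calc (2 * ENNReal.ofReal Real.pi) ^ (1 / 2 : ℝ) ≤ ENNReal.ofReal 9 ^ (1 / 2 : ℝ) := by
        rw [← ENNReal.ofReal_ofNat, ← ENNReal.ofReal_mul (by norm_num)]
        gcongr
        have := Real.pi_lt_d2
        linarith
    _ = 3 := by
        rw [ENNReal.ofReal_rpow_of_pos (by norm_num), show (9 : ℝ) = 3 ^ (2 : ℝ) by norm_num,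
          ← Real.rpow_mul (by norm_num)]
        norm_num

@[fun_prop]
theorem continuous_rot : Continuous fun p : ℝ × Circle => rot p.1 p.2 := by
  unfold rot
  have : Continuous fun p : ℝ × Circle => ((Circle.exp p.1 : Circle) : ℂ) * (p.2 : ℂ) := by fun_prop
  exact Continuous.subtype_mk this _

@[fun_prop]
theorem measurable_rot : Measurable fun p : ℝ × Circle => rot p.1 p.2 := continuous_rot.measurable

theorem rot_exp (t θ : ℝ) : rot t (Circle.exp θ) = Circle.exp (θ + t) := by
  rw [rot, ← Circle.exp_add, add_comm]

/-- The average of `f` over the arc from `x` to `rot η x`. -/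
def avg (η : ℝ) (f : Circle → ℂ) (x : Circle) : ℂ := (η : ℂ)⁻¹ * ∫ t in (0 : ℝ)..η, f (rot t x)

theorem intervalIntegrable_comp_exp {f : Circle → ℂ} (hf : Integrable f σ) (a b : ℝ) :
    IntervalIntegrable (fun θ => f (Circle.exp θ)) volume a b := by
  refine Function.Periodic.intervalIntegrable (T := 2 * Real.pi) (t := 0)
    (fun θ => by simp [Circle.exp_add]) (by have := Real.pi_pos; positivity) ?_ a b
  rw [intervalIntegrable_iff_integrableOn_Ioc_of_le (by have := Real.pi_pos; linarith)]
  exact ((measurePreserving_exp 0).integrable_comp hf.aestronglyMeasurable).2 hf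

theorem intervalIntegrable_comp_rot {f : Circle → ℂ} (hf : Integrable f σ) (x : Circle) (a b : ℝ) :
    IntervalIntegrable (fun t => f (rot t x)) volume a b := by
  obtain ⟨θ, rfl⟩ := Circle.exp_surjective x
  simp_rw [rot_exp]
  have := (intervalIntegrable_comp_exp hf (θ + a) (θ + b)).comp_add_left θ
  simpa using this

theorem avg_exp (η : ℝ) (f : Circle → ℂ) (θ : ℝ) :
    avg η f (Circle.exp θ) = (η : ℂ)⁻¹ * ∫ s in θ..θ + η, f (Circle.exp s) := by
  simp_rw [avg, rot_exp]
  rw [intervalIntegral.integral_comp_add_left (fun s => f (Circle.exp s)) θ, add_zero]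

theorem measurable_avg (η : ℝ) {f : Circle → ℂ} (hf : Measurable f) : Measurable (avg η f) := by
  unfold avg intervalIntegral
  have h : StronglyMeasurable fun p : Circle × ℝ => f (rot p.2 p.1) := by
    apply Measurable.stronglyMeasurable
    exact hf.comp (measurable_rot.comp measurable_swap)
  exact measurable_const.mul (h.integral_prod_right'.measurable.sub h.integral_prod_right'.measurable)

theorem enorm_ofReal_inv {η : ℝ} (hη : 0 < η) : ‖((η : ℂ))⁻¹‖ₑ = ENNReal.ofReal η⁻¹ := by
  rw [← ofReal_norm, norm_inv, Complex.norm_real, Real.norm_of_nonneg hη.le]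

theorem enorm_avg_le {η : ℝ} (hη : 0 < η) (f : Circle → ℂ) (x : Circle) :
    ‖avg η f x‖ₑ ≤ ENNReal.ofReal η⁻¹ * ∫⁻ t in Ioc 0 η, ‖f (rot t x)‖ₑ := by
  rw [avg, enorm_mul, intervalIntegral.integral_of_le hη.le, enorm_ofReal_inv hη]
  gcongr
  exact enorm_integral_le_lintegral_enorm _

theorem avg_sub_const {η : ℝ} (hη : 0 < η) {f : Circle → ℂ} (hf : Integrable f σ) (x : Circle) :
    avg η f x - f x = (η : ℂ)⁻¹ * ∫ t in (0 : ℝ)..η, (f (rot t x) - f x) := by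
  rw [intervalIntegral.integral_sub (intervalIntegrable_comp_rot hf x 0 η) (by simp), mul_sub, avg]
  have : (η : ℂ) ≠ 0 := by exact_mod_cast hη.ne'
  simp [this]

/-- Cauchy-Schwarz in `t` followed by Tonelli: an average of functions has norm at most the largest
of theirs. -/
theorem l2_average_le {η : ℝ} (hη : 0 < η) {G : ℝ → Circle → ℝ≥0∞}
    (hG : Measurable fun p : ℝ × Circle => G p.1 p.2) {b : ℝ≥0∞} (hb : ∀ t ∈ Ioc 0 η, l2 (G t) ≤ b) :
    l2 (fun x => ENNReal.ofReal η⁻¹ * ∫⁻ t in Ioc 0 η, G t x) ≤ b := by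
  have hη0 : ENNReal.ofReal η ≠ 0 := by simpa using hη
  have hη1 : ENNReal.ofReal η ≠ ∞ := ENNReal.ofReal_ne_top
  have hpt : ∀ x, (ENNReal.ofReal η⁻¹ * ∫⁻ t in Ioc 0 η, G t x) ^ (2 : ℝ) ≤
      ENNReal.ofReal η⁻¹ * ∫⁻ t in Ioc 0 η, G t x ^ (2 : ℝ) := by
    intro x
    have hGx : Measurable fun t => G t x := hG.comp (measurable_id.prodMk measurable_const)
    have h := ENNReal.lintegral_mul_norm_pow_le (μ := volume.restrict (Ioc 0 η))
      (f := fun t => G t x ^ (2 : ℝ)) (g := fun _ => 1)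
      (p := 1 / 2) (q := 1 / 2) (by fun_prop) (by fun_prop) (by norm_num) (by norm_num) (by norm_num)
    simp only [← ENNReal.rpow_mul, ENNReal.one_rpow, mul_one, lintegral_one,
      Measure.restrict_apply_univ, Real.volume_Ioc, sub_zero] at h
    rw [show (2 : ℝ) * (1 / 2) = 1 by norm_num] at h
    simp only [ENNReal.rpow_one] at h
    calc _ ≤ (ENNReal.ofReal η⁻¹ * ((∫⁻ t in Ioc 0 η, G t x ^ (2 : ℝ)) ^ (1 / 2 : ℝ) *
          ENNReal.ofReal η ^ (1 / 2 : ℝ))) ^ (2 : ℝ) := by gcongr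
      _ = (ENNReal.ofReal η⁻¹ * ENNReal.ofReal η⁻¹ * ENNReal.ofReal η) *
          ∫⁻ t in Ioc 0 η, G t x ^ (2 : ℝ) := by
          rw [ENNReal.mul_rpow_of_nonneg _ _ (by norm_num),
            ENNReal.mul_rpow_of_nonneg _ _ (by norm_num), ← ENNReal.rpow_mul, ← ENNReal.rpow_mul,
            show (2 : ℝ) = ((2 : ℕ) : ℝ) by norm_num, ENNReal.rpow_natCast]
          norm_num
          ring
      _ = _ := by
          rw [mul_assoc (ENNReal.ofReal η⁻¹), ENNReal.ofReal_inv_of_pos hη,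
            ENNReal.inv_mul_cancel hη0 hη1, mul_one]
  have hswap : ∫⁻ x, (∫⁻ t in Ioc 0 η, G t x ^ (2 : ℝ)) ∂σ =
      ∫⁻ t in Ioc 0 η, (∫⁻ x, G t x ^ (2 : ℝ) ∂σ) :=
    lintegral_lintegral_swap (f := fun (x : Circle) (t : ℝ) => G t x ^ (2 : ℝ))
      ((hG.pow_const _).comp measurable_swap).aemeasurable
  have h2 : ∫⁻ x, (ENNReal.ofReal η⁻¹ * ∫⁻ t in Ioc 0 η, G t x) ^ (2 : ℝ) ∂σ ≤ b ^ (2 : ℝ) := by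
    calc _ ≤ ∫⁻ x, (ENNReal.ofReal η⁻¹ * ∫⁻ t in Ioc 0 η, G t x ^ (2 : ℝ)) ∂σ := lintegral_mono hpt
      _ = ENNReal.ofReal η⁻¹ * ∫⁻ t in Ioc 0 η, l2 (G t) ^ (2 : ℝ) := by
          rw [lintegral_const_mul' _ _ ENNReal.ofReal_ne_top, hswap]
          simp_rw [l2_rpow_two]
      _ ≤ ENNReal.ofReal η⁻¹ * ∫⁻ _ in Ioc 0 η, b ^ (2 : ℝ) := by
          gcongr 1
          exact setLIntegral_mono measurable_const fun t ht =>
            ENNReal.rpow_le_rpow (hb t ht) (by norm_num)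
      _ = b ^ (2 : ℝ) := by
          rw [lintegral_const, Measure.restrict_apply_univ, Real.volume_Ioc, sub_zero, mul_comm,
            mul_assoc, ENNReal.ofReal_inv_of_pos hη, ENNReal.mul_inv_cancel hη0 hη1, mul_one]
  calc _ ≤ (b ^ (2 : ℝ)) ^ (1 / 2 : ℝ) := by unfold l2; gcongr
    _ = b := by rw [← ENNReal.rpow_mul]; norm_num

theorem l2_avg_le {η : ℝ} (hη : 0 < η) {f : Circle → ℂ} (hf : Measurable f) :
    l2 (fun x => ‖avg η f x‖ₑ) ≤ l2 fun x => ‖f x‖ₑ := by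
  refine (l2_mono (enorm_avg_le hη f)).trans ?_
  refine l2_average_le hη (G := fun t x => ‖f (rot t x)‖ₑ) (by fun_prop) fun t _ => ?_
  exact (l2_comp_rot t (f := fun x => ‖f x‖ₑ) (by fun_prop)).le

theorem l2_avg_sub_le {η : ℝ} (hη : 0 < η) {f : Circle → ℂ} (hf : Measurable f)
    (hfi : Integrable f σ) {b : ℝ≥0∞}
    (hb : ∀ t ∈ Ioc 0 η, l2 (fun x => ‖f (rot t x) - f x‖ₑ) ≤ b) :
    l2 (fun x => ‖avg η f x - f x‖ₑ) ≤ b := by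
  refine (l2_mono fun x => ?_).trans
    (l2_average_le hη (G := fun t x => ‖f (rot t x) - f x‖ₑ) (by fun_prop) hb)
  rw [avg_sub_const hη hfi, enorm_mul, intervalIntegral.integral_of_le hη.le, enorm_ofReal_inv hη]
  gcongr
  exact enorm_integral_le_lintegral_enorm _

theorem lintegral_rot_le_l2 {η : ℝ} (hη1 : η ≤ 1) {f : Circle → ℂ}
    (hf : Measurable f) (x : Circle) :
    ∫⁻ t in Ioc 0 η, ‖f (rot t x)‖ₑ ≤ 3 * l2 fun x => ‖f x‖ₑ := by
  refine le_trans ?_ (lintegral_le_l2 (f := fun x => ‖f x‖ₑ) (by fun_prop))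
  rw [← lintegral_mul_left_eq x (f := fun x => ‖f x‖ₑ) (by fun_prop),
    ← (measurePreserving_exp 0).lintegral_comp (by
      have := (measurePreserving_mul_left x).measurable; fun_prop)]
  simp_rw [rot, mul_comm x]
  -- An arc of length at most `1` lies within a single period.
  refine lintegral_mono_set fun t ht => ⟨ht.1, ?_⟩
  have := Real.pi_gt_three
  linarith [ht.2]

theorem norm_avg_le {η : ℝ} (hη : 0 < η) (hη1 : η ≤ 1) {f : Circle → ℂ} (hf : Measurable f) {a : ℝ≥0}
    (ha : l2 (fun x => ‖f x‖ₑ) ≤ a) (x : Circle) : ‖avg η f x‖ ≤ 3 * a / η := by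
  have h : ‖avg η f x‖ₑ ≤ ENNReal.ofReal (3 * a / η) := by
    refine (enorm_avg_le hη f x).trans ?_
    calc _ ≤ ENNReal.ofReal η⁻¹ * (3 * a) := by
          gcongr
          exact (lintegral_rot_le_l2 hη1 hf x).trans (by gcongr)
      _ = _ := by
          rw [div_eq_inv_mul, ENNReal.ofReal_mul (by positivity), ENNReal.ofReal_mul (by norm_num)]
          simp
  rw [← ofReal_norm, ENNReal.ofReal_le_ofReal_iff (by positivity)] at h
  exact h

theorem norm_avg_le_of_norm_le {η : ℝ} (hη : 0 < η) {f : Circle → ℂ} {M : ℝ} (hM : ∀ x, ‖f x‖ ≤ M)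
    (x : Circle) : ‖avg η f x‖ ≤ M := by
  have h := intervalIntegral.norm_integral_le_of_norm_le_const (a := 0) (b := η)
    (f := fun t => f (rot t x)) (C := M) fun t _ => hM _
  rw [sub_zero, abs_of_pos hη] at h
  rw [avg, norm_mul, norm_inv, Complex.norm_real, Real.norm_of_nonneg hη.le, inv_mul_le_iff₀ hη,
    mul_comm η]
  exact h

theorem continuous_avg_exp (η : ℝ) {f : Circle → ℂ} (hf : Integrable f σ) :
    Continuous fun θ => avg η f (Circle.exp θ) := by
  simp_rw [avg_exp]
  have hc := intervalIntegral.continuous_primitive (intervalIntegrable_comp_exp hf) 0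
  have : ∀ θ, ∫ s in θ..θ + η, f (Circle.exp s) =
      (∫ s in (0 : ℝ)..θ + η, f (Circle.exp s)) - ∫ s in (0 : ℝ)..θ, f (Circle.exp s) := fun θ => by
    rw [intervalIntegral.integral_interval_sub_left (intervalIntegrable_comp_exp hf _ _)
      (intervalIntegrable_comp_exp hf _ _)]
  simp_rw [this]
  exact continuous_const.mul ((hc.comp (continuous_id.add continuous_const)).sub hc)

theorem hasDerivAt_avg_exp (η : ℝ) {g : Circle → ℂ} (hg : Continuous fun θ => g (Circle.exp θ))
    (θ : ℝ) : HasDerivAt (fun θ => avg η g (Circle.exp θ))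
      ((η : ℂ)⁻¹ * (g (Circle.exp (θ + η)) - g (Circle.exp θ))) θ := by
  simp_rw [avg_exp]
  have hi : ∀ a b, IntervalIntegrable (fun θ => g (Circle.exp θ)) volume a b :=
    fun a b => hg.intervalIntegrable a b
  have : ∀ θ, ∫ s in θ..θ + η, g (Circle.exp s) =
      (∫ s in (0 : ℝ)..θ + η, g (Circle.exp s)) - ∫ s in (0 : ℝ)..θ, g (Circle.exp s) := fun θ => by
    rw [intervalIntegral.integral_interval_sub_left (hi _ _) (hi _ _)]
  simp_rw [this]
  have h1 : ∀ u, HasDerivAt (fun u => ∫ s in (0 : ℝ)..u, g (Circle.exp s)) (g (Circle.exp u)) u :=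
    fun u => intervalIntegral.integral_hasDerivAt_right (hi _ _)
      (hg.stronglyMeasurableAtFilter _ _) hg.continuousAt
  exact (((h1 (θ + η)).comp_add_const θ η).sub (h1 θ)).const_mul _

/-- The function `f` is averaged twice over arcs of length `η`. The first average is bounded by
`3a/η` and continuous; the second is differentiable, and its derivative is a difference quotient of
the first, whence `6a/η²`. Each average costs `b` in `L²`. -/
theorem exists_smooth_approx {η : ℝ} (hη : 0 < η) (hη1 : η ≤ 1) {f : Circle → ℂ} (hf : Measurable f)
    {a : ℝ≥0} (ha : l2 (fun x => ‖f x‖ₑ) ≤ a) {b : ℝ≥0∞}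
    (hb : ∀ t ∈ Ioc 0 η, l2 (fun x => ‖f (rot t x) - f x‖ₑ) ≤ b) :
    ∃ (g : Circle → ℂ) (g' : ℝ → ℂ), Measurable g ∧ Continuous g' ∧
      (∀ θ, HasDerivAt (fun θ => g (Circle.exp θ)) (g' θ) θ) ∧
      (∀ x, ‖g x‖ ≤ 3 * a / η) ∧ (∀ θ, ‖g' θ‖ ≤ 6 * a / η ^ 2) ∧
      l2 (fun x => ‖g x‖ₑ) ≤ a ∧ l2 (fun x => ‖f x - g x‖ₑ) ≤ 2 * b := by
  have hfi : Integrable f σ := by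
    refine ⟨hf.aestronglyMeasurable, (lintegral_le_l2 (f := fun x => ‖f x‖ₑ) (by fun_prop)).trans_lt ?_⟩
    exact ENNReal.mul_lt_top (by norm_num) (ha.trans_lt ENNReal.coe_lt_top)
  set h := avg η f with hh
  have hm : Measurable h := measurable_avg η hf
  have hc : Continuous fun θ => h (Circle.exp θ) := continuous_avg_exp η hfi
  have hM : ∀ x, ‖h x‖ ≤ 3 * a / η := norm_avg_le hη hη1 hf ha
  have hhi : Integrable h σ := (Integrable.of_bound hm.aestronglyMeasurable _ (Eventually.of_forall hM))
  refine ⟨avg η h, fun θ => (η : ℂ)⁻¹ * (h (Circle.exp (θ + η)) - h (Circle.exp θ)),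
    measurable_avg η hm, ?_, hasDerivAt_avg_exp η hc, norm_avg_le_of_norm_le hη hM, ?_, ?_, ?_⟩
  · exact continuous_const.mul ((hc.comp (continuous_id.add continuous_const)).sub hc)
  · intro θ
    rw [norm_mul, norm_inv, Complex.norm_real, Real.norm_of_nonneg hη.le, inv_mul_le_iff₀ hη]
    calc _ ≤ 3 * a / η + 3 * a / η := (norm_sub_le _ _).trans (add_le_add (hM _) (hM _))
      _ = _ := by field_simp; ring
  · exact ((l2_avg_le hη hm).trans (l2_avg_le hη hf)).trans ha
  · have h1 : l2 (fun x => ‖h x - f x‖ₑ) ≤ b := l2_avg_sub_le hη hf hfi hb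
    have h2 : l2 (fun x => ‖avg η h x - h x‖ₑ) ≤ b := by
      refine l2_avg_sub_le hη hm hhi fun t ht => le_trans ?_ (hb t ht)
      -- Averaging commutes with rotations, so `h` inherits the modulus of continuity of `f`.
      have : ∀ x, h (rot t x) - h x = avg η (fun y => f (rot t y) - f y) x := by
        intro x
        have hcomm : ∀ s, rot s (rot t x) = rot t (rot s x) := fun s => by
          simp only [rot]; rw [mul_left_comm]
        rw [hh, avg, avg, avg, ← mul_sub, ← intervalIntegral.integral_sub
          (intervalIntegrable_comp_rot hfi _ _ _) (intervalIntegrable_comp_rot hfi _ _ _)]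
        simp_rw [hcomm]
      simp_rw [this]
      exact l2_avg_le hη (f := fun y => f (rot t y) - f y) (by fun_prop)
    calc _ ≤ l2 (fun x => ‖avg η h x - h x‖ₑ + ‖h x - f x‖ₑ) := by
          refine l2_mono fun x => ?_
          rw [← enorm_neg, neg_sub]
          calc _ = ‖(avg η h x - h x) + (h x - f x)‖ₑ := by rw [sub_add_sub_cancel]
            _ ≤ _ := enorm_add_le _ _
      _ ≤ b + b := (l2_add_le ((measurable_avg η hm).sub hm).enorm (by fun_prop)).trans
          (add_le_add h2 h1)
      _ = 2 * b := (two_mul b).symm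

/-! ### Integration by parts on the torus -/

/-- The regularised cosecant. -/
def csc (κ ψ : ℝ) : ℝ := Real.sin ψ / (Real.sin ψ ^ 2 + κ ^ 2)

/-- The derivative of the regularised cosecant. -/
def cscDeriv (κ ψ : ℝ) : ℝ :=
  Real.cos ψ * (κ ^ 2 - Real.sin ψ ^ 2) / (Real.sin ψ ^ 2 + κ ^ 2) ^ 2

theorem sin_sq_add_pos {κ : ℝ} (hκ : 0 < κ) (ψ : ℝ) : 0 < Real.sin ψ ^ 2 + κ ^ 2 := by positivity

theorem hasDerivAt_csc {κ : ℝ} (hκ : 0 < κ) (ψ : ℝ) : HasDerivAt (csc κ) (cscDeriv κ ψ) ψ := by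
  have h := (Real.hasDerivAt_sin ψ).div (((Real.hasDerivAt_sin ψ).pow 2).add_const (κ ^ 2))
    (sin_sq_add_pos hκ ψ).ne'
  refine h.congr_deriv ?_
  simp only [cscDeriv, Pi.pow_apply]
  congr 1
  push_cast
  ring

theorem continuous_csc {κ : ℝ} (hκ : 0 < κ) : Continuous (csc κ) :=
  Real.continuous_sin.div (by fun_prop) fun ψ => (sin_sq_add_pos hκ ψ).ne'

theorem continuous_cscDeriv {κ : ℝ} (hκ : 0 < κ) : Continuous (cscDeriv κ) :=
  Continuous.div (by fun_prop) (by fun_prop) fun ψ => (pow_pos (sin_sq_add_pos hκ ψ) 2).ne'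

theorem abs_csc_le {κ : ℝ} (hκ : 0 < κ) (ψ : ℝ) : |csc κ ψ| ≤ 1 / κ ^ 2 := by
  rw [csc, abs_div, abs_of_pos (sin_sq_add_pos hκ ψ)]
  gcongr
  · exact Real.abs_sin_le_one ψ
  · nlinarith [sq_nonneg (Real.sin ψ)]

theorem abs_cscDeriv_le {κ : ℝ} (hκ : 0 < κ) (ψ : ℝ) : |cscDeriv κ ψ| ≤ 1 / κ ^ 2 := by
  have hp := sin_sq_add_pos hκ ψ
  rw [cscDeriv, abs_div, abs_mul, abs_of_pos (pow_pos hp 2)]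
  have h1 : |κ ^ 2 - Real.sin ψ ^ 2| ≤ Real.sin ψ ^ 2 + κ ^ 2 := by
    rw [abs_le]; constructor <;> nlinarith [sq_nonneg (Real.sin ψ), sq_nonneg κ]
  calc _ ≤ 1 * (Real.sin ψ ^ 2 + κ ^ 2) / (Real.sin ψ ^ 2 + κ ^ 2) ^ 2 := by
        gcongr
        exact Real.abs_cos_le_one ψ
    _ = 1 / (Real.sin ψ ^ 2 + κ ^ 2) := by field_simp
    _ ≤ 1 / κ ^ 2 := by
        gcongr
        nlinarith [sq_nonneg (Real.sin ψ)]

/-- Lebesgue measure on a period. -/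
def period : Measure ℝ := volume.restrict (Ioc (-Real.pi) Real.pi)

instance : IsFiniteMeasure period := by unfold period; infer_instance

theorem integrable_period_prod {F : ℝ × ℝ → ℂ} (hF : Continuous F) :
    Integrable F (period.prod period) := by
  rw [period, Measure.prod_restrict]
  have : IntegrableOn F (Icc (-Real.pi) Real.pi ×ˢ Icc (-Real.pi) Real.pi)
      ((volume : Measure ℝ).prod volume) :=
    hF.continuousOn.integrableOn_compact (isCompact_Icc.prod isCompact_Icc)
  exact this.mono_set (prod_mono Ioc_subset_Icc_self Ioc_subset_Icc_self)

theorem integral_period_deriv {H H' : ℝ → ℂ} (hH : ∀ θ, HasDerivAt H (H' θ) θ) (hc : Continuous H')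
    (hper : H Real.pi = H (-Real.pi)) : ∫ θ, H' θ ∂period = 0 := by
  have hpi := Real.pi_pos
  rw [period, ← intervalIntegral.integral_of_le (by linarith),
    intervalIntegral.integral_eq_sub_of_hasDerivAt (fun θ _ => hH θ) (hc.intervalIntegrable _ _),
    hper, sub_self]

/-- The squared norm of `exp(iα) + exp(iβ) + b`. -/
def sumSq (b : ℂ) (α β : ℝ) : ℝ :=
  (Real.cos α + Real.cos β + b.re) ^ 2 + (Real.sin α + Real.sin β + b.im) ^ 2

theorem sumSq_comm (b : ℂ) (α β : ℝ) : sumSq b α β = sumSq b β α := by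
  simp only [sumSq]; ring

/-- The component along `exp(iβ)` of the radial field with profile `q` at `exp(iα) + exp(iβ) + b`. -/
def radialComp (q : ℝ → ℝ) (b : ℂ) (α β : ℝ) : ℝ :=
  q (sumSq b α β) * ((Real.cos α + Real.cos β + b.re) * Real.cos β +
    (Real.sin α + Real.sin β + b.im) * Real.sin β)

/-- The field has length `|q| √s` at squared radius `s`, and `exp(iβ)` is a unit vector. -/
theorem abs_radialComp_le (q : ℝ → ℝ) (b : ℂ) (α β : ℝ) :
    |radialComp q b α β| ≤ |q (sumSq b α β)| * √(sumSq b α β) := by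
  rw [radialComp, abs_mul]
  gcongr
  refine Real.abs_le_sqrt ?_
  rw [sumSq]
  set u := Real.cos α + Real.cos β + b.re
  set v := Real.sin α + Real.sin β + b.im
  nlinarith [sq_nonneg (u * Real.sin β - v * Real.cos β), Real.sin_sq_add_cos_sq β]

/-- The derivative in `α` of `radialComp q b α β`. -/
def radialCompDeriv (q q' : ℝ → ℝ) (b : ℂ) (α β : ℝ) : ℝ :=
  q' (sumSq b α β) * (2 * ((Real.cos α + Real.cos β + b.re) * (-Real.sin α) +
    (Real.sin α + Real.sin β + b.im) * Real.cos α)) *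
    ((Real.cos α + Real.cos β + b.re) * Real.cos β +
    (Real.sin α + Real.sin β + b.im) * Real.sin β) + q (sumSq b α β) * Real.sin (β - α)

theorem hasDerivAt_radialComp {q q' : ℝ → ℝ} (hq : ∀ s, HasDerivAt q (q' s) s) (b : ℂ) (α β : ℝ) :
    HasDerivAt (fun α => radialComp q b α β) (radialCompDeriv q q' b α β) α := by
  have h1 : HasDerivAt (fun α => Real.cos α + Real.cos β + b.re) (-Real.sin α) α :=
    ((Real.hasDerivAt_cos α).add_const _).add_const _
  have h2 : HasDerivAt (fun α => Real.sin α + Real.sin β + b.im) (Real.cos α) α :=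
    ((Real.hasDerivAt_sin α).add_const _).add_const _
  have h3 : HasDerivAt (fun α => sumSq b α β)
      (2 * ((Real.cos α + Real.cos β + b.re) * (-Real.sin α) +
        (Real.sin α + Real.sin β + b.im) * Real.cos α)) α := by
    refine ((h1.pow 2).add (h2.pow 2)).congr_deriv ?_
    push_cast
    ring
  have h4 := (hq (sumSq b α β)).comp α h3
  refine (h4.mul ((h1.mul_const (Real.cos β)).add (h2.mul_const (Real.sin β)))).congr_deriv ?_
  simp only [radialCompDeriv, Function.comp_apply, Pi.add_apply, Real.sin_sub]
  ring

/-- This is the divergence theorem's integrand in the coordinates `z = exp(iα) + exp(iβ) + b`. The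
divergence of `z ↦ q(|z|²) z` is `2q + 2sq'` with `s = |z|²`, and the Jacobian of the coordinates is
`sin(β - α)`. -/
theorem radialCompDeriv_sub (q q' : ℝ → ℝ) (b : ℂ) (α β : ℝ) :
    radialCompDeriv q q' b α β - radialCompDeriv q q' b β α =
      Real.sin (β - α) * (2 * q (sumSq b α β) + 2 * sumSq b α β * q' (sumSq b α β)) := by
  rw [radialCompDeriv, radialCompDeriv, sumSq_comm b β α]
  generalize q (sumSq b α β) = a
  generalize q' (sumSq b α β) = a'
  rw [sumSq, Real.sin_sub, Real.sin_sub]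
  ring

theorem continuous_sumSq (b : ℂ) : Continuous fun p : ℝ × ℝ => sumSq b p.1 p.2 := by
  unfold sumSq; fun_prop

theorem continuous_radialComp {q : ℝ → ℝ} (hq : Continuous q) (b : ℂ) :
    Continuous fun p : ℝ × ℝ => radialComp q b p.1 p.2 := by
  have := continuous_sumSq b
  unfold radialComp; fun_prop

theorem continuous_radialCompDeriv {q q' : ℝ → ℝ} (hq : Continuous q) (hq' : Continuous q') (b : ℂ) :
    Continuous fun p : ℝ × ℝ => radialCompDeriv q q' b p.1 p.2 := by
  have := continuous_sumSq b
  unfold radialCompDeriv; fun_prop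

section

variable {q q' : ℝ → ℝ} {G₁ G₁' G₂ G₂' : ℝ → ℂ} {κ : ℝ}

/-- The derivative in `α` of `G α * csc κ (β - α) * radialComp q b α β`. -/
def totalTerm (q q' : ℝ → ℝ) (G G' : ℝ → ℂ) (κ : ℝ) (b : ℂ) (α β : ℝ) : ℂ :=
  G' α * ((csc κ (β - α) * radialComp q b α β : ℝ) : ℂ) +
    G α * ((-cscDeriv κ (β - α) * radialComp q b α β +
      csc κ (β - α) * radialCompDeriv q q' b α β : ℝ) : ℂ)

/-- The derivative in `α` of `G α * csc κ (β - α)`. -/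
def remTerm (G G' : ℝ → ℂ) (κ : ℝ) (α β : ℝ) : ℂ :=
  G' α * (csc κ (β - α) : ℂ) - G α * (cscDeriv κ (β - α) : ℂ)

theorem continuous_totalTerm (hq : Continuous q) (hq' : Continuous q') (hG₁ : Continuous G₁)
    (hG₁' : Continuous G₁') (hκ : 0 < κ) (b : ℂ) :
    Continuous fun p : ℝ × ℝ => totalTerm q q' G₁ G₁' κ b p.1 p.2 := by
  have hr := continuous_radialComp hq b
  have hr' := continuous_radialCompDeriv hq hq' b
  have hcs := continuous_csc hκ
  have hcs' := continuous_cscDeriv hκ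
  unfold totalTerm
  fun_prop

theorem continuous_remTerm (hG₁ : Continuous G₁) (hG₁' : Continuous G₁') (hκ : 0 < κ) :
    Continuous fun p : ℝ × ℝ => remTerm G₁ G₁' κ p.1 p.2 := by
  have hcs := continuous_csc hκ
  have hcs' := continuous_cscDeriv hκ
  unfold remTerm
  fun_prop

theorem norm_remTerm_le (hκ : 0 < κ) {M D : ℝ} (hM : ∀ θ, ‖G₁ θ‖ ≤ M) (hD : ∀ θ, ‖G₁' θ‖ ≤ D)
    (α β : ℝ) : ‖remTerm G₁ G₁' κ α β‖ ≤ (D + M) * (1 / κ ^ 2) := by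
  have hM0 : 0 ≤ M := (norm_nonneg _).trans (hM 0)
  have hD0 : 0 ≤ D := (norm_nonneg _).trans (hD 0)
  calc _ ≤ ‖G₁' α‖ * |csc κ (β - α)| + ‖G₁ α‖ * |cscDeriv κ (β - α)| := by
        refine (norm_sub_le _ _).trans ?_
        simp
    _ ≤ D * (1 / κ ^ 2) + M * (1 / κ ^ 2) := by
        gcongr
        exacts [hD α, abs_csc_le hκ _, hM α, abs_cscDeriv_le hκ _]
    _ = _ := by ring

/-- Dividing by the Jacobian is regularised by `csc κ`. The product rule splits the density into
total derivatives in `α` and in `β`, minus the terms where the derivative falls on `G` or on `csc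
κ`. Oddness of `csc κ` accounts for the sign in the `β` term. -/
theorem div_eq_totalTerm (b : ℂ) (α β : ℝ) :
    G₁ α * G₂ β * ((csc κ (β - α) * Real.sin (β - α) *
      (2 * q (sumSq b α β) + 2 * sumSq b α β * q' (sumSq b α β)) : ℝ) : ℂ) =
      G₂ β * totalTerm q q' G₁ G₁' κ b α β + G₁ α * totalTerm q q' G₂ G₂' κ b β α -
      (remTerm G₁ G₁' κ α β * (G₂ β * (radialComp q b α β : ℂ)) +
        remTerm G₂ G₂' κ β α * (G₁ α * (radialComp q b β α : ℂ))) := by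
  have h1 := radialCompDeriv_sub q q' b α β
  have h2 : csc κ (α - β) = - csc κ (β - α) := by
    have hodd : ∀ ψ, csc κ (-ψ) = -csc κ ψ := fun ψ => by simp [csc, neg_div]
    have := hodd (β - α)
    rwa [neg_sub] at this
  rw [mul_assoc (csc κ (β - α)), ← h1, totalTerm, totalTerm, remTerm, remTerm, h2]
  push_cast
  ring

theorem integral_totalTerm (hq : ∀ s, HasDerivAt q (q' s) s) (hq' : Continuous q')
    (hG₁ : ∀ θ, HasDerivAt G₁ (G₁' θ) θ) (hG₁' : Continuous G₁')
    (hper : G₁ Real.pi = G₁ (-Real.pi)) (hκ : 0 < κ) (b : ℂ) (β : ℝ) :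
    ∫ α, totalTerm q q' G₁ G₁' κ b α β ∂period = 0 := by
  have hqc : Continuous q := continuous_iff_continuousAt.2 fun s => (hq s).continuousAt
  have hG₁c : Continuous G₁ := continuous_iff_continuousAt.2 fun s => (hG₁ s).continuousAt
  refine integral_period_deriv
    (H := fun α => G₁ α * ((csc κ (β - α) * radialComp q b α β : ℝ) : ℂ)) (fun α => ?_)
    (Continuous.comp (g := fun p : ℝ × ℝ => totalTerm q q' G₁ G₁' κ b p.1 p.2)
      (f := fun α => (α, β)) (continuous_totalTerm hqc hq' hG₁c hG₁' hκ b) (by fun_prop)) ?_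
  · have h1 : HasDerivAt (fun α => csc κ (β - α)) (-cscDeriv κ (β - α)) α := by
      simpa using (hasDerivAt_csc hκ (β - α)).comp_const_sub β α
    have h2 : HasDerivAt (fun α => csc κ (β - α) * radialComp q b α β)
        (-cscDeriv κ (β - α) * radialComp q b α β + csc κ (β - α) * radialCompDeriv q q' b α β) α :=
      h1.fun_mul (hasDerivAt_radialComp hq b α β)
    exact (hG₁ α).fun_mul h2.ofReal_comp
  · simp only [hper, csc, radialComp, sumSq, Real.sin_sub, Real.cos_pi, Real.sin_pi, Real.cos_neg,
      Real.sin_neg, neg_zero]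

/-- Periodicity kills the total derivatives. What remains contains the field undifferentiated, so it
is bounded by the size of the field; the regularised cosecant and its derivative cost `1/κ²`. -/
theorem norm_integral_div_le (hq : ∀ s, HasDerivAt q (q' s) s) (hq' : Continuous q')
    (hG₁ : ∀ θ, HasDerivAt G₁ (G₁' θ) θ) (hG₁' : Continuous G₁')
    (hper₁ : G₁ Real.pi = G₁ (-Real.pi))
    (hG₂ : ∀ θ, HasDerivAt G₂ (G₂' θ) θ) (hG₂' : Continuous G₂')
    (hper₂ : G₂ Real.pi = G₂ (-Real.pi)) (hκ : 0 < κ) (b : ℂ) {M₁ M₂ D₁ D₂ : ℝ}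
    (hM₁ : ∀ θ, ‖G₁ θ‖ ≤ M₁) (hM₂ : ∀ θ, ‖G₂ θ‖ ≤ M₂) (hD₁ : ∀ θ, ‖G₁' θ‖ ≤ D₁)
    (hD₂ : ∀ θ, ‖G₂' θ‖ ≤ D₂) :
    ‖∫ p, G₁ p.1 * G₂ p.2 * ((csc κ (p.2 - p.1) * Real.sin (p.2 - p.1) *
      (2 * q (sumSq b p.1 p.2) + 2 * sumSq b p.1 p.2 * q' (sumSq b p.1 p.2)) : ℝ) : ℂ)
      ∂(period.prod period)‖ ≤
      (((D₁ + M₁) * M₂ + (D₂ + M₂) * M₁) * (1 / κ ^ 2)) *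
        ∫ p, |q (sumSq b p.1 p.2)| * √(sumSq b p.1 p.2) ∂(period.prod period) := by
  have hqc : Continuous q := continuous_iff_continuousAt.2 fun s => (hq s).continuousAt
  have hG₁c : Continuous G₁ := continuous_iff_continuousAt.2 fun s => (hG₁ s).continuousAt
  have hG₂c : Continuous G₂ := continuous_iff_continuousAt.2 fun s => (hG₂ s).continuousAt
  have hr : Continuous fun p : ℝ × ℝ => ((radialComp q b p.1 p.2 : ℝ) : ℂ) :=
    Continuous.comp (g := fun x : ℝ => (x : ℂ)) (f := fun p : ℝ × ℝ => radialComp q b p.1 p.2)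
      Complex.continuous_ofReal (continuous_radialComp hqc b)
  have hsw : Continuous fun p : ℝ × ℝ => (p.2, p.1) := continuous_swap
  have hrs : Continuous fun p : ℝ × ℝ => ((radialComp q b p.2 p.1 : ℝ) : ℂ) :=
    Continuous.comp (g := fun p : ℝ × ℝ => ((radialComp q b p.1 p.2 : ℝ) : ℂ))
      (f := fun p : ℝ × ℝ => (p.2, p.1)) hr hsw
  have ht₁ := continuous_totalTerm hqc hq' hG₁c hG₁' hκ b
  have ht₂ : Continuous fun p : ℝ × ℝ => totalTerm q q' G₂ G₂' κ b p.2 p.1 :=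
    Continuous.comp (g := fun p : ℝ × ℝ => totalTerm q q' G₂ G₂' κ b p.1 p.2)
      (f := fun p : ℝ × ℝ => (p.2, p.1)) (continuous_totalTerm hqc hq' hG₂c hG₂' hκ b) hsw
  have hm₁ := continuous_remTerm hG₁c hG₁' hκ
  have hm₂ : Continuous fun p : ℝ × ℝ => remTerm G₂ G₂' κ p.2 p.1 :=
    Continuous.comp (g := fun p : ℝ × ℝ => remTerm G₂ G₂' κ p.1 p.2)
      (f := fun p : ℝ × ℝ => (p.2, p.1)) (continuous_remTerm hG₂c hG₂' hκ) hsw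
  have i₁ : Integrable (fun p : ℝ × ℝ => G₂ p.2 * totalTerm q q' G₁ G₁' κ b p.1 p.2)
      (period.prod period) := integrable_period_prod ((hG₂c.comp continuous_snd).mul ht₁)
  have i₂ : Integrable (fun p : ℝ × ℝ => G₁ p.1 * totalTerm q q' G₂ G₂' κ b p.2 p.1)
      (period.prod period) := integrable_period_prod ((hG₁c.comp continuous_fst).mul ht₂)
  have i₁₂ : Integrable (fun p : ℝ × ℝ => G₂ p.2 * totalTerm q q' G₁ G₁' κ b p.1 p.2 +
      G₁ p.1 * totalTerm q q' G₂ G₂' κ b p.2 p.1) (period.prod period) := i₁.add i₂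
  have i₃ : Integrable (fun p : ℝ × ℝ =>
      remTerm G₁ G₁' κ p.1 p.2 * (G₂ p.2 * (radialComp q b p.1 p.2 : ℂ)) +
        remTerm G₂ G₂' κ p.2 p.1 * (G₁ p.1 * (radialComp q b p.2 p.1 : ℂ)))
      (period.prod period) :=
    integrable_period_prod ((hm₁.mul ((hG₂c.comp continuous_snd).mul hr)).add
      (hm₂.mul ((hG₁c.comp continuous_fst).mul hrs)))
  have z₁ : ∫ p : ℝ × ℝ, G₂ p.2 * totalTerm q q' G₁ G₁' κ b p.1 p.2 ∂(period.prod period) = 0 := by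
    refine (integral_prod_symm _ i₁).trans ?_
    simp [integral_const_mul, integral_totalTerm hq hq' hG₁ hG₁' hper₁ hκ b]
  have z₂ : ∫ p : ℝ × ℝ, G₁ p.1 * totalTerm q q' G₂ G₂' κ b p.2 p.1 ∂(period.prod period) = 0 := by
    refine (integral_prod _ i₂).trans ?_
    simp [integral_const_mul, integral_totalTerm hq hq' hG₂ hG₂' hper₂ hκ b]
  simp_rw [div_eq_totalTerm (G₁' := G₁') (G₂' := G₂') (q' := q')]
  rw [integral_sub i₁₂ i₃]
  have z : ∫ p : ℝ × ℝ, (G₂ p.2 * totalTerm q q' G₁ G₁' κ b p.1 p.2 +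
      G₁ p.1 * totalTerm q q' G₂ G₂' κ b p.2 p.1) ∂(period.prod period) = 0 := by
    refine (integral_add i₁ i₂).trans ?_
    exact (congrArg₂ (· + ·) z₁ z₂).trans (add_zero 0)
  rw [z, zero_sub, norm_neg, ← integral_const_mul]
  have hsq : Continuous fun p : ℝ × ℝ => sumSq b p.1 p.2 := continuous_sumSq b
  refine norm_integral_le_of_norm_le ?_ (Eventually.of_forall fun p => ?_)
  · refine Integrable.const_mul ?_ _
    have := (integrable_period_prod (F := fun p : ℝ × ℝ =>
      ((|q (sumSq b p.1 p.2)| * √(sumSq b p.1 p.2) : ℝ) : ℂ)) (by fun_prop)).re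
    simpa using this
  · have a1 := abs_radialComp_le q b p.1 p.2
    have a2 := abs_radialComp_le q b p.2 p.1
    rw [sumSq_comm b p.2 p.1] at a2
    have hM₁0 : 0 ≤ M₁ := (norm_nonneg _).trans (hM₁ 0)
    have hM₂0 : 0 ≤ M₂ := (norm_nonneg _).trans (hM₂ 0)
    have hD₁0 : 0 ≤ D₁ := (norm_nonneg _).trans (hD₁ 0)
    have hD₂0 : 0 ≤ D₂ := (norm_nonneg _).trans (hD₂ 0)
    generalize |q (sumSq b p.1 p.2)| * √(sumSq b p.1 p.2) = X at a1 a2 ⊢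
    calc _ ≤ ((D₁ + M₁) * (1 / κ ^ 2)) * (M₂ * X) + ((D₂ + M₂) * (1 / κ ^ 2)) * (M₁ * X) := by
          refine (norm_add_le _ _).trans ?_
          rw [norm_mul, norm_mul, norm_mul, norm_mul, Complex.norm_real, Complex.norm_real,
            Real.norm_eq_abs, Real.norm_eq_abs]
          gcongr
          exacts [norm_remTerm_le hκ hM₁ hD₁ _ _, hM₂ _, norm_remTerm_le hκ hM₂ hD₂ _ _, hM₁ _]
      _ = _ := by ring

end

/-! ### Radial fields whose divergence approximates a disc average -/

/-- A smooth profile on the line interpolating between `1` near `0` and `1 / x` near infinity. -/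
def prof (N : ℕ) (x : ℝ) : ℝ := (1 + x ^ N) ^ (-(1 / N : ℝ))

/-- The derivative of `x * prof N x`. -/
def flux (N : ℕ) (x : ℝ) : ℝ := (1 + x ^ N) ^ (-(1 / N : ℝ) - 1)

section

variable {N : ℕ}

/-- Evenness of `N` keeps the base of the real powers positive on the whole line, so the profiles
are smooth without a sign condition. -/
theorem one_add_pow_pos (hN : Even N) (x : ℝ) : 0 < 1 + x ^ N := by
  have := hN.pow_nonneg x
  positivity

theorem continuous_flux (hN : Even N) : Continuous (flux N) := by
  unfold flux
  exact Continuous.rpow_const (by fun_prop) fun x => Or.inl (one_add_pow_pos hN x).ne'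

theorem flux_nonneg (hN : Even N) (x : ℝ) : 0 ≤ flux N x :=
  Real.rpow_nonneg (one_add_pow_pos hN x).le _

theorem neg_inv_sub_one_le (N : ℕ) : -(1 / N : ℝ) - 1 ≤ -1 := by
  have : (0 : ℝ) ≤ 1 / N := by positivity
  linarith

theorem flux_le_inv (hN : Even N) (x : ℝ) : flux N x ≤ (1 + x ^ N)⁻¹ := by
  rw [flux, ← Real.rpow_neg_one]
  exact Real.rpow_le_rpow_of_exponent_le (by linarith [hN.pow_nonneg x]) (neg_inv_sub_one_le N)

theorem flux_le_one (hN : Even N) (x : ℝ) : flux N x ≤ 1 :=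
  (flux_le_inv hN x).trans (inv_le_one_of_one_le₀ (by linarith [hN.pow_nonneg x]))

theorem hasDerivAt_prof (hN : Even N) (hN0 : N ≠ 0) (x : ℝ) :
    HasDerivAt (prof N) (-x ^ (N - 1) * flux N x) x := by
  have h := ((hasDerivAt_pow N x).const_add 1).rpow_const (p := -(1 / N : ℝ))
    (Or.inl (one_add_pow_pos hN x).ne')
  refine h.congr_deriv ?_
  have : (N : ℝ) ≠ 0 := by exact_mod_cast hN0
  rw [flux]
  field_simp

theorem prof_add (hN : Even N) (hN0 : N ≠ 0) (x : ℝ) :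
    prof N x + x * (-x ^ (N - 1) * flux N x) = flux N x := by
  have h : prof N x = (1 + x ^ N) * flux N x := by
    rw [prof, flux, Real.rpow_sub_one (one_add_pow_pos hN x).ne', mul_div_cancel₀ _
      (one_add_pow_pos hN x).ne']
  have h2 : x ^ N = x * x ^ (N - 1) := by
    rw [← pow_succ', Nat.sub_add_cancel (Nat.one_le_iff_ne_zero.2 hN0)]
  rw [h, h2]
  ring

theorem prof_le_inv (hN0 : N ≠ 0) {x : ℝ} (hx : 0 < x) : prof N x ≤ x⁻¹ := by
  calc prof N x ≤ (x ^ N) ^ (-(1 / N : ℝ)) :=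
        Real.rpow_le_rpow_of_nonpos (by positivity) (by linarith) (by
          rw [neg_nonpos]; positivity)
    _ = x⁻¹ := by
        rw [Real.rpow_neg (by positivity), one_div, Real.pow_rpow_inv_natCast hx.le hN0]

theorem inv_one_add_le_prof (hN0 : N ≠ 0) {x : ℝ} (hx : 0 < x) : (1 + x)⁻¹ ≤ prof N x := by
  have h1 : 1 + x ^ N ≤ (1 + x) ^ N := by
    have := pow_add_pow_le (zero_le_one (α := ℝ)) hx.le hN0
    simpa using this
  calc (1 + x)⁻¹ = ((1 + x) ^ N) ^ (-(1 / N : ℝ)) := by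
        rw [Real.rpow_neg (by positivity), one_div, Real.pow_rpow_inv_natCast (by positivity) hN0]
    _ ≤ prof N x := Real.rpow_le_rpow_of_nonpos (by positivity) h1 (by
          rw [neg_nonpos]; positivity)

/-- The rescaled profile. -/
def fieldProf (N : ℕ) (c s : ℝ) : ℝ := (2 * Real.pi * c)⁻¹ * prof N (s / c)

/-- The derivative of the rescaled profile. -/
def fieldProfDeriv (N : ℕ) (c s : ℝ) : ℝ :=
  (2 * Real.pi * c)⁻¹ * ((-(s / c) ^ (N - 1) * flux N (s / c)) * (1 / c))

theorem hasDerivAt_fieldProf (hN : Even N) (hN0 : N ≠ 0) (c s : ℝ) :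
    HasDerivAt (fieldProf N c) (fieldProfDeriv N c s) s :=
  ((hasDerivAt_prof hN hN0 (s / c)).comp s ((hasDerivAt_id s).div_const c)).const_mul _

theorem continuous_fieldProfDeriv (hN : Even N) (c : ℝ) : Continuous (fieldProfDeriv N c) := by
  have := continuous_flux hN
  unfold fieldProfDeriv
  fun_prop

/-- The left side is the divergence of `z ↦ fieldProf N c (|z|²) z` at `s = |z|²`; for `c = r²` the
right side tends to the normalised disc indicator as `N` grows. -/
theorem two_mul_fieldProf_add (hN : Even N) (hN0 : N ≠ 0) {c : ℝ} (hc : 0 < c) (s : ℝ) :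
    2 * fieldProf N c s + 2 * s * fieldProfDeriv N c s = (Real.pi * c)⁻¹ * flux N (s / c) := by
  rw [← prof_add hN hN0 (s / c), fieldProf, fieldProfDeriv]
  have := Real.pi_pos
  field_simp

/-- The profile lies between `1/(1 + x)` and `1/x` for every `N`. Hence the deviation from the
Newtonian profile is controlled uniformly in `N`. -/
theorem abs_fieldProf_sub_le (hN0 : N ≠ 0) {c s : ℝ} (hc : 0 < c) (hs : 0 < s) :
    |fieldProf N c s - (2 * Real.pi * s)⁻¹| ≤ s⁻¹ * (c / (c + s)) := by
  have hpi := Real.pi_gt_three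
  have hx : 0 < s / c := by positivity
  have h1 := prof_le_inv hN0 hx
  have h2 := inv_one_add_le_prof hN0 hx
  have e1 : (2 * Real.pi * s)⁻¹ = (2 * Real.pi * c)⁻¹ * (s / c)⁻¹ := by field_simp
  have e2 : (s / c)⁻¹ - (1 + s / c)⁻¹ = c * (s⁻¹ * (c / (c + s))) := by
    field_simp; ring
  have hp : 0 < (2 * Real.pi * c)⁻¹ := by positivity
  rw [fieldProf, e1, ← mul_sub, abs_mul, abs_of_pos hp, abs_sub_comm, abs_of_nonneg (by linarith)]
  calc _ ≤ (2 * Real.pi * c)⁻¹ * (c * (s⁻¹ * (c / (c + s)))) := by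
        gcongr; linarith
    _ = (2 * Real.pi)⁻¹ * (s⁻¹ * (c / (c + s))) := by field_simp
    _ ≤ 1 * (s⁻¹ * (c / (c + s))) := by
        gcongr
        exact inv_le_one_of_one_le₀ (by linarith)
    _ = _ := one_mul _

end

/-! ### Convergence of the regularised divergence to the disc indicator -/

theorem tendsto_flux_lt {x : ℝ} (h0 : 0 ≤ x) (h1 : x < 1) :
    Tendsto (fun k : ℕ => flux (2 * (k + 1)) x) atTop (𝓝 1) := by
  have hn : Tendsto (fun k : ℕ => 2 * (k + 1)) atTop atTop :=
    tendsto_atTop_mono (fun k => by simp only [id]; omega) tendsto_id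
  have hp : Tendsto (fun k : ℕ => 1 + x ^ (2 * (k + 1))) atTop (𝓝 (1 + 0)) :=
    ((tendsto_pow_atTop_nhds_zero_of_lt_one h0 h1).comp hn).const_add 1
  have he : Tendsto (fun k : ℕ => -(1 / ((2 * (k + 1) : ℕ) : ℝ)) - 1) atTop (𝓝 (-0 - 1)) :=
    ((tendsto_one_div_atTop_nhds_zero_nat (𝕜 := ℝ)).comp hn).neg.sub_const 1
  have := hp.rpow he (Or.inl (by norm_num))
  simpa [flux] using this

theorem tendsto_flux_gt {x : ℝ} (h1 : 1 < x) :
    Tendsto (fun k : ℕ => flux (2 * (k + 1)) x) atTop (𝓝 0) := by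
  have hn : Tendsto (fun k : ℕ => 2 * (k + 1)) atTop atTop :=
    tendsto_atTop_mono (fun k => by simp only [id]; omega) tendsto_id
  have hp : Tendsto (fun k : ℕ => (1 + x ^ (2 * (k + 1)))⁻¹) atTop (𝓝 0) :=
    tendsto_inv_atTop_zero.comp (tendsto_atTop_add_const_left _ _
      ((tendsto_pow_atTop_atTop_of_one_lt h1).comp hn))
  exact squeeze_zero (fun k => flux_nonneg (even_two_mul _) x)
    (fun k => flux_le_inv (even_two_mul _) x) hp

/-- The normalised indicator function of a disc. -/
def disc (r : ℝ) (z : ℂ) : ℝ := (Metric.ball (0 : ℂ) r).indicator (fun _ => (Real.pi * r ^ 2)⁻¹) z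

@[fun_prop]
theorem measurable_disc (r : ℝ) : Measurable (disc r) :=
  measurable_const.indicator Metric.isOpen_ball.measurableSet

theorem disc_nonneg (r : ℝ) (z : ℂ) : 0 ≤ disc r z :=
  indicator_nonneg (fun _ _ => by have := Real.pi_pos; positivity) z

/-- The circle `‖z‖ = r` is excluded because there the limit is half the value inside. -/
theorem tendsto_flux_disc {r : ℝ} (hr : 0 < r) {z : ℂ} (hz : ‖z‖ ≠ r) :
    Tendsto (fun k : ℕ => (Real.pi * r ^ 2)⁻¹ * flux (2 * (k + 1)) (‖z‖ ^ 2 / r ^ 2)) atTop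
      (𝓝 (disc r z)) := by
  rcases lt_or_gt_of_ne hz with h | h
  · have hx : ‖z‖ ^ 2 / r ^ 2 < 1 := by
      rw [div_lt_one (by positivity)]
      exact pow_lt_pow_left₀ h (norm_nonneg z) two_ne_zero
    have := (tendsto_flux_lt (by positivity) hx).const_mul (Real.pi * r ^ 2)⁻¹
    rw [mul_one] at this
    rwa [disc, indicator_of_mem (by simpa using h)]
  · have hx : 1 < ‖z‖ ^ 2 / r ^ 2 := by
      rw [one_lt_div (by positivity)]
      exact pow_lt_pow_left₀ h hr.le two_ne_zero
    have := (tendsto_flux_gt hx).const_mul (Real.pi * r ^ 2)⁻¹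
    rw [mul_zero] at this
    rwa [disc, indicator_of_notMem (by simpa using h.le)]

/-- The size of the radial field whose divergence is the normalised indicator of a disc, minus the
Newtonian field. -/
def bump (r : ℝ) (z : ℂ) : ℝ≥0∞ := ‖z‖ₑ⁻¹ * ENNReal.ofReal (1 + (r⁻¹ * ‖z‖) ^ 2)⁻¹

@[fun_prop]
theorem measurable_bump (r : ℝ) : Measurable (bump r) := by
  unfold bump; fun_prop

/-- The polar Jacobian cancels the singularity `1/‖z‖`; the radial arctangent integral then gives
exactly `π² r`. -/
theorem lintegral_bump {r : ℝ} (hr : 0 < r) : ∫⁻ z, bump r z ≤ ENNReal.ofReal (10 * r) := by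
  have hpi := Real.pi_pos
  have hpi4 := Real.pi_lt_d2
  rw [lintegral_eq_polar (measurable_bump r) 0]
  have h1 : ∀ ρ ∈ Ioi (0 : ℝ), ENNReal.ofReal ρ * ∫⁻ y : Circle, bump r (ρ * y + 0) ∂σ =
      ENNReal.ofReal (2 * Real.pi) * ENNReal.ofReal (1 + (r⁻¹ * ρ) ^ 2)⁻¹ := by
    intro ρ hρ
    rw [mem_Ioi] at hρ
    have hn : ∀ y : Circle, ‖(ρ : ℂ) * y + 0‖ = ρ := fun y => by
      rw [add_zero, norm_mul, Circle.norm_coe, mul_one, Complex.norm_real, Real.norm_of_nonneg hρ.le]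
    simp_rw [bump, ← ofReal_norm, hn, lintegral_const, measure_univ_eq]
    rw [← mul_assoc, ← mul_assoc, ENNReal.mul_inv_cancel (by simpa using hρ) ENNReal.ofReal_ne_top,
      one_mul, mul_comm]
  rw [setLIntegral_congr_fun measurableSet_Ioi h1, lintegral_const_mul _ (by fun_prop)]
  have h2 := lintegral_comp_mul_left_Ioi (fun ρ => ENNReal.ofReal (1 + ρ ^ 2)⁻¹) (inv_pos.2 hr)
  rw [← ofReal_integral_eq_lintegral_ofReal (integrable_inv_one_add_sq.integrableOn)
    (Eventually.of_forall fun x => by positivity), integral_Ioi_inv_one_add_sq] at h2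
  simp only [Real.arctan_zero, sub_zero] at h2
  have h3 : ∫⁻ ρ in Ioi (0 : ℝ), ENNReal.ofReal (1 + (r⁻¹ * ρ) ^ 2)⁻¹ =
      ENNReal.ofReal r * ENNReal.ofReal (Real.pi / 2) := by
    rw [← h2, ← mul_assoc, ← ENNReal.ofReal_mul hr.le, mul_inv_cancel₀ hr.ne', ENNReal.ofReal_one,
      one_mul]
  rw [h3, ← ENNReal.ofReal_mul hr.le, ← ENNReal.ofReal_mul (by positivity)]
  refine ENNReal.ofReal_le_ofReal ?_
  have hsq : Real.pi ^ 2 ≤ 10 := by nlinarith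
  nlinarith [mul_le_mul_of_nonneg_right hsq hr.le]

/-- Both fields are close to the same Newtonian field, which does not depend on the radius and
cancels in the difference. This is why differences of disc averages are estimated. -/
theorem ofReal_abs_fieldProf_le {N : ℕ} (hN0 : N ≠ 0) {r r' : ℝ} (hr : 0 < r) (hr' : 0 < r') {z : ℂ}
    {s : ℝ} (hs : s = ‖z‖ ^ 2) :
    ENNReal.ofReal (|fieldProf N (r ^ 2) s - fieldProf N (r' ^ 2) s| * √s) ≤
      bump r z + bump r' z := by
  subst hs
  rw [Real.sqrt_sq (norm_nonneg z)]
  rcases eq_or_ne z 0 with rfl | hz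
  · simp
  have hz0 : 0 < ‖z‖ := norm_pos_iff.2 hz
  have hb : ∀ ρ : ℝ, 0 < ρ →
      bump ρ z = ENNReal.ofReal ((‖z‖ ^ 2)⁻¹ * (ρ ^ 2 / (ρ ^ 2 + ‖z‖ ^ 2)) * ‖z‖) := by
    intro ρ hρ
    rw [bump, ← ofReal_norm, ← ENNReal.ofReal_inv_of_pos hz0, ← ENNReal.ofReal_mul (by positivity)]
    congr 1
    field_simp
  rw [hb r hr, hb r' hr', ← ENNReal.ofReal_add (by positivity) (by positivity), ← add_mul]
  refine ENNReal.ofReal_le_ofReal ?_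
  gcongr
  have h1 := abs_fieldProf_sub_le hN0 (c := r ^ 2) (s := ‖z‖ ^ 2) (by positivity) (by positivity)
  have h2 := abs_fieldProf_sub_le hN0 (c := r' ^ 2) (s := ‖z‖ ^ 2) (by positivity) (by positivity)
  rw [abs_sub_comm] at h2
  exact (abs_sub_le _ _ _).trans (add_le_add h1 h2)

/-- A circle is Lebesgue null, so transversality makes its preimage null for the weight `gap`, which
vanishes almost nowhere. -/
theorem norm_add_ne_ae (b : ℂ) (r : ℝ) : ∀ᵐ p ∂(σ.prod σ), ‖(p.1 : ℂ) + p.2 + b‖ ≠ r := by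
  have hm : MeasurableSet (Metric.sphere (0 : ℂ) r) := Metric.isClosed_sphere.measurableSet
  have h1 : Measurable ((Metric.sphere (0 : ℂ) r).indicator (1 : ℂ → ℝ≥0∞)) :=
    measurable_one.indicator hm
  have h := isTransversal_add.2 _ h1 b
  rw [lintegral_indicator_one hm, Measure.addHaar_sphere, mul_zero, nonpos_iff_eq_zero,
    lintegral_eq_zero_iff (by fun_prop)] at h
  filter_upwards [h, gap_ne_zero_ae] with p hp hg hpr
  simp only [Pi.zero_apply, mul_eq_zero, hg, false_or] at hp
  rw [indicator_of_mem (by simpa using hpr)] at hp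
  exact one_ne_zero hp

/-! ### Integration by parts transferred to the circle -/

/-- A regularised indicator function of transversal pairs. -/
def sep (κ : ℝ) (p : Circle × Circle) : ℝ :=
  ((p.1 / p.2 : Circle) : ℂ).im ^ 2 / (((p.1 / p.2 : Circle) : ℂ).im ^ 2 + κ ^ 2)

theorem sep_exp (κ α β : ℝ) :
    sep κ (Circle.exp α, Circle.exp β) = csc κ (β - α) * Real.sin (β - α) := by
  have : Real.sin (α - β) = - Real.sin (β - α) := by rw [← Real.sin_neg, neg_sub]
  rw [sep, ← Circle.exp_sub, im_exp, this, csc]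
  ring

theorem measurable_sep (κ : ℝ) : Measurable (sep κ) := by
  have h : Continuous fun p : Circle × Circle => ((p.1 : ℂ) * (starRingEnd ℂ) p.2).im := by fun_prop
  have e : ∀ p : Circle × Circle,
      ((p.1 / p.2 : Circle) : ℂ).im = ((p.1 : ℂ) * (starRingEnd ℂ) p.2).im := fun p => by
    rw [div_eq_mul_inv, Circle.coe_mul, Circle.coe_inv_eq_conj]
  have hm := h.measurable
  unfold sep
  simp_rw [e]
  fun_prop

theorem sep_nonneg (κ : ℝ) (p : Circle × Circle) : 0 ≤ sep κ p := by unfold sep; positivity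

theorem sep_le_one (κ : ℝ) (p : Circle × Circle) : sep κ p ≤ 1 :=
  div_le_one_of_le₀ (by nlinarith [sq_nonneg κ]) (by positivity)

theorem sumSq_eq (b : ℂ) (α β : ℝ) :
    sumSq b α β = ‖((Circle.exp α : Circle) : ℂ) + (Circle.exp β : Circle) + b‖ ^ 2 := by
  rw [Complex.sq_norm, Complex.normSq_apply, sumSq]
  simp only [Complex.add_re, Complex.add_im, Circle.coe_exp, Complex.exp_ofReal_mul_I_re,
    Complex.exp_ofReal_mul_I_im]
  ring

theorem measurePreserving_exp_prod :
    MeasurePreserving (Prod.map Circle.exp Circle.exp) (period.prod period) (σ.prod σ) :=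
  measurePreserving_exp_Ioc.prod measurePreserving_exp_Ioc

/-- For each `k` the smooth profiles with `N = 2(k + 1)` allow integration by parts. The resulting
bound by `bump` does not depend on `k`, and dominated convergence replaces the fluxes by disc
indicators. -/
theorem enorm_integral_sep_le {g₁ g₂ : Circle → ℂ} {G₁' G₂' : ℝ → ℂ}
    (hg₁ : ∀ θ, HasDerivAt (fun θ => g₁ (Circle.exp θ)) (G₁' θ) θ) (hG₁' : Continuous G₁')
    (hg₂ : ∀ θ, HasDerivAt (fun θ => g₂ (Circle.exp θ)) (G₂' θ) θ) (hG₂' : Continuous G₂')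
    (hm₁ : Measurable g₁) (hm₂ : Measurable g₂)
    {κ : ℝ} (hκ : 0 < κ) (b : ℂ) {M₁ M₂ D₁ D₂ : ℝ}
    (hM₁ : ∀ x, ‖g₁ x‖ ≤ M₁) (hM₂ : ∀ x, ‖g₂ x‖ ≤ M₂) (hD₁ : ∀ θ, ‖G₁' θ‖ ≤ D₁)
    (hD₂ : ∀ θ, ‖G₂' θ‖ ≤ D₂) {r r' : ℝ} (hr : 0 < r) (hr' : 0 < r') :
    ‖∫ p, g₁ p.1 * g₂ p.2 * (sep κ p : ℂ) *
      ((disc r (p.1 + p.2 + b) - disc r' (p.1 + p.2 + b) : ℝ) : ℂ) ∂(σ.prod σ)‖ₑ ≤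
      ENNReal.ofReal (((D₁ + M₁) * M₂ + (D₂ + M₂) * M₁) * (1 / κ ^ 2)) *
        ∫⁻ p, (bump r (p.1 + p.2 + b) + bump r' (p.1 + p.2 + b)) ∂(σ.prod σ) := by
  have hM₁0 : 0 ≤ M₁ := (norm_nonneg _).trans (hM₁ 1)
  have hM₂0 : 0 ≤ M₂ := (norm_nonneg _).trans (hM₂ 1)
  have hD₁0 : 0 ≤ D₁ := (norm_nonneg _).trans (hD₁ 0)
  have hD₂0 : 0 ≤ D₂ := (norm_nonneg _).trans (hD₂ 0)
  set K : ℝ := ((D₁ + M₁) * M₂ + (D₂ + M₂) * M₁) * (1 / κ ^ 2) with hK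
  have hK0 : 0 ≤ K := by positivity
  set R : ℝ≥0∞ := ∫⁻ p, (bump r (p.1 + p.2 + b) + bump r' (p.1 + p.2 + b)) ∂(σ.prod σ) with hR
  set fl : ℕ → Circle × Circle → ℝ := fun k p =>
    (Real.pi * r ^ 2)⁻¹ * flux (2 * (k + 1)) (‖(p.1 : ℂ) + p.2 + b‖ ^ 2 / r ^ 2) -
    (Real.pi * r' ^ 2)⁻¹ * flux (2 * (k + 1)) (‖(p.1 : ℂ) + p.2 + b‖ ^ 2 / r' ^ 2) with hfl
  have hflm : ∀ k, Measurable (fl k) := fun k => by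
    have := (continuous_flux (N := 2 * (k + 1)) (even_two_mul _)).measurable
    fun_prop
  have hsm := measurable_sep κ
  have hmk : ∀ k, Measurable fun p : Circle × Circle =>
      g₁ p.1 * g₂ p.2 * (sep κ p : ℂ) * ((fl k p : ℝ) : ℂ) := fun k => by
    have := hflm k
    fun_prop
  have hpi := Real.pi_pos
  have hlim : Tendsto (fun k => ∫ p, g₁ p.1 * g₂ p.2 * (sep κ p : ℂ) * ((fl k p : ℝ) : ℂ)
      ∂(σ.prod σ)) atTop (𝓝 (∫ p, g₁ p.1 * g₂ p.2 * (sep κ p : ℂ) *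
      ((disc r (p.1 + p.2 + b) - disc r' (p.1 + p.2 + b) : ℝ) : ℂ) ∂(σ.prod σ))) := by
    refine tendsto_integral_of_dominated_convergence
      (fun _ => M₁ * M₂ * 1 * ((Real.pi * r ^ 2)⁻¹ * 1 + (Real.pi * r' ^ 2)⁻¹ * 1))
      (fun k => (hmk k).aestronglyMeasurable) (integrable_const _)
      (fun k => Eventually.of_forall fun p => ?_) ?_
    · rw [norm_mul, norm_mul, norm_mul, Complex.norm_real, Complex.norm_real,
        Real.norm_of_nonneg (sep_nonneg κ p)]
      have hf : ∀ ρ : ℝ, ‖(Real.pi * ρ ^ 2)⁻¹ * flux (2 * (k + 1))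
          (‖(p.1 : ℂ) + p.2 + b‖ ^ 2 / ρ ^ 2)‖ ≤ (Real.pi * ρ ^ 2)⁻¹ * 1 := fun ρ => by
        rw [Real.norm_of_nonneg (mul_nonneg (by positivity) (flux_nonneg (even_two_mul _) _))]
        gcongr
        exact flux_le_one (even_two_mul _) _
      gcongr
      exacts [sep_nonneg κ p, hM₁ _, hM₂ _, sep_le_one κ p, (norm_sub_le _ _).trans (add_le_add (hf r) (hf r'))]
    · filter_upwards [norm_add_ne_ae b r, norm_add_ne_ae b r'] with p h1 h2
      exact ((Complex.continuous_ofReal.tendsto _).comp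
        ((tendsto_flux_disc hr h1).sub (tendsto_flux_disc hr' h2))).const_mul _
  refine le_of_tendsto (hlim.enorm) (Eventually.of_forall fun k => ?_)
  have hN : Even (2 * (k + 1)) := even_two_mul _
  have hN0 : 2 * (k + 1) ≠ 0 := by omega
  set q : ℝ → ℝ := fun s => fieldProf (2 * (k + 1)) (r ^ 2) s - fieldProf (2 * (k + 1)) (r' ^ 2) s
    with hq
  set q' : ℝ → ℝ := fun s =>
    fieldProfDeriv (2 * (k + 1)) (r ^ 2) s - fieldProfDeriv (2 * (k + 1)) (r' ^ 2) s with hq'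
  have hqd : ∀ s, HasDerivAt q (q' s) s := fun s =>
    (hasDerivAt_fieldProf hN hN0 _ s).sub (hasDerivAt_fieldProf hN hN0 _ s)
  have hqc' : Continuous q' :=
    (continuous_fieldProfDeriv hN _).sub (continuous_fieldProfDeriv hN _)
  have hper : ∀ g : Circle → ℂ, g (Circle.exp Real.pi) = g (Circle.exp (-Real.pi)) := fun g => by
    congr 1
    ext
    simp [Circle.coe_exp]
  have main := norm_integral_div_le hqd hqc' hg₁ hG₁' (hper g₁) hg₂ hG₂' (hper g₂) hκ b
    (fun θ => hM₁ _) (fun θ => hM₂ _) hD₁ hD₂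
  have e : ∫ p, g₁ p.1 * g₂ p.2 * (sep κ p : ℂ) * ((fl k p : ℝ) : ℂ) ∂(σ.prod σ) =
      ∫ p, g₁ (Circle.exp p.1) * g₂ (Circle.exp p.2) *
        ((csc κ (p.2 - p.1) * Real.sin (p.2 - p.1) *
        (2 * q (sumSq b p.1 p.2) + 2 * sumSq b p.1 p.2 * q' (sumSq b p.1 p.2)) : ℝ) : ℂ)
        ∂(period.prod period) := by
    rw [← measurePreserving_exp_prod.map_eq, integral_map
      measurePreserving_exp_prod.measurable.aemeasurable (hmk k).aestronglyMeasurable]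
    congr 1
    ext p
    have h1 := two_mul_fieldProf_add hN hN0 (c := r ^ 2) (by positivity) (sumSq b p.1 p.2)
    have h2 := two_mul_fieldProf_add hN hN0 (c := r' ^ 2) (by positivity) (sumSq b p.1 p.2)
    have h3 : 2 * q (sumSq b p.1 p.2) + 2 * sumSq b p.1 p.2 * q' (sumSq b p.1 p.2) =
        fl k (Circle.exp p.1, Circle.exp p.2) := by
      simp only [hfl, hq, hq', ← sumSq_eq]
      rw [← h1, ← h2]
      ring
    rw [h3, ← sep_exp]
    push_cast [Prod.map]
    ring
  rw [e]
  have hX : ∫⁻ p, ENNReal.ofReal (|q (sumSq b p.1 p.2)| * √(sumSq b p.1 p.2))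
      ∂(period.prod period) ≤ R := by
    rw [hR, ← measurePreserving_exp_prod.lintegral_comp (by fun_prop)]
    exact lintegral_mono fun p => ofReal_abs_fieldProf_le hN0 hr hr' (sumSq_eq b p.1 p.2)
  calc _ ≤ ENNReal.ofReal (K * ∫ p, |q (sumSq b p.1 p.2)| * √(sumSq b p.1 p.2)
        ∂(period.prod period)) := by
        rw [← ofReal_norm]
        exact ENNReal.ofReal_le_ofReal main
    _ ≤ ENNReal.ofReal K * R := by
        rw [ENNReal.ofReal_mul hK0]
        gcongr
        refine le_trans ?_ hX
        have hqc : Continuous q := continuous_iff_continuousAt.2 fun s => (hqd s).continuousAt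
        have hsq := continuous_sumSq b
        rw [integral_eq_lintegral_of_nonneg_ae (Eventually.of_forall fun p => by positivity)
          (by fun_prop)]
        exact ENNReal.ofReal_toReal_le

/-! ### Differences of disc averages -/

theorem measure_univ_le_seven : σ univ ≤ 7 := by
  rw [measure_univ_eq]
  have h := Real.pi_lt_d2
  calc ENNReal.ofReal (2 * Real.pi) ≤ ENNReal.ofReal 7 := ENNReal.ofReal_le_ofReal (by linarith)
    _ = 7 := by norm_num

theorem lintegral_prod_gap_rpow_le {a : ℝ} (h0 : 0 ≤ a) (h1 : a < 1) :
    ∫⁻ p, gap p.1 p.2 ^ (-a) ∂(σ.prod σ) ≤ 10 * ENNReal.ofReal (1 / (1 - a)) * 7 := by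
  rw [lintegral_prod _ (by fun_prop)]
  refine (lintegral_mono fun x => lintegral_gap_rpow_lt h0 h1 x).trans ?_
  rw [lintegral_const]
  gcongr
  exact measure_univ_le_seven

theorem enorm_one_sub_sep_le_one (κ : ℝ) (p : Circle × Circle) : ‖1 - sep κ p‖ₑ ≤ 1 := by
  have h0 := sep_nonneg κ p
  have h1 := sep_le_one κ p
  rw [← ofReal_norm, Real.norm_of_nonneg (by linarith)]
  exact ENNReal.ofReal_le_one.2 (by linarith)

theorem enorm_one_sub_sep_le {κ : ℝ} (hκ : 0 < κ) {p : Circle × Circle} (hp : gap p.1 p.2 ≠ 0) :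
    ‖1 - sep κ p‖ₑ ≤ ENNReal.ofReal κ ^ (2 : ℝ) * gap p.1 p.2 ^ (-2 : ℝ) := by
  rw [gap] at hp ⊢
  rw [sep]
  set s := ((p.1 / p.2 : Circle) : ℂ).im
  have hs : s ≠ 0 := by simpa using hp
  have hs' : 0 < |s| := abs_pos.2 hs
  have e : 1 - s ^ 2 / (s ^ 2 + κ ^ 2) = κ ^ 2 / (s ^ 2 + κ ^ 2) := by
    field_simp; ring
  rw [e, ← ofReal_norm, ← ofReal_norm, Real.norm_of_nonneg (by positivity), Real.norm_eq_abs,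
    ENNReal.ofReal_rpow_of_pos hκ, ENNReal.ofReal_rpow_of_pos hs',
    ← ENNReal.ofReal_mul (by positivity)]
  refine ENNReal.ofReal_le_ofReal ?_
  rw [Real.rpow_neg hs'.le, Real.rpow_two, Real.rpow_two, sq_abs, ← div_eq_mul_inv]
  gcongr
  nlinarith

/-- The factor `1 - sep κ` is at most both `1` and `κ² gap^(-2)`. Interpolating gains a power of `κ`
at the price of a power of `gap` that stays integrable; `280` is `10 * 4 * 7`. -/
theorem energy_one_sub_sep_le {κ : ℝ} (hκ : 0 < κ) {P : Circle × Circle → ℝ≥0∞} {M : ℝ≥0∞}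
    (hP : ∀ p, P p ≤ M * ‖1 - sep κ p‖ₑ) :
    energy P ^ (2 / 3 : ℝ) ≤ 280 * M * ENNReal.ofReal κ ^ (1 / 6 : ℝ) := by
  have hpt : ∀ᵐ p ∂(σ.prod σ), P p ^ (3 / 2 : ℝ) * gap p.1 p.2 ^ (-(1 / 2) : ℝ) ≤
      M ^ (3 / 2 : ℝ) * ENNReal.ofReal κ ^ (1 / 4 : ℝ) * gap p.1 p.2 ^ (-(3 / 4) : ℝ) := by
    filter_upwards [gap_ne_zero_ae] with p hp
    have hg : gap p.1 p.2 ≠ ∞ := ((gap_le_one _ _).trans_lt ENNReal.one_lt_top).ne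
    calc _ ≤ (M * ‖1 - sep κ p‖ₑ) ^ (3 / 2 : ℝ) * gap p.1 p.2 ^ (-(1 / 2) : ℝ) := by
          gcongr; exact hP p
      _ = M ^ (3 / 2 : ℝ) * ‖1 - sep κ p‖ₑ ^ (3 / 2 : ℝ) * gap p.1 p.2 ^ (-(1 / 2) : ℝ) := by
          rw [ENNReal.mul_rpow_of_nonneg _ _ (by norm_num)]
      _ ≤ M ^ (3 / 2 : ℝ) * ‖1 - sep κ p‖ₑ ^ (1 / 8 : ℝ) * gap p.1 p.2 ^ (-(1 / 2) : ℝ) := by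
          -- Lowering the exponent from `3/2` to `1/8` leaves `gap^(-1/4 - 1/2)`, with exponent
          -- above `-1`.
          gcongr M ^ (3 / 2 : ℝ) * ?_ * gap p.1 p.2 ^ (-(1 / 2) : ℝ)
          exact ENNReal.rpow_le_rpow_of_exponent_ge (enorm_one_sub_sep_le_one κ p) (by norm_num)
      _ ≤ M ^ (3 / 2 : ℝ) * (ENNReal.ofReal κ ^ (2 : ℝ) * gap p.1 p.2 ^ (-2 : ℝ)) ^ (1 / 8 : ℝ) *
          gap p.1 p.2 ^ (-(1 / 2) : ℝ) := by
          gcongr; exact enorm_one_sub_sep_le hκ hp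
      _ = M ^ (3 / 2 : ℝ) * ENNReal.ofReal κ ^ (1 / 4 : ℝ) *
          (gap p.1 p.2 ^ (-(1 / 4) : ℝ) * gap p.1 p.2 ^ (-(1 / 2) : ℝ)) := by
          rw [ENNReal.mul_rpow_of_nonneg _ _ (by norm_num), ← ENNReal.rpow_mul, ← ENNReal.rpow_mul]
          norm_num
          ring
      _ = _ := by
          rw [← ENNReal.rpow_add _ _ hp hg]
          norm_num
  have hE : energy P ≤ M ^ (3 / 2 : ℝ) * ENNReal.ofReal κ ^ (1 / 4 : ℝ) * 280 := by
    refine (lintegral_mono_ae hpt).trans ?_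
    rw [lintegral_const_mul _ (by fun_prop)]
    gcongr
    refine (lintegral_prod_gap_rpow_le (by norm_num) (by norm_num)).trans ?_
    norm_num
  calc _ ≤ (M ^ (3 / 2 : ℝ) * ENNReal.ofReal κ ^ (1 / 4 : ℝ) * 280) ^ (2 / 3 : ℝ) := by gcongr
    _ = M * ENNReal.ofReal κ ^ (1 / 6 : ℝ) * 280 ^ (2 / 3 : ℝ) := by
        rw [ENNReal.mul_rpow_of_nonneg _ _ (by norm_num),
          ENNReal.mul_rpow_of_nonneg _ _ (by norm_num), ← ENNReal.rpow_mul, ← ENNReal.rpow_mul]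
        norm_num
    _ ≤ M * ENNReal.ofReal κ ^ (1 / 6 : ℝ) * 280 ^ (1 : ℝ) := by
        gcongr
        · norm_num
        · norm_num
    _ = _ := by rw [ENNReal.rpow_one]; ring

theorem energy_one_rpow_le : energy (fun _ => 1) ^ (2 / 3 : ℝ) ≤ 140 := by
  have hE : energy (fun _ => 1) ≤ 140 := by
    simp only [energy, ENNReal.one_rpow, one_mul]
    refine (lintegral_prod_gap_rpow_le (by norm_num) (by norm_num)).trans ?_
    norm_num
  calc _ ≤ (140 : ℝ≥0∞) ^ (2 / 3 : ℝ) := by gcongr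
    _ ≤ 140 ^ (1 : ℝ) := by
        gcongr
        · norm_num
        · norm_num
    _ = 140 := ENNReal.rpow_one _

theorem lintegral_enorm_disc {r : ℝ} (hr : 0 < r) : ∫⁻ z, ‖disc r z‖ₑ = 1 := by
  have hpi := Real.pi_pos
  have h : ∀ z, ‖disc r z‖ₑ =
      (Metric.ball (0 : ℂ) r).indicator (fun _ => ENNReal.ofReal (Real.pi * r ^ 2)⁻¹) z := by
    intro z
    rw [← ofReal_norm, Real.norm_of_nonneg (disc_nonneg r z), disc]
    by_cases hz : z ∈ Metric.ball (0 : ℂ) r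
    · simp only [indicator_of_mem hz]
    · simp only [indicator_of_notMem hz, ENNReal.ofReal_zero]
  simp_rw [h]
  rw [lintegral_indicator_const Metric.isOpen_ball.measurableSet, Complex.volume_ball,
    ← ENNReal.ofReal_pow hr.le]
  have hpi' : (NNReal.pi : ℝ≥0∞) = ENNReal.ofReal Real.pi := by
    rw [← NNReal.coe_real_pi, ENNReal.ofReal_coe_nnreal]
  rw [hpi', ← ENNReal.ofReal_mul (by positivity), ← ENNReal.ofReal_mul (by positivity),
    mul_comm (r ^ 2), inv_mul_cancel₀ (by positivity), ENNReal.ofReal_one]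

/-- The difference of two normalised indicator functions of discs. -/
def discSub (r r' : ℝ) (z : ℂ) : ℂ := ((disc r z - disc r' z : ℝ) : ℂ)

@[fun_prop]
theorem measurable_discSub (r r' : ℝ) : Measurable (discSub r r') := by
  unfold discSub; fun_prop

theorem norm_disc_le (r : ℝ) (z : ℂ) : ‖disc r z‖ ≤ (Real.pi * r ^ 2)⁻¹ := by
  have hpi := Real.pi_pos
  rw [Real.norm_of_nonneg (disc_nonneg r z)]
  exact indicator_le_self' (fun _ _ => by positivity) z

theorem norm_discSub_le (r r' : ℝ) (z : ℂ) :
    ‖discSub r r' z‖ ≤ (Real.pi * r ^ 2)⁻¹ + (Real.pi * r' ^ 2)⁻¹ := by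
  rw [discSub, Complex.norm_real]
  exact (norm_sub_le _ _).trans (add_le_add (norm_disc_le r z) (norm_disc_le r' z))

theorem lintegral_enorm_discSub_le {r r' : ℝ} (hr : 0 < r) (hr' : 0 < r') :
    ∫⁻ z, ‖discSub r r' z‖ₑ ≤ 2 := by
  calc _ ≤ ∫⁻ z, (‖disc r z‖ₑ + ‖disc r' z‖ₑ) := by
        refine lintegral_mono fun z => ?_
        rw [discSub, ← ofReal_norm, Complex.norm_real, ofReal_norm]
        exact enorm_sub_le
    _ = 1 + 1 := by
        rw [lintegral_add_left (by fun_prop), lintegral_enorm_disc hr, lintegral_enorm_disc hr']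
    _ = 2 := one_add_one_eq_two

theorem integrable_of_l2_ne_top {f : Circle → ℂ} (hf : Measurable f) (h : l2 (fun x => ‖f x‖ₑ) ≠ ∞) :
    Integrable f σ :=
  ⟨hf.aestronglyMeasurable, ((lintegral_le_l2 (f := fun x => ‖f x‖ₑ) (by fun_prop)).trans_lt
    (ENNReal.mul_lt_top (by norm_num) h.lt_top))⟩

theorem integrable_convOp {P Q : Circle × Circle → ℂ} {u : Circle → ℂ} {φ : ℂ → ℂ}
    (hP : Integrable P (σ.prod σ)) (hQ : Integrable Q (σ.prod σ)) (hu : Integrable u σ)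
    (hφ : Measurable φ) {B : ℝ} (hB : ∀ z, ‖φ z‖ ≤ B) (x : Circle) :
    Integrable (fun t => P t.1 * Q t.2.1 * u t.2.2 * φ (phase t x)) quintMeasure := by
  have h1 : Integrable (fun t : Quint => P t.1 * (Q t.2.1 * u t.2.2)) quintMeasure :=
    hP.mul_prod (hQ.mul_prod hu)
  have hm : Measurable fun t : Quint => φ (phase t x) := by
    have : Measurable fun t : Quint => phase t x := by unfold phase; fun_prop
    exact hφ.comp this
  have h2 := h1.mul_bdd (c := B) hm.aestronglyMeasurable (Eventually.of_forall fun t => hB _)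
  simpa only [mul_assoc] using h2

theorem convOp_add {P P' Q : Circle × Circle → ℂ} {u : Circle → ℂ} {φ : ℂ → ℂ}
    (hP : Integrable P (σ.prod σ)) (hP' : Integrable P' (σ.prod σ)) (hQ : Integrable Q (σ.prod σ))
    (hu : Integrable u σ) (hφ : Measurable φ) {B : ℝ} (hB : ∀ z, ‖φ z‖ ≤ B) (x : Circle) :
    convOp (P + P') Q u φ x = convOp P Q u φ x + convOp P' Q u φ x := by
  rw [convOp, convOp, convOp, ← integral_add (integrable_convOp hP hQ hu hφ hB x)
    (integrable_convOp hP' hQ hu hφ hB x)]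
  simp only [Pi.add_apply, add_mul]

/-- By Fubini the first pair is integrated innermost, with the other points frozen into the
translation `b`. After integration by parts its density has become the constant `1`, and the kernel
has become `bump`. -/
theorem enorm_convOp_sep_le {g₁ g₂ : Circle → ℂ} {G₁' G₂' : ℝ → ℂ}
    (hg₁ : ∀ θ, HasDerivAt (fun θ => g₁ (Circle.exp θ)) (G₁' θ) θ) (hG₁' : Continuous G₁')
    (hg₂ : ∀ θ, HasDerivAt (fun θ => g₂ (Circle.exp θ)) (G₂' θ) θ) (hG₂' : Continuous G₂')
    (hm₁ : Measurable g₁) (hm₂ : Measurable g₂)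
    {κ : ℝ} (hκ : 0 < κ) {M₁ M₂ D₁ D₂ : ℝ}
    (hM₁ : ∀ x, ‖g₁ x‖ ≤ M₁) (hM₂ : ∀ x, ‖g₂ x‖ ≤ M₂) (hD₁ : ∀ θ, ‖G₁' θ‖ ≤ D₁)
    (hD₂ : ∀ θ, ‖G₂' θ‖ ≤ D₂) {r r' : ℝ} (hr : 0 < r) (hr' : 0 < r')
    {Q : Circle × Circle → ℂ} {u : Circle → ℂ} (hQ : Measurable Q) (hu : Measurable u)
    (hQi : Integrable Q (σ.prod σ)) (hui : Integrable u σ)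
    (hPi : Integrable (fun p : Circle × Circle => g₁ p.1 * g₂ p.2 * (sep κ p : ℂ)) (σ.prod σ))
    (x : Circle) :
    ‖convOp (fun p => g₁ p.1 * g₂ p.2 * (sep κ p : ℂ)) Q u (discSub r r') x‖ₑ ≤
      ENNReal.ofReal (((D₁ + M₁) * M₂ + (D₂ + M₂) * M₁) * (1 / κ ^ 2)) *
        posOp (fun _ => 1) (fun q => ‖Q q‖ₑ) (fun d => ‖u d‖ₑ) (fun z => bump r z + bump r' z) x := by
  have hint := integrable_convOp hPi hQi hui (measurable_discSub r r') (norm_discSub_le r r') x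
  have hph : ∀ (p q : Circle × Circle) (d : Circle), phase (p, q, d) x =
      (p.1 : ℂ) + p.2 + ((q.1 : ℂ) + q.2 + ((d : ℂ) - x)) := fun p q d => by
    simp only [phase]; ring
  have hphm : Measurable fun t : Quint => phase t x := by unfold phase; fun_prop
  set K := ENNReal.ofReal (((D₁ + M₁) * M₂ + (D₂ + M₂) * M₁) * (1 / κ ^ 2)) with hK
  have e1 : convOp (fun p => g₁ p.1 * g₂ p.2 * (sep κ p : ℂ)) Q u (discSub r r') x =
      ∫ s : (Circle × Circle) × Circle, ∫ p : Circle × Circle,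
        g₁ p.1 * g₂ p.2 * (sep κ p : ℂ) * Q s.1 * u s.2 * discSub r r' (phase (p, s) x)
        ∂(σ.prod σ) ∂((σ.prod σ).prod σ) := integral_prod_symm _ hint
  have e2 : posOp (fun _ => 1) (fun q => ‖Q q‖ₑ) (fun d => ‖u d‖ₑ)
      (fun z => bump r z + bump r' z) x = ∫⁻ s : (Circle × Circle) × Circle, ∫⁻ p : Circle × Circle,
        1 * ‖Q s.1‖ₑ * ‖u s.2‖ₑ * (bump r (phase (p, s) x) + bump r' (phase (p, s) x))
        ∂(σ.prod σ) ∂((σ.prod σ).prod σ) := by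
    refine (lintegral_prod_symm _ ?_).trans rfl
    fun_prop
  rw [e1, e2]
  refine (enorm_integral_le_lintegral_enorm _).trans ?_
  rw [← lintegral_const_mul' _ _ ENNReal.ofReal_ne_top]
  refine lintegral_mono fun s => ?_
  have h := enorm_integral_sep_le hg₁ hG₁' hg₂ hG₂' hm₁ hm₂ hκ
    ((s.1.1 : ℂ) + s.1.2 + ((s.2 : ℂ) - x)) hM₁ hM₂ hD₁ hD₂ hr hr'
  have e3 : ∫ p : Circle × Circle,
      g₁ p.1 * g₂ p.2 * (sep κ p : ℂ) * Q s.1 * u s.2 * discSub r r' (phase (p, s) x) ∂(σ.prod σ) =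
      (Q s.1 * u s.2) * ∫ p, g₁ p.1 * g₂ p.2 * (sep κ p : ℂ) *
      ((disc r (p.1 + p.2 + ((s.1.1 : ℂ) + s.1.2 + ((s.2 : ℂ) - x))) -
        disc r' (p.1 + p.2 + ((s.1.1 : ℂ) + s.1.2 + ((s.2 : ℂ) - x))) : ℝ) : ℂ) ∂(σ.prod σ) := by
    rw [← integral_const_mul]
    congr 1
    ext p
    rw [discSub, hph]
    ring
  rw [e3, enorm_mul, enorm_mul]
  simp_rw [one_mul, hph]
  rw [lintegral_const_mul _ (by fun_prop)]
  calc _ ≤ ‖Q s.1‖ₑ * ‖u s.2‖ₑ * (K * _) := by gcongr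
    _ = _ := by ring

theorem integrable_tensor {f g : Circle → ℂ} (hf : Integrable f σ) (hg : Integrable g σ) :
    Integrable (tensor f g) (σ.prod σ) := hf.mul_prod hg

theorem enorm_tensor (f g : Circle → ℂ) :
    (fun p => ‖tensor f g p‖ₑ) = tensor (fun x => ‖f x‖ₑ) (fun x => ‖g x‖ₑ) := by
  ext p; simp [tensor, enorm_mul]

/-- Four pieces are estimated separately: two approximation errors by the `L²` multilinear bound,
the part near parallel pairs by its small energy, and the transversal smooth part by integration by
parts. -/
theorem l2_convOp_discSub_le {f₁ f₂ v w u : Circle → ℂ} (hf₁ : Measurable f₁) (hf₂ : Measurable f₂)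
    (hv : Measurable v) (hw : Measurable w) (hu : Measurable u) {η : ℝ} (hη : 0 < η) (hη1 : η ≤ 1)
    {a₁ a₂ : ℝ≥0} (ha₁ : l2 (fun x => ‖f₁ x‖ₑ) ≤ a₁) (ha₂ : l2 (fun x => ‖f₂ x‖ₑ) ≤ a₂)
    {b₁ b₂ : ℝ≥0∞} (hb₁ : ∀ t ∈ Ioc 0 η, l2 (fun x => ‖f₁ (rot t x) - f₁ x‖ₑ) ≤ b₁)
    (hb₂ : ∀ t ∈ Ioc 0 η, l2 (fun x => ‖f₂ (rot t x) - f₂ x‖ₑ) ≤ b₂)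
    (hv2 : l2 (fun x => ‖v x‖ₑ) ≠ ∞) (hw2 : l2 (fun x => ‖w x‖ₑ) ≠ ∞)
    (hu2 : l2 (fun x => ‖u x‖ₑ) ≠ ∞) {r' : ℝ} (hr' : 0 < r') (hr'r : r' ≤ η ^ 40) :
    l2 (fun x => ‖convOp (tensor f₁ f₂) (tensor v w) u (discSub (η ^ 40) r') x‖ₑ) ≤
      10 ^ 10 * (ENNReal.ofReal η * (a₁ * a₂) + (b₁ * a₂ + a₁ * b₂)) *
        (l2 (fun x => ‖v x‖ₑ) * l2 (fun x => ‖w x‖ₑ) * l2 (fun x => ‖u x‖ₑ)) := by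
  obtain ⟨g₁, G₁', hg₁, hG₁', hgd₁, hgM₁, hgD₁, hga₁, hgb₁⟩ := exists_smooth_approx hη hη1 hf₁ ha₁ hb₁
  obtain ⟨g₂, G₂', hg₂, hG₂', hgd₂, hgM₂, hgD₂, hga₂, hgb₂⟩ := exists_smooth_approx hη hη1 hf₂ ha₂ hb₂
  set L := l2 (fun x => ‖v x‖ₑ) * l2 (fun x => ‖w x‖ₑ) * l2 (fun x => ‖u x‖ₑ) with hL
  -- The part near parallel pairs has size `η^(-2) κ^(1/6)`, and the smooth part `η^(-3) κ^(-2) r`.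
  -- The exponents `18` and `40` make both of order `η`.
  set κ : ℝ := η ^ 18 with hκ
  set r : ℝ := η ^ 40 with hr
  have hκ0 : 0 < κ := by positivity
  have hr0 : 0 < r := by positivity
  have ne_top : ∀ {f : Circle → ℂ} {a : ℝ≥0}, l2 (fun x => ‖f x‖ₑ) ≤ a → l2 (fun x => ‖f x‖ₑ) ≠ ∞ :=
    fun h => (h.trans_lt ENNReal.coe_lt_top).ne
  have if₁ := integrable_of_l2_ne_top hf₁ (ne_top ha₁)
  have if₂ := integrable_of_l2_ne_top hf₂ (ne_top ha₂)
  have ig₁ := integrable_of_l2_ne_top hg₁ (ne_top hga₁)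
  have ig₂ := integrable_of_l2_ne_top hg₂ (ne_top hga₂)
  have iQ := integrable_tensor (integrable_of_l2_ne_top hv hv2) (integrable_of_l2_ne_top hw hw2)
  have iu := integrable_of_l2_ne_top hu hu2
  have hsm := measurable_sep κ
  set P₃ : Circle × Circle → ℂ := fun p => g₁ p.1 * g₂ p.2 * ((1 - sep κ p : ℝ) : ℂ) with hP₃
  set P₄ : Circle × Circle → ℂ := fun p => g₁ p.1 * g₂ p.2 * (sep κ p : ℂ) with hP₄
  have hP₃m : Measurable P₃ := by fun_prop
  have i₁ : Integrable (tensor (f₁ - g₁) f₂) (σ.prod σ) := integrable_tensor (if₁.sub ig₁) if₂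
  have i₂ : Integrable (tensor g₁ (f₂ - g₂)) (σ.prod σ) := integrable_tensor ig₁ (if₂.sub ig₂)
  have i₄ : Integrable P₄ (σ.prod σ) := by
    refine (integrable_tensor ig₁ ig₂).mul_bdd (c := 1) (by fun_prop)
      (Eventually.of_forall fun p => ?_)
    rw [Complex.norm_real, Real.norm_of_nonneg (sep_nonneg κ p)]
    exact sep_le_one κ p
  have i₃ : Integrable P₃ (σ.prod σ) := by
    refine ((integrable_tensor ig₁ ig₂).sub i₄).congr (Eventually.of_forall fun p => ?_)
    simp only [hP₃, hP₄, tensor, Pi.sub_apply]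
    push_cast
    ring
  -- One factor is smoothed at a time, and the smooth product is then split by `sep κ`.
  have hsplit : tensor f₁ f₂ =
      tensor (f₁ - g₁) f₂ + (tensor g₁ (f₂ - g₂) + (P₃ + P₄)) := by
    ext p
    simp only [tensor, Pi.add_apply, Pi.sub_apply, hP₃, hP₄]
    push_cast
    ring
  have hφm := measurable_discSub r r'
  have hφB := norm_discSub_le r r'
  have hφ1 : ∫⁻ z, ‖discSub r r' z‖ₑ ≤ 2 := lintegral_enorm_discSub_le hr0 hr'
  set M₁ : ℝ := 3 * a₁ / η with hM₁
  set M₂ : ℝ := 3 * a₂ / η with hM₂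
  set K : ℝ≥0∞ := ENNReal.ofReal (((6 * a₁ / η ^ 2 + M₁) * M₂ + (6 * a₂ / η ^ 2 + M₂) * M₁) *
    (1 / κ ^ 2)) with hK
  set V : Circle × Circle → ℝ≥0∞ := tensor (fun x => ‖v x‖ₑ) (fun x => ‖w x‖ₑ) with hV
  set U : Circle → ℝ≥0∞ := fun x => ‖u x‖ₑ with hU
  set χ : ℂ → ℝ≥0∞ := fun z => ‖discSub r r' z‖ₑ with hχ
  set O₁ := posOp (tensor (fun x => ‖f₁ x - g₁ x‖ₑ) fun x => ‖f₂ x‖ₑ) V U χ with hO₁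
  set O₂ := posOp (tensor (fun x => ‖g₁ x‖ₑ) fun x => ‖f₂ x - g₂ x‖ₑ) V U χ with hO₂
  set O₃ := posOp (fun p => ‖P₃ p‖ₑ) V U χ with hO₃
  set O₄ := posOp (fun _ => 1) V U (fun z => bump r z + bump r' z) with hO₄
  have hpt : ∀ x, ‖convOp (tensor f₁ f₂) (tensor v w) u (discSub r r') x‖ₑ ≤
      O₁ x + (O₂ x + (O₃ x + K * O₄ x)) := by
    intro x
    rw [hsplit, convOp_add i₁ (i₂.add (i₃.add i₄)) iQ iu hφm hφB,
      convOp_add i₂ (i₃.add i₄) iQ iu hφm hφB, convOp_add i₃ i₄ iQ iu hφm hφB]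
    refine (enorm_add_le _ _).trans (add_le_add ?_ ((enorm_add_le _ _).trans (add_le_add ?_
      ((enorm_add_le _ _).trans (add_le_add ?_ ?_)))))
    · refine (enorm_convOp_le _ _ _ _ x).trans (le_of_eq ?_)
      rw [enorm_tensor, enorm_tensor]; rfl
    · refine (enorm_convOp_le _ _ _ _ x).trans (le_of_eq ?_)
      rw [enorm_tensor, enorm_tensor]; rfl
    · refine (enorm_convOp_le _ _ _ _ x).trans (le_of_eq ?_)
      rw [enorm_tensor]
    · refine (enorm_convOp_sep_le hgd₁ hG₁' hgd₂ hG₂' hg₁ hg₂ hκ0 hgM₁ hgM₂ hgD₁ hgD₂ hr0 hr'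
        (by fun_prop) hu iQ iu i₄ x).trans (le_of_eq ?_)
      rw [enorm_tensor]
  have hVm : Measurable V := by fun_prop
  have hUm : Measurable U := by fun_prop
  have hχm : Measurable χ := by fun_prop
  have hO₁m : Measurable O₁ := measurable_posOp (by fun_prop) hVm hUm hχm
  have hO₂m : Measurable O₂ := measurable_posOp (by fun_prop) hVm hUm hχm
  have hO₃m : Measurable O₃ := measurable_posOp (by fun_prop) hVm hUm hχm
  have hO₄m : Measurable O₄ := measurable_posOp (by fun_prop) hVm hUm (by fun_prop)
  have e₁ : l2 O₁ ≤ 4096000 * (b₁ * a₂) * L := by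
    refine (l2_posOp_tensor_le (by fun_prop) (by fun_prop) (by fun_prop) (by fun_prop) hUm hχm).trans ?_
    calc _ ≤ 1024000 * 2 * ((2 * b₁) * a₂) * L := by gcongr
      _ = _ := by ring
  have e₂ : l2 O₂ ≤ 4096000 * (a₁ * b₂) * L := by
    refine (l2_posOp_tensor_le (by fun_prop) (by fun_prop) (by fun_prop) (by fun_prop) hUm hχm).trans ?_
    calc _ ≤ 1024000 * 2 * (a₁ * (2 * b₂)) * L := by gcongr
      _ = _ := by ring
  have e₃ : l2 O₃ ≤ 64512000 * (ENNReal.ofReal η * (a₁ * a₂)) * L := by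
    refine (l2_posOp_le (by fun_prop) (by fun_prop) (by fun_prop) hUm hχm).trans ?_
    have hE := energy_one_sub_sep_le hκ0 (P := fun p => ‖P₃ p‖ₑ) (M := ENNReal.ofReal (M₁ * M₂))
      fun p => by
        simp only [hP₃]
        rw [← ofReal_norm, ← ofReal_norm, ← ENNReal.ofReal_mul (by positivity), norm_mul, norm_mul,
          Complex.norm_real]
        refine ENNReal.ofReal_le_ofReal ?_
        gcongr
        exacts [hgM₁ _, hgM₂ _]
    have hcalc : ENNReal.ofReal (M₁ * M₂) * ENNReal.ofReal κ ^ (1 / 6 : ℝ) =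
        9 * (ENNReal.ofReal η * (a₁ * a₂)) := by
      have h1 : κ ^ (1 / 6 : ℝ) = η ^ 3 := by
        rw [hκ, ← Real.rpow_natCast, ← Real.rpow_mul hη.le, ← Real.rpow_natCast]
        norm_num
      rw [ENNReal.ofReal_rpow_of_pos hκ0, h1, ← ENNReal.ofReal_mul (by positivity)]
      have h2 : M₁ * M₂ * η ^ 3 = 9 * (η * (a₁ * a₂)) := by
        rw [hM₁, hM₂]; field_simp; ring
      rw [h2, ENNReal.ofReal_mul (by norm_num), ENNReal.ofReal_mul hη.le,
        ENNReal.ofReal_mul (by positivity), ENNReal.ofReal_coe_nnreal, ENNReal.ofReal_coe_nnreal]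
      norm_num
    calc _ ≤ 12800 * 2 * (280 * ENNReal.ofReal (M₁ * M₂) * ENNReal.ofReal κ ^ (1 / 6 : ℝ)) * L := by
          gcongr
      _ = 12800 * 2 * (280 * (ENNReal.ofReal (M₁ * M₂) * ENNReal.ofReal κ ^ (1 / 6 : ℝ))) * L := by
          ring
      _ = _ := by rw [hcalc]; ring
  have e₄ : l2 (fun x => K * O₄ x) ≤ 1935360000 * (ENNReal.ofReal η * (a₁ * a₂)) * L := by
    rw [l2_const_mul _ hO₄m]
    have h1 : l2 O₄ ≤ 12800 * ENNReal.ofReal (20 * r) * 140 * L := by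
      refine (l2_posOp_le (by fun_prop) (by fun_prop) (by fun_prop) hUm (by fun_prop)).trans ?_
      gcongr
      · rw [lintegral_add_left (by fun_prop)]
        refine (add_le_add (lintegral_bump hr0) (lintegral_bump hr')).trans ?_
        rw [← ENNReal.ofReal_add (by positivity) (by positivity)]
        exact ENNReal.ofReal_le_ofReal (by linarith)
      · exact energy_one_rpow_le
    have h2 : K * ENNReal.ofReal (20 * r) ≤ 1080 * (ENNReal.ofReal η * (a₁ * a₂)) := by
      rw [hK, ← ENNReal.ofReal_mul (by positivity)]
      have h3 : ((6 * a₁ / η ^ 2 + M₁) * M₂ + (6 * a₂ / η ^ 2 + M₂) * M₁) * (1 / κ ^ 2) * (20 * r) ≤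
          1080 * (η * (a₁ * a₂)) := by
        have h4 : ∀ a : ℝ≥0, 6 * (a : ℝ) / η ^ 2 + 3 * a / η ≤ 9 * a / η ^ 2 := fun a => by
          have : 3 * (a : ℝ) / η ≤ 3 * a / η ^ 2 := by
            gcongr
            nlinarith
          calc _ ≤ 6 * (a : ℝ) / η ^ 2 + 3 * a / η ^ 2 := by gcongr
            _ = _ := by ring
        calc _ ≤ (9 * a₁ / η ^ 2 * M₂ + 9 * a₂ / η ^ 2 * M₁) * (1 / κ ^ 2) * (20 * r) := by
              gcongr
              exacts [h4 a₁, h4 a₂]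
          _ = _ := by
              rw [hM₁, hM₂, hκ, hr]
              field_simp
              ring
      refine (ENNReal.ofReal_le_ofReal h3).trans (le_of_eq ?_)
      rw [ENNReal.ofReal_mul (by norm_num), ENNReal.ofReal_mul hη.le,
        ENNReal.ofReal_mul (by positivity), ENNReal.ofReal_coe_nnreal, ENNReal.ofReal_coe_nnreal]
      norm_num
    calc _ ≤ K * (12800 * ENNReal.ofReal (20 * r) * 140 * L) := by gcongr
      _ = 12800 * (K * ENNReal.ofReal (20 * r)) * 140 * L := by ring
      _ ≤ 12800 * (1080 * (ENNReal.ofReal η * (a₁ * a₂))) * 140 * L := by gcongr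
      _ = _ := by ring
  calc _ ≤ l2 (fun x => O₁ x + (O₂ x + (O₃ x + K * O₄ x))) := l2_mono hpt
    _ ≤ l2 O₁ + (l2 O₂ + (l2 O₃ + l2 (fun x => K * O₄ x))) := by
        refine (l2_add_le hO₁m (by fun_prop)).trans (add_le_add le_rfl ?_)
        refine (l2_add_le hO₂m (by fun_prop)).trans (add_le_add le_rfl ?_)
        exact l2_add_le hO₃m (by fun_prop)
    _ ≤ 4096000 * (b₁ * a₂) * L + (4096000 * (a₁ * b₂) * L +
        (64512000 * (ENNReal.ofReal η * (a₁ * a₂)) * L +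
        1935360000 * (ENNReal.ofReal η * (a₁ * a₂)) * L)) := by gcongr
    _ ≤ 10 ^ 10 * (b₁ * a₂) * L + (10 ^ 10 * (a₁ * b₂) * L +
        (5 * 10 ^ 9 * (ENNReal.ofReal η * (a₁ * a₂)) * L +
        5 * 10 ^ 9 * (ENNReal.ofReal η * (a₁ * a₂)) * L)) := by
        gcongr <;> norm_num
    _ = _ := by ring

/-! ### The restriction of the convolution to the circle -/

/-- Averages over discs of radius `r` of the convolution of five densities. -/
def discConv (P Q : Circle × Circle → ℂ) (u : Circle → ℂ) (r : ℝ) (x : Circle) : ℂ :=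
  convOp P Q u (fun z => (disc r z : ℂ)) x

theorem measurable_discConv {P Q : Circle × Circle → ℂ} {u : Circle → ℂ} (hP : Measurable P)
    (hQ : Measurable Q) (hu : Measurable u) (r : ℝ) : Measurable (discConv P Q u r) := by
  unfold discConv convOp
  have hm : Measurable fun s : Circle × Quint => phase s.2 s.1 :=
    measurable_phase.comp measurable_swap
  have h : StronglyMeasurable fun s : Circle × Quint =>
      P s.2.1 * Q s.2.2.1 * u s.2.2.2 * (disc r (phase s.2 s.1) : ℂ) := by
    apply Measurable.stronglyMeasurable
    fun_prop
  exact h.integral_prod_right'.measurable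

theorem discConv_sub {P Q : Circle × Circle → ℂ} {u : Circle → ℂ}
    (hP : Integrable P (σ.prod σ)) (hQ : Integrable Q (σ.prod σ)) (hu : Integrable u σ)
    (r r' : ℝ) (x : Circle) :
    discConv P Q u r x - discConv P Q u r' x = convOp P Q u (discSub r r') x := by
  have h : ∀ ρ : ℝ, Integrable (fun t => P t.1 * Q t.2.1 * u t.2.2 * (disc ρ (phase t x) : ℂ))
      quintMeasure := fun ρ =>
    integrable_convOp hP hQ hu (φ := fun z => (disc ρ z : ℂ)) (by fun_prop)
      (fun z => by rw [Complex.norm_real]; exact norm_disc_le ρ z) x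
  rw [discConv, discConv, convOp, convOp, convOp, ← integral_sub (h r) (h r')]
  congr 1
  ext t
  rw [discSub]
  push_cast
  ring

/-! ### Disc averages under rotation, and the limit as the radius shrinks -/

theorem norm_sub_rot_le (t : ℝ) (x : Circle) : ‖(x : ℂ) - (rot t x : Circle)‖ ≤ |t| := by
  have h : (x : ℂ) - (rot t x : Circle) = -((Complex.exp (Complex.I * t) - 1) * x) := by
    rw [rot, Circle.coe_mul, Circle.coe_exp, mul_comm Complex.I]
    ring
  rw [h, norm_neg, norm_mul, Circle.norm_coe, mul_one]
  simpa using Real.norm_exp_I_mul_ofReal_sub_one_le (x := t)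

/-- The normalised indicator function of an annulus. -/
def annulus (r s : ℝ) (z : ℂ) : ℝ≥0∞ :=
  (Metric.ball (0 : ℂ) (r + s) \ Metric.ball 0 (r - s)).indicator
    (fun _ => ENNReal.ofReal (Real.pi * r ^ 2)⁻¹) z

@[fun_prop]
theorem measurable_annulus (r s : ℝ) : Measurable (annulus r s) :=
  measurable_const.indicator
    (Metric.isOpen_ball.measurableSet.diff Metric.isOpen_ball.measurableSet)

theorem ennreal_ofReal_pi : (NNReal.pi : ℝ≥0∞) = ENNReal.ofReal Real.pi := by
  rw [← NNReal.coe_real_pi, ENNReal.ofReal_coe_nnreal]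

theorem lintegral_annulus {r s : ℝ} (hr : 0 < r) (hs : 0 ≤ s) (hsr : s ≤ r) :
    ∫⁻ z, annulus r s z = ENNReal.ofReal (4 * s / r) := by
  have hpi := Real.pi_pos
  unfold annulus
  rw [lintegral_indicator_const
    (Metric.isOpen_ball.measurableSet.diff Metric.isOpen_ball.measurableSet),
    measure_sdiff (Metric.ball_subset_ball (by linarith))
      Metric.isOpen_ball.measurableSet.nullMeasurableSet measure_ball_lt_top.ne,
    Complex.volume_ball, Complex.volume_ball, ennreal_ofReal_pi,
    ← ENNReal.ofReal_pow (by linarith), ← ENNReal.ofReal_pow (by linarith),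
    ← ENNReal.ofReal_mul (by positivity), ← ENNReal.ofReal_mul (by positivity),
    ← ENNReal.ofReal_sub _ (by positivity), ← ENNReal.ofReal_mul (by positivity)]
  congr 1
  field_simp
  ring

/-- A displacement of length at most `s` can cross the boundary of the disc only from a point within
`s` of it. -/
theorem enorm_disc_sub_le {r s : ℝ} {z w : ℂ} (h : ‖w - z‖ ≤ s) :
    ‖disc r w - disc r z‖ₑ ≤ annulus r s z := by
  have hpi := Real.pi_pos
  have h0 : 0 ≤ (Real.pi * r ^ 2)⁻¹ := by positivity
  have h1 : ‖w‖ ≤ ‖z‖ + s := by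
    have := norm_add_le z (w - z)
    rw [add_sub_cancel] at this
    linarith
  have h2 : ‖z‖ ≤ ‖w‖ + s := by
    have := norm_sub_le w (w - z)
    rw [sub_sub_cancel] at this
    linarith
  by_cases hz : z ∈ Metric.ball (0 : ℂ) (r + s) \ Metric.ball 0 (r - s)
  · rw [annulus, indicator_of_mem hz, ← ofReal_norm]
    refine ENNReal.ofReal_le_ofReal ?_
    have a1 := disc_nonneg r w
    have a2 := disc_nonneg r z
    have a3 := norm_disc_le r w
    have a4 := norm_disc_le r z
    rw [Real.norm_of_nonneg a1] at a3
    rw [Real.norm_of_nonneg a2] at a4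
    rw [Real.norm_eq_abs, abs_le]
    constructor <;> linarith
  · have : disc r w = disc r z := by
      simp only [Set.mem_sdiff, Metric.mem_ball, dist_zero_right, not_and, not_not] at hz
      rcases lt_or_ge ‖z‖ (r + s) with h3 | h3
      · have h4 := hz h3
        have hs : 0 ≤ s := (norm_nonneg _).trans h
        rw [disc, disc, indicator_of_mem, indicator_of_mem] <;>
          simp only [Metric.mem_ball, dist_zero_right] <;> linarith
      · have hs : 0 ≤ s := (norm_nonneg _).trans h
        rw [disc, disc, indicator_of_notMem, indicator_of_notMem] <;>
          simp only [Metric.mem_ball, dist_zero_right, not_lt] <;> linarith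
    rw [this, sub_self, enorm_zero]
    exact zero_le

theorem enorm_discConv_rot_sub_le {P Q : Circle × Circle → ℂ} {u : Circle → ℂ}
    (hP : Integrable P (σ.prod σ)) (hQ : Integrable Q (σ.prod σ)) (hu : Integrable u σ)
    (r t : ℝ) (x : Circle) :
    ‖discConv P Q u r (rot t x) - discConv P Q u r x‖ₑ ≤
      posOp (fun p => ‖P p‖ₑ) (fun q => ‖Q q‖ₑ) (fun d => ‖u d‖ₑ) (annulus r |t|) x := by
  have h : ∀ y : Circle, Integrable
      (fun t => P t.1 * Q t.2.1 * u t.2.2 * (disc r (phase t y) : ℂ)) quintMeasure := fun y =>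
    integrable_convOp hP hQ hu (φ := fun z => (disc r z : ℂ)) (by fun_prop)
      (fun z => by rw [Complex.norm_real]; exact norm_disc_le r z) y
  rw [discConv, discConv, convOp, convOp, ← integral_sub (h _) (h _)]
  refine (enorm_integral_le_lintegral_enorm _).trans (lintegral_mono fun s => ?_)
  simp only
  rw [← mul_sub, enorm_mul, enorm_mul, enorm_mul, ← Complex.ofReal_sub]
  gcongr
  rw [← ofReal_norm, Complex.norm_real, ofReal_norm]
  refine enorm_disc_sub_le ?_
  have : phase s (rot t x) - phase s x = (x : ℂ) - (rot t x : Circle) := by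
    simp only [phase]; ring
  rw [this]
  exact norm_sub_rot_le t x

section

variable {f₁ f₂ v w u : Circle → ℂ} {α : ℝ} {A₁ A₂ : ℝ≥0}

/-- With `η = r^(1/40)`, the moduli of continuity at scale `η` become `r^(α/40)`. The term of order
`η` is no larger because `α ≤ 1`. -/
theorem l2_discConv_sub_le (hf₁ : Measurable f₁) (hf₂ : Measurable f₂)
    (hv : Measurable v) (hw : Measurable w) (hu : Measurable u) (hα0 : 0 < α) (hα1 : α ≤ 1)
    (ha₁ : l2 (fun x => ‖f₁ x‖ₑ) ≤ A₁) (ha₂ : l2 (fun x => ‖f₂ x‖ₑ) ≤ A₂)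
    (hb₁ : ∀ t ∈ Ioc (0 : ℝ) 1, l2 (fun x => ‖f₁ (rot t x) - f₁ x‖ₑ) ≤ A₁ * ENNReal.ofReal (t ^ α))
    (hb₂ : ∀ t ∈ Ioc (0 : ℝ) 1, l2 (fun x => ‖f₂ (rot t x) - f₂ x‖ₑ) ≤ A₂ * ENNReal.ofReal (t ^ α))
    (hv2 : l2 (fun x => ‖v x‖ₑ) ≠ ∞) (hw2 : l2 (fun x => ‖w x‖ₑ) ≠ ∞)
    (hu2 : l2 (fun x => ‖u x‖ₑ) ≠ ∞) {r r' : ℝ} (hr' : 0 < r') (hr'r : r' ≤ r) (hr1 : r ≤ 1) :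
    l2 (fun x => ‖discConv (tensor f₁ f₂) (tensor v w) u r x -
      discConv (tensor f₁ f₂) (tensor v w) u r' x‖ₑ) ≤
      3 * 10 ^ 10 * ENNReal.ofReal (r ^ (α / 40)) * (A₁ * A₂ *
        (l2 (fun x => ‖v x‖ₑ) * l2 (fun x => ‖w x‖ₑ) * l2 (fun x => ‖u x‖ₑ))) := by
  have hr : 0 < r := hr'.trans_le hr'r
  have i : ∀ {f : Circle → ℂ}, Measurable f → l2 (fun x => ‖f x‖ₑ) ≠ ∞ → Integrable f σ :=
    fun hf h => integrable_of_l2_ne_top hf h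
  have n₁ := (ha₁.trans_lt ENNReal.coe_lt_top).ne
  have n₂ := (ha₂.trans_lt ENNReal.coe_lt_top).ne
  simp_rw [discConv_sub (integrable_tensor (i hf₁ n₁) (i hf₂ n₂))
    (integrable_tensor (i hv hv2) (i hw hw2)) (i hu hu2)]
  set η : ℝ := r ^ (1 / 40 : ℝ) with hη
  have hη0 : 0 < η := by positivity
  have hη1 : η ≤ 1 := Real.rpow_le_one hr.le hr1 (by norm_num)
  have hηr : η ^ 40 = r := by
    rw [hη, ← Real.rpow_natCast, ← Real.rpow_mul hr.le]; norm_num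
  have hηα : r ^ (α / 40) = η ^ α := by
    rw [hη, ← Real.rpow_mul hr.le]; congr 1; ring
  have hmon : ∀ t ∈ Ioc 0 η, ENNReal.ofReal (t ^ α) ≤ ENNReal.ofReal (η ^ α) := fun t ht =>
    ENNReal.ofReal_le_ofReal (Real.rpow_le_rpow ht.1.le ht.2 hα0.le)
  have h := l2_convOp_discSub_le hf₁ hf₂ hv hw hu hη0 hη1 ha₁ ha₂
    (b₁ := A₁ * ENNReal.ofReal (η ^ α)) (b₂ := A₂ * ENNReal.ofReal (η ^ α))
    (fun t ht => (hb₁ t ⟨ht.1, ht.2.trans hη1⟩).trans (mul_le_mul' le_rfl (hmon t ht)))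
    (fun t ht => (hb₂ t ⟨ht.1, ht.2.trans hη1⟩).trans (mul_le_mul' le_rfl (hmon t ht)))
    hv2 hw2 hu2 hr' (by rwa [hηr])
  rw [hηr] at h
  refine h.trans ?_
  have hle : ENNReal.ofReal η ≤ ENNReal.ofReal (η ^ α) := by
    refine ENNReal.ofReal_le_ofReal ?_
    simpa using Real.rpow_le_rpow_of_exponent_ge hη0 hη1 hα1
  rw [hηα]
  generalize l2 (fun x => ‖v x‖ₑ) * l2 (fun x => ‖w x‖ₑ) * l2 (fun x => ‖u x‖ₑ) = L
  calc _ ≤ 10 ^ 10 * (ENNReal.ofReal (η ^ α) * (A₁ * A₂) + (A₁ * ENNReal.ofReal (η ^ α) * A₂ +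
        A₁ * (A₂ * ENNReal.ofReal (η ^ α)))) * L := by gcongr
    _ = _ := by ring

theorem l2_sub_le {f g h : Circle → ℂ} (hf : Measurable f) (hg : Measurable g) (hh : Measurable h) :
    l2 (fun x => ‖f x - h x‖ₑ) ≤ l2 (fun x => ‖f x - g x‖ₑ) + l2 (fun x => ‖g x - h x‖ₑ) := by
  refine le_trans (l2_mono fun x => ?_) (l2_add_le (by fun_prop) (by fun_prop))
  rw [← sub_add_sub_cancel (f x) (g x) (h x)]
  exact enorm_add_le _ _

theorem l2_sub_comm (f g : Circle → ℂ) :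
    l2 (fun x => ‖f x - g x‖ₑ) = l2 (fun x => ‖g x - f x‖ₑ) := by
  simp_rw [enorm_sub_rev]

/-- An `L²` family with Hölder continuous dependence on a small parameter has a limit. -/
theorem exists_l2_limit {G : ℝ → Circle → ℂ} (hG : ∀ r, Measurable (G r))
    (hG2 : ∀ r, 0 < r → l2 (fun x => ‖G r x‖ₑ) ≠ ∞) {β : ℝ} (hβ : 0 < β) {K : ℝ≥0∞} (hK : K ≠ ∞)
    (h : ∀ r r' : ℝ, 0 < r' → r' ≤ r → r ≤ 1 →
      l2 (fun x => ‖G r x - G r' x‖ₑ) ≤ ENNReal.ofReal (r ^ β) * K) :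
    ∃ F : Circle → ℂ, Measurable F ∧ ∀ r : ℝ, 0 < r → r ≤ 1 →
      l2 (fun x => ‖G r x - F x‖ₑ) ≤ ENNReal.ofReal (r ^ β) * K := by
  -- Along dyadic radii the errors are geometric, hence summable, and `L²` is complete.
  set s : ℕ → ℝ := fun n => (1 / 2) ^ n with hs
  have hs0 : ∀ n, 0 < s n := fun n => by positivity
  have hs1 : ∀ n, s n ≤ 1 := fun n => pow_le_one₀ (by norm_num) (by norm_num)
  set ρ : ℝ := (1 / 2) ^ β with hρ
  have hρ1 : ρ < 1 := Real.rpow_lt_one (by norm_num) (by norm_num) hβ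
  have hρ0 : 0 < ρ := by positivity
  have hsρ : ∀ n, (s n) ^ β = ρ ^ n := fun n => by
    change ((1 / 2 : ℝ) ^ n) ^ β = ((1 / 2 : ℝ) ^ β) ^ n
    rw [← Real.rpow_natCast, ← Real.rpow_natCast, ← Real.rpow_mul (by norm_num),
      ← Real.rpow_mul (by norm_num), mul_comm]
  have hmem : ∀ n, MemLp (G (s n)) 2 σ := fun n =>
    ⟨(hG _).aestronglyMeasurable, by rw [eLpNorm_eq_l2]; exact (hG2 _ (hs0 n)).lt_top⟩
  -- The constant `K + 1` supplies the strict inequality, also when `K = 0`.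
  have hcau : ∀ N n m : ℕ, N ≤ n → n ≤ m →
      eLpNorm (G (s n) - G (s m)) 2 σ < (K + 1) * ENNReal.ofReal ρ ^ N := by
    intro N n m hNn hnm
    rw [eLpNorm_eq_l2]
    refine (h (s n) (s m) (hs0 m) (pow_le_pow_of_le_one (by norm_num) (by norm_num) hnm)
      (hs1 n)).trans_lt ?_
    rw [hsρ, ENNReal.ofReal_pow hρ0.le, mul_comm]
    have hρn : ENNReal.ofReal ρ ≠ 0 := by simpa using hρ0
    calc _ ≤ K * ENNReal.ofReal ρ ^ N := by
          gcongr 1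
          exact pow_le_pow_of_le_one zero_le (ENNReal.ofReal_le_one.2 hρ1.le) hNn
      _ < _ := by
          refine (ENNReal.mul_lt_mul_iff_left (pow_ne_zero _ hρn)
            (ENNReal.pow_ne_top ENNReal.ofReal_ne_top)).2 ?_
          exact ENNReal.lt_add_right hK one_ne_zero
  obtain ⟨F, hF, hlim⟩ := Lp.cauchy_complete_eLpNorm (p := 2) (μ := σ) (by norm_num) hmem
    (B := fun N => (K + 1) * ENNReal.ofReal ρ ^ N) (by
      rw [ENNReal.tsum_mul_left, ENNReal.tsum_geometric]
      refine ENNReal.mul_ne_top (by finiteness) (ENNReal.inv_ne_top.2 ?_)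
      exact (tsub_pos_of_lt (ENNReal.ofReal_lt_one.2 hρ1)).ne') (by
      intro N n m hn hm
      rcases le_total n m with hnm | hnm
      · exact hcau N n m hn hnm
      · rw [← eLpNorm_neg, neg_sub]
        exact hcau N m n hm hnm)
  obtain ⟨F', hF', hFF'⟩ := hF.1
  refine ⟨F', hF'.measurable, fun r hr hr1 => ?_⟩
  have hlim' : Tendsto (fun n => ENNReal.ofReal (r ^ β) * K + l2 (fun x => ‖G (s n) x - F' x‖ₑ))
      atTop (𝓝 (ENNReal.ofReal (r ^ β) * K + 0)) := by
    refine Tendsto.const_add _ (hlim.congr fun n => ?_)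
    rw [← eLpNorm_eq_l2]
    exact eLpNorm_congr_ae (EventuallyEq.rfl.sub hFF')
  rw [add_zero] at hlim'
  -- A general radius is compared with dyadic radii below it, which then tend to zero.
  refine ge_of_tendsto hlim' ?_
  have hs_lim : Tendsto s atTop (𝓝 0) := tendsto_pow_atTop_nhds_zero_of_lt_one (by norm_num)
    (by norm_num)
  filter_upwards [hs_lim.eventually_le_const hr] with n hn
  refine (l2_sub_le (hG r) (hG (s n)) hF'.measurable).trans ?_
  gcongr
  exact h r (s n) (hs0 n) hn hr1

end

theorem lintegral_enorm_ofReal_disc {r : ℝ} (hr : 0 < r) : ∫⁻ z, ‖((disc r z : ℝ) : ℂ)‖ₑ = 1 := by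
  rw [← lintegral_enorm_disc hr]
  congr 1
  ext z
  rw [← ofReal_norm, Complex.norm_real, ofReal_norm]

/-- The Cauchy rate gives the limit; its norm is read off at radius `1`. For the Hölder bound, `F`
is compared with a disc average before and after the rotation, and the rotated disc average differs
by an annulus term of mass `4|t|/r`. -/
theorem exists_discConv_limit {f₁ f₂ v w u : Circle → ℂ} {α : ℝ} {A₁ A₂ : ℝ≥0} {L : ℝ≥0∞}
    (hf₁ : Measurable f₁) (hf₂ : Measurable f₂)
    (hv : Measurable v) (hw : Measurable w) (hu : Measurable u) (hα0 : 0 < α) (hα1 : α ≤ 1)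
    (ha₁ : l2 (fun x => ‖f₁ x‖ₑ) ≤ A₁) (ha₂ : l2 (fun x => ‖f₂ x‖ₑ) ≤ A₂)
    (hb₁ : ∀ t ∈ Ioc (0 : ℝ) 1, l2 (fun x => ‖f₁ (rot t x) - f₁ x‖ₑ) ≤ A₁ * ENNReal.ofReal (t ^ α))
    (hb₂ : ∀ t ∈ Ioc (0 : ℝ) 1, l2 (fun x => ‖f₂ (rot t x) - f₂ x‖ₑ) ≤ A₂ * ENNReal.ofReal (t ^ α))
    (hv2 : l2 (fun x => ‖v x‖ₑ) ≠ ∞) (hw2 : l2 (fun x => ‖w x‖ₑ) ≠ ∞)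
    (hu2 : l2 (fun x => ‖u x‖ₑ) ≠ ∞)
    (hL : L = A₁ * A₂ * (l2 (fun x => ‖v x‖ₑ) * l2 (fun x => ‖w x‖ₑ) * l2 (fun x => ‖u x‖ₑ))) :
    ∃ F : Circle → ℂ, Measurable F ∧
      Tendsto (fun r => l2 (fun x => ‖discConv (tensor f₁ f₂) (tensor v w) u r x - F x‖ₑ))
        (𝓝[>] 0) (𝓝 0) ∧
      l2 (fun x => ‖F x‖ₑ) ≤ 10 ^ 11 * L ∧
      ∀ t : ℝ, 0 < |t| → |t| ≤ 1 → l2 (fun x => ‖F (rot t x) - F x‖ₑ) ≤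
        10 ^ 11 * L * ENNReal.ofReal (|t| ^ (α / 80)) := by
  set G := discConv (tensor f₁ f₂) (tensor v w) u with hG
  have n₁ := (ha₁.trans_lt ENNReal.coe_lt_top).ne
  have n₂ := (ha₂.trans_lt ENNReal.coe_lt_top).ne
  have hLtop : L ≠ ∞ := by rw [hL]; finiteness
  have iP := integrable_tensor (integrable_of_l2_ne_top hf₁ n₁) (integrable_of_l2_ne_top hf₂ n₂)
  have iQ := integrable_tensor (integrable_of_l2_ne_top hv hv2) (integrable_of_l2_ne_top hw hw2)
  have iu := integrable_of_l2_ne_top hu hu2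
  have hGm : ∀ r, Measurable (G r) := fun r =>
    measurable_discConv (measurable_tensor hf₁ hf₂) (measurable_tensor hv hw) hu r
  have hpos : ∀ χ : ℂ → ℝ≥0∞, Measurable χ →
      l2 (posOp (fun p => ‖tensor f₁ f₂ p‖ₑ) (fun q => ‖tensor v w q‖ₑ) (fun d => ‖u d‖ₑ) χ) ≤
        1024000 * (∫⁻ z, χ z) * L := fun χ hχ => by
    rw [enorm_tensor, enorm_tensor]
    refine (l2_posOp_tensor_le (by fun_prop) (by fun_prop) (by fun_prop) (by fun_prop)
      (by fun_prop) hχ).trans ?_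
    calc _ ≤ 1024000 * (∫⁻ z, χ z) * (A₁ * A₂) *
          (l2 (fun x => ‖v x‖ₑ) * l2 (fun x => ‖w x‖ₑ) * l2 (fun x => ‖u x‖ₑ)) := by gcongr
      _ = _ := by rw [hL, mul_assoc]
  have hGle : ∀ r, 0 < r → l2 (fun x => ‖G r x‖ₑ) ≤ 1024000 * L := fun r hr => by
    refine (l2_mono fun x => enorm_convOp_le _ _ _ _ x).trans ?_
    have := hpos (fun z => ‖((disc r z : ℝ) : ℂ)‖ₑ) (by fun_prop)
    rwa [lintegral_enorm_ofReal_disc hr, mul_one] at this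
  obtain ⟨F, hFm, hF⟩ := exists_l2_limit (G := G) hGm
    (fun r hr => ((hGle r hr).trans_lt (by finiteness)).ne) (β := α / 40) (by positivity)
    (K := 3 * 10 ^ 10 * L) (by finiteness) fun r r' hr' hr'r hr1 => by
      refine (l2_discConv_sub_le hf₁ hf₂ hv hw hu hα0 hα1 ha₁ ha₂ hb₁ hb₂ hv2 hw2 hu2 hr' hr'r
        hr1).trans (le_of_eq ?_)
      rw [← hL]
      ring
  have hrotm : ∀ t {f : Circle → ℂ}, Measurable f → Measurable fun x => f (rot t x) :=
    fun t f hf => hf.comp (measurePreserving_rot t).measurable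
  refine ⟨F, hFm, ?_, ?_, fun t ht0 ht1 => ?_⟩
  · have hlim : Tendsto (fun r : ℝ => ENNReal.ofReal (r ^ (α / 40)) * (3 * 10 ^ 10 * L))
        (𝓝[>] 0) (𝓝 0) := by
      have h1 : Tendsto (fun r : ℝ => r ^ (α / 40)) (𝓝[>] 0) (𝓝 0) := by
        have := (Real.continuous_rpow_const (q := α / 40) (by positivity)).tendsto 0
        rw [Real.zero_rpow (by positivity)] at this
        exact this.mono_left nhdsWithin_le_nhds
      have h2 := ENNReal.Tendsto.mul_const (b := 3 * 10 ^ 10 * L) (ENNReal.tendsto_ofReal h1)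
        (Or.inr (by finiteness))
      simpa using h2
    refine tendsto_of_tendsto_of_tendsto_of_le_of_le' tendsto_const_nhds hlim
      (Eventually.of_forall fun _ => zero_le) ?_
    filter_upwards [Ioc_mem_nhdsGT (zero_lt_one (α := ℝ))] with r hr
    exact hF r hr.1 hr.2
  · calc _ ≤ l2 (fun x => ‖F x - G 1 x‖ₑ + ‖G 1 x‖ₑ) := l2_mono fun x => by
          nth_rewrite 1 [← sub_add_cancel (F x) (G 1 x)]
          exact enorm_add_le _ _
      _ ≤ l2 (fun x => ‖F x - G 1 x‖ₑ) + l2 (fun x => ‖G 1 x‖ₑ) := by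
          have := hGm 1
          exact l2_add_le (by fun_prop) (by fun_prop)
      _ ≤ 3 * 10 ^ 10 * L + 1024000 * L := by
          gcongr
          · rw [l2_sub_comm]
            simpa using hF 1 one_pos le_rfl
          · exact hGle 1 one_pos
      _ = (3 * 10 ^ 10 + 1024000) * L := by ring
      _ ≤ _ := by gcongr; norm_num
  -- The approximation error is `r^(α/40)` and the annulus has mass `4|t|/r`. With this radius they
  -- are `|t|^(α/80)` and `4|t|^(1/2)`, the latter at most `4|t|^(α/80)`.
  · set r : ℝ := |t| ^ (1 / 2 : ℝ) with hr
    have hr0 : 0 < r := by positivity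
    have hr1 : r ≤ 1 := Real.rpow_le_one ht0.le ht1 (by norm_num)
    have hrr : |t| = r ^ 2 := by
      rw [hr, ← Real.rpow_natCast, ← Real.rpow_mul ht0.le]; norm_num
    have htr : |t| ≤ r := by rw [hrr]; nlinarith
    have e1 : r ^ (α / 40) = |t| ^ (α / 80) := by
      rw [hr, ← Real.rpow_mul ht0.le]; congr 1; ring
    have e2 : ENNReal.ofReal (4 * |t| / r) ≤ 4 * ENNReal.ofReal (|t| ^ (α / 80)) := by
      have : 4 * |t| / r ≤ 4 * |t| ^ (α / 80) := by
        rw [← e1]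
        have h1 : 4 * |t| / r = 4 * r := by rw [hrr]; field_simp
        rw [h1]
        gcongr
        simpa using Real.rpow_le_rpow_of_exponent_ge hr0 hr1 (by linarith : α / 40 ≤ 1)
      refine (ENNReal.ofReal_le_ofReal this).trans (le_of_eq ?_)
      rw [ENNReal.ofReal_mul (by norm_num)]
      norm_num
    have h1 := hF r hr0 hr1
    rw [e1] at h1
    have h2 : l2 (fun x => ‖F (rot t x) - G r (rot t x)‖ₑ) ≤
        ENNReal.ofReal (|t| ^ (α / 80)) * (3 * 10 ^ 10 * L) := by
      have := hGm r
      rw [l2_comp_rot t (f := fun x => ‖F x - G r x‖ₑ) (by fun_prop), l2_sub_comm]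
      exact h1
    have h3 : l2 (fun x => ‖G r (rot t x) - G r x‖ₑ) ≤
        1024000 * (4 * ENNReal.ofReal (|t| ^ (α / 80))) * L := by
      refine (l2_mono fun x => enorm_discConv_rot_sub_le iP iQ iu r t x).trans ?_
      refine (hpos _ (measurable_annulus r |t|)).trans ?_
      rw [lintegral_annulus hr0 ht0.le htr]
      gcongr
    calc _ ≤ l2 (fun x => ‖F (rot t x) - G r (rot t x)‖ₑ) +
          (l2 (fun x => ‖G r (rot t x) - G r x‖ₑ) + l2 (fun x => ‖G r x - F x‖ₑ)) :=
          (l2_sub_le (hrotm t hFm) (hrotm t (hGm r)) hFm).trans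
            (add_le_add le_rfl (l2_sub_le (hrotm t (hGm r)) (hGm r) hFm))
      _ ≤ ENNReal.ofReal (|t| ^ (α / 80)) * (3 * 10 ^ 10 * L) +
          (1024000 * (4 * ENNReal.ofReal (|t| ^ (α / 80))) * L +
          ENNReal.ofReal (|t| ^ (α / 80)) * (3 * 10 ^ 10 * L)) := by gcongr
      _ = (3 * 10 ^ 10 + (1024000 * 4 + 3 * 10 ^ 10)) * L * ENNReal.ofReal (|t| ^ (α / 80)) := by ring
      _ ≤ _ := by gcongr; norm_num

/-! ### The convolution measure -/

/-- The reordering of a quintuple of points. -/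
def quintEquiv (t : Quint) : Fin 5 → Circle := ![t.1.1, t.1.2, t.2.1.1, t.2.2, t.2.1.2]

theorem measurePreserving_quintEquiv :
    MeasurePreserving quintEquiv quintMeasure (Measure.pi fun _ : Fin 5 => σ) := by
  have hm : Measurable quintEquiv := by
    refine measurable_pi_lambda _ fun i => ?_
    fin_cases i <;> simp only [quintEquiv] <;> simp <;> fun_prop
  refine ⟨hm, (Measure.pi_eq fun s hs => ?_).symm⟩
  rw [Measure.map_apply hm (MeasurableSet.univ_pi hs)]
  have : quintEquiv ⁻¹' univ.pi s = (s 0 ×ˢ s 1) ×ˢ ((s 2 ×ˢ s 4) ×ˢ s 3) := by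
    ext t
    simp only [quintEquiv, mem_preimage, mem_univ_pi, Fin.forall_fin_succ, mem_prod]
    simp
    tauto
  rw [this, quintMeasure, Measure.prod_prod, Measure.prod_prod, Measure.prod_prod,
    Measure.prod_prod]
  simp [Fin.prod_univ_succ]
  ring

/-- The sum of the five points lies in the disc about `x` exactly when the phase lies in the disc
about `0`. The reordering `quintEquiv` puts indices `2` and `4` in the second pair and leaves index
`3` single. Measurable representatives change nothing, as the product is only integrated. -/
theorem convMeasure_ball_div {f g : Fin 5 → Circle → ℂ} (hg : ∀ i, Measurable (g i))
    (hgi : ∀ i, Integrable (g i) σ) (hfg : ∀ i, f i =ᵐ[σ] g i) {r : ℝ} (hr : 0 < r) (x : Circle) :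
    convMeasure f (Metric.ball (x : ℂ) r) / ((volume.real (Metric.ball (x : ℂ) r) : ℝ) : ℂ) =
      discConv (tensor (g 0) (g 1)) (tensor (g 2) (g 4)) (g 3) r x := by
  have hpi := Real.pi_pos
  have hgint : Integrable (fun y : Fin 5 → Circle => ∏ i, g i (y i)) (Measure.pi fun _ => σ) :=
    Integrable.fintype_prod hgi
  have hae : (fun y : Fin 5 → Circle => ∏ i, f i (y i)) =ᵐ[Measure.pi fun _ => σ]
      fun y => ∏ i, g i (y i) := by
    have : ∀ i, ∀ᵐ y ∂(Measure.pi fun _ : Fin 5 => σ), f i (y i) = g i (y i) := fun i =>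
      (Measure.tendsto_eval_ae_ae (μ := fun _ : Fin 5 => σ) (i := i)).eventually (hfg i)
    filter_upwards [ae_all_iff.2 this] with y hy
    simp [hy]
  have hfint : Integrable (fun y : Fin 5 → Circle => ∏ i, f i (y i)) (Measure.pi fun _ => σ) :=
    hgint.congr hae.symm
  have hsum : Measurable fun y : Fin 5 → Circle => ∑ i, (y i : ℂ) := by fun_prop
  have hB : MeasurableSet (Metric.ball (x : ℂ) r) := Metric.isOpen_ball.measurableSet
  have hvol : volume.real (Metric.ball (x : ℂ) r) = Real.pi * r ^ 2 := by
    rw [Measure.real, Complex.volume_ball, ← ENNReal.ofReal_pow hr.le, ENNReal.toReal_mul,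
      ENNReal.toReal_ofReal (by positivity), ENNReal.coe_toReal, NNReal.coe_real_pi, mul_comm]
  rw [convMeasure, VectorMeasure.map_apply _ hsum hB, withDensityᵥ_apply hfint (hsum hB), hvol,
    setIntegral_congr_ae (g := fun y => ∏ i, g i (y i)) (hsum hB) (hae.mono fun y hy _ => hy),
    ← integral_indicator (hsum hB), ← measurePreserving_quintEquiv.map_eq,
    integral_map measurePreserving_quintEquiv.measurable.aemeasurable
      ((Measurable.indicator (by fun_prop) (hsum hB)).aestronglyMeasurable),
    div_eq_mul_inv, mul_comm, ← integral_const_mul, discConv, convOp]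
  congr 1
  ext t
  have hph : ∑ i, (quintEquiv t i : ℂ) - x = phase t x := by
    simp [quintEquiv, phase, Fin.sum_univ_succ]
    ring
  have hmem : quintEquiv t ∈ (fun y : Fin 5 → Circle => ∑ i, (y i : ℂ)) ⁻¹' Metric.ball (x : ℂ) r ↔
      phase t x ∈ Metric.ball (0 : ℂ) r := by
    rw [mem_preimage, Metric.mem_ball, dist_eq_norm, hph, Metric.mem_ball, dist_zero_right]
  by_cases h : phase t x ∈ Metric.ball (0 : ℂ) r
  · rw [indicator_of_mem (hmem.2 h), disc, indicator_of_mem h]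
    simp [quintEquiv, tensor, Fin.prod_univ_succ]
    ring
  · rw [indicator_of_notMem (fun h' => h (hmem.1 h')), disc, indicator_of_notMem h]
    simp

/-! ### The Hölder space -/

/-- For order zero the weak derivative identity says that `f` and `g` have equal integrals against
smooth functions, and these determine an integrable function. -/
theorem ae_eq_of_isWeakDeriv_zero {f g : Circle → ℂ} (hf : MemLp f 2 σ) (h : IsWeakDeriv 0 f g) :
    f =ᵐ[σ] g := by
  have hfi : Integrable f σ := hf.integrable (by norm_num)
  have hgi : Integrable g σ := h.1.integrable (by norm_num)
  refine ae_eq_of_integral_contMDiff_smul_eq (modelWithCornersSelf ℝ (EuclideanSpace ℝ (Fin 1)))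
    hfi.locallyIntegrable hgi.locallyIntegrable fun φ hφ _ => ?_
  have hsm : IsSmooth fun x => (φ x : ℂ) := by
    have h1 := hφ.comp (contMDiff_circleExp (m := ((⊤ : ℕ∞) : WithTop ℕ∞)))
    exact Complex.ofRealCLM.contDiff.comp h1.contDiff
  have h2 := h.2 _ hsm
  simp only [Function.iterate_zero, id, pow_zero, one_mul] at h2
  simpa only [Complex.real_smul, mul_comm] using h2

theorem ordInt_lt {s : ℝ} (hs : 0 < s) : 0 < s - ordInt s := by
  have h1 : 1 ≤ ⌈s⌉₊ := Nat.ceil_pos.2 hs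
  have h2 := Nat.ceil_lt_add_one hs.le
  rw [ordInt, Nat.cast_sub h1]
  push_cast
  linarith

theorem sub_ordInt_le {s : ℝ} (hs : 0 < s) : s - ordInt s ≤ 1 := by
  have h1 : 1 ≤ ⌈s⌉₊ := Nat.ceil_pos.2 hs
  have h2 := Nat.le_ceil s
  rw [ordInt, Nat.cast_sub h1]
  push_cast
  linarith

theorem ordInt_of_le_one {s : ℝ} (hs : s ≤ 1) : ordInt s = 0 := by
  have : ⌈s⌉₊ ≤ 1 := Nat.ceil_le.2 (by simpa using hs)
  rw [ordInt]
  omega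

theorem eLpNorm_le_HNorm (s : ℝ) (f : Circle → ℂ) : eLpNorm f 2 σ ≤ HNorm s f := le_self_add

theorem eLpNorm_rot_sub_congr {f g : Circle → ℂ} (h : f =ᵐ[σ] g) (t : ℝ) :
    eLpNorm (fun x => f (rot t x) - f x) 2 σ = eLpNorm (fun x => g (rot t x) - g x) 2 σ :=
  eLpNorm_congr_ae (((measurePreserving_rot t).quasiMeasurePreserving.ae_eq_comp h).sub h)

/-- Only the term `m = 0` of the norm is kept. It bounds `f` itself with exponent `s - ordInt s`,
also when `s > 1`. -/
theorem eLpNorm_rot_sub_le {s : ℝ} {f : Circle → ℂ} (hf : MemLp f 2 σ) {t : ℝ}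
    (ht0 : 0 < |t|) (ht1 : |t| ≤ 1) :
    eLpNorm (fun x => f (rot t x) - f x) 2 σ ≤
      HNorm s f * ENNReal.ofReal (|t| ^ (s - ordInt s)) := by
  have hpos : 0 < |t| ^ (s - ordInt s) := by positivity
  rw [← ENNReal.div_le_iff (by simpa using hpos) ENNReal.ofReal_ne_top]
  calc _ ≤ ⨅ g : Circle → ℂ, ⨅ _ : IsWeakDeriv 0 f g, holderSeminorm (s - ordInt s) g := by
        refine le_iInf₂ fun g hg => ?_
        rw [eLpNorm_rot_sub_congr (ae_eq_of_isWeakDeriv_zero hf hg) t, holderSeminorm,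
          Fin.sum_univ_two]
        exact (le_iSup₂ (f := fun (t : ℝ) (_ : 0 < |t| ∧ |t| ≤ 1) =>
          eLpNorm (fun x => g (rot t x) - g x) 2 σ / ENNReal.ofReal (|t| ^ (s - ordInt s)))
          t ⟨ht0, ht1⟩).trans le_self_add
    _ ≤ ∑ m ∈ Finset.range (ordInt s + 1),
        ⨅ g : Circle → ℂ, ⨅ _ : IsWeakDeriv m f g, holderSeminorm (s - ordInt s) g :=
        Finset.single_le_sum (f := fun m => ⨅ g : Circle → ℂ, ⨅ _ : IsWeakDeriv m f g,
          holderSeminorm (s - ordInt s) g) (fun _ _ => zero_le) (by simp)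
    _ ≤ _ := le_add_self

/-- For `s ≤ 1` only `m = 0` occurs, and `f` itself competes in the infimum. The factor `2` counts
the two equal fields. -/
theorem HNorm_le {s : ℝ} (hs1 : s ≤ 1) {f : Circle → ℂ} (hf : MemLp f 2 σ) {B : ℝ≥0∞}
    (hB : ∀ t : ℝ, 0 < |t| → |t| ≤ 1 →
      eLpNorm (fun x => f (rot t x) - f x) 2 σ ≤ B * ENNReal.ofReal (|t| ^ s)) :
    HNorm s f ≤ eLpNorm f 2 σ + 2 * B := by
  rw [HNorm, ordInt_of_le_one hs1]
  simp only [zero_add, Finset.range_one, Finset.sum_singleton, Nat.cast_zero, sub_zero]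
  gcongr
  refine (iInf₂_le f ⟨hf, fun φ _ => by simp⟩).trans ?_
  rw [holderSeminorm, Fin.sum_univ_two, ← two_mul]
  gcongr
  refine iSup₂_le fun t ht => ENNReal.div_le_of_le_mul (hB t ht.1 ht.2)

end CircleConv

end

/-! ### The main theorem -/

theorem proposition1 (ε : ℝ) (hε : 0 < ε) :
    ∃ δ : ℝ, 0 < δ ∧ δ < 1 ∧ ∃ C : ℝ≥0,
      ∀ f : Fin 4 → Circle → ℂ, (∀ i, CircleConv.MemH ε (f i)) →
      ∀ h : Circle → ℂ, MemLp h 2 CircleConv.σ →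
        ∃ F : Circle → ℂ,
          CircleConv.IsRestriction (CircleConv.convMeasure ![f 0, f 1, f 2, f 3, h]) F ∧
          CircleConv.MemH δ F ∧
          CircleConv.HNorm δ F ≤
            (C : ℝ≥0∞) * (∏ i, CircleConv.HNorm ε (f i)) * eLpNorm h 2 CircleConv.σ := by
  open CircleConv in
  have hα0 := ordInt_lt hε
  have hα1 := sub_ordInt_le hε
  set α : ℝ := ε - ordInt ε with hα
  -- The exponent comes from `exists_discConv_limit`. The constant is `10^11` for the `L²` norm plus
  -- twice `10^11` for the two equal seminorms.
  refine ⟨α / 80, by positivity, by linarith, 3 * 10 ^ 11, fun f hf h hh => ?_⟩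
  set k : Fin 5 → Circle → ℂ := ![f 0, f 1, f 2, f 3, h] with hk
  have hkL : ∀ i, MemLp (k i) 2 σ := by
    intro i
    fin_cases i
    exacts [(hf 0).1, (hf 1).1, (hf 2).1, (hf 3).1, hh]
  -- The estimates are for measurable functions, so each factor is replaced by a measurable
  -- representative.
  set g : Fin 5 → Circle → ℂ := fun i => (hkL i).1.mk (k i) with hg
  have hgm : ∀ i, Measurable (g i) := fun i => (hkL i).1.stronglyMeasurable_mk.measurable
  have hkg : ∀ i, k i =ᵐ[σ] g i := fun i => (hkL i).1.ae_eq_mk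
  have hgL : ∀ i, MemLp (g i) 2 σ := fun i => (memLp_congr_ae (hkg i)).1 (hkL i)
  have hgl2 : ∀ i, l2 (fun x => ‖g i x‖ₑ) = eLpNorm (k i) 2 σ := fun i => by
    rw [← eLpNorm_eq_l2, eLpNorm_congr_ae (hkg i)]
  have hgfin : ∀ i, l2 (fun x => ‖g i x‖ₑ) ≠ ∞ := fun i => by
    rw [hgl2]; exact (hkL i).2.ne
  have hrot : ∀ i : Fin 5, ∀ s : Fin 4, k i = f s → ∀ t ∈ Set.Ioc (0 : ℝ) 1,
      l2 (fun x => ‖g i (rot t x) - g i x‖ₑ) ≤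
        ((HNorm ε (f s)).toNNReal : ℝ≥0∞) * ENNReal.ofReal (t ^ α) := by
    intro i s his t ht
    rw [← eLpNorm_eq_l2, ← eLpNorm_rot_sub_congr (hkg i), his, ENNReal.coe_toNNReal (hf s).2.ne]
    have := eLpNorm_rot_sub_le (s := ε) (hf s).1 (t := t) (by rw [abs_pos]; exact ht.1.ne')
      (by rw [abs_of_pos ht.1]; exact ht.2)
    rwa [abs_of_pos ht.1] at this
  have hsize : ∀ i : Fin 5, ∀ s : Fin 4, k i = f s →
      l2 (fun x => ‖g i x‖ₑ) ≤ HNorm ε (f s) := fun i s his => by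
    rw [hgl2, his]; exact eLpNorm_le_HNorm _ _
  have hsize' : ∀ i : Fin 5, ∀ s : Fin 4, k i = f s →
      l2 (fun x => ‖g i x‖ₑ) ≤ ((HNorm ε (f s)).toNNReal : ℝ≥0∞) := fun i s his => by
    rw [ENNReal.coe_toNNReal (hf s).2.ne]; exact hsize i s his
  -- Indices `0` and `1` supply the Hölder regularity; `2`, `4` and `3` enter only through their
  -- `L²` norms.
  obtain ⟨F, hFm, hFlim, hF2, hFrot⟩ := exists_discConv_limit (hgm 0) (hgm 1) (hgm 2) (hgm 4)
    (hgm 3) hα0 hα1 (hsize' 0 0 rfl) (hsize' 1 1 rfl) (hrot 0 0 rfl) (hrot 1 1 rfl)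
    (hgfin 2) (hgfin 4) (hgfin 3) rfl
  simp only [ENNReal.coe_toNNReal (hf _).2.ne] at hF2 hFrot
  set L := HNorm ε (f 0) * HNorm ε (f 1) *
    (l2 (fun x => ‖g 2 x‖ₑ) * l2 (fun x => ‖g 4 x‖ₑ) * l2 (fun x => ‖g 3 x‖ₑ)) with hL
  have hLtop : L ≠ ∞ := by
    have h0 := (hf 0).2.ne
    have h1 := (hf 1).2.ne
    have h2 := hgfin 2
    have h3 := hgfin 3
    have h4 := hgfin 4
    finiteness
  have hFL : MemLp F 2 σ :=
    ⟨hFm.aestronglyMeasurable, by rw [eLpNorm_eq_l2]; exact hF2.trans_lt (by finiteness)⟩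
  have hH : HNorm (α / 80) F ≤ 3 * 10 ^ 11 * L := by
    refine (HNorm_le (by linarith) hFL (B := 10 ^ 11 * L) fun t h0 h1 => ?_).trans ?_
    · rw [eLpNorm_eq_l2]; exact hFrot t h0 h1
    · rw [eLpNorm_eq_l2]
      calc _ ≤ 10 ^ 11 * L + 2 * (10 ^ 11 * L) := by gcongr
        _ = _ := by ring
  refine ⟨F, ⟨hFL, ?_⟩, ⟨hFL, hH.trans_lt (by finiteness)⟩, hH.trans ?_⟩
  · refine hFlim.congr' ?_
    filter_upwards [self_mem_nhdsWithin] with r hr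
    rw [eLpNorm_eq_l2]
    simp_rw [convMeasure_ball_div hgm (fun i => (hgL i).integrable (by norm_num)) hkg hr]
  · have e4 : l2 (fun x => ‖g 4 x‖ₑ) = eLpNorm h 2 σ := hgl2 4
    rw [hL, e4, Fin.prod_univ_four]
    push_cast
    calc _ ≤ 3 * 10 ^ 11 * (HNorm ε (f 0) * HNorm ε (f 1) *
          (HNorm ε (f 2) * eLpNorm h 2 σ * HNorm ε (f 3))) := by
          gcongr
          exacts [hsize 2 2 rfl, hsize 3 3 rfl]
      _ = _ := by ring
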